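/- **Setting.** Let $G$ be a compact Lie group and $H\subset G$ a closed subgroup such that the homogeneous space $M=G/H$ is connected and almost effective (the kernel of the $G$-action on $M$ is discrete). Fix an $\mathrm{Ad}(G)$-invariant inner product $Q$ on $\mathfrak g=\mathrm{Lie}(G)$, let $\mathfrak h=\mathrm{Lie}(H)$, and let $\mathfrak m$ be the $Q$-orthogonal complement of $\mathfrak h$ in $\mathfrak g$, identified with $T_{eH}M$. In this way $G$-invariant metrics on $M$ correspond to $\mathrm{Ad}(H)$-invariant inner products on $\mathfrak m$. Let $\Sigma$ be the set of $Q$-symmetric, $\mathrm{Ad}(H)$-equivariant endomorphisms $v$ of $\mathfrak m$ with $\operatorname{Tr}(v^2)=1$ and $\operatorname{Tr}(v)=0$. For $v\in\Sigma$ and $t\in\mathbb R$ let $\gamma_v(t)$ be the $G$-invariant metric on $M$ given on $\mathfrak m$ by $Q(e^{tv}\,\cdot\,,\cdot)$; $\gamma_v$ is the geodesic with $\gamma_v(0)=Q|_{\mathfrak m}$ and initial velocity $v$ in the symmetric space of $G$-invariant metrics with the same volume as $Q|_{\mathfrak m}$ (unit volume, after normalising $Q$). A *good decomposition* for $v\in\Sigma$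 is a $Q$-orthogonal decomposition $\mathfrak m=\mathfrak m_1+\dots+\mathfrak m_\ell$ into $\mathrm{Ad}(H)$-invariant irreducible subspaces with $v|_{\mathfrak m_i}=v_i\,\mathrm{Id}$ for real numbers $v_i$. For such a decomposition put $[ijk]=\sum Q([e_\alpha,e_\beta],e_\gamma)^2$, where $e_\alpha,e_\beta,e_\gamma$ run through $Q$-orthonormal bases of $\mathfrak m_i,\mathfrak m_j,\mathfrak m_k$. Let $\hat v_1$ be the smallest eigenvalue of $v$. The direction $v\in\Sigma$ is a *submersion direction* if, for every good decomposition for $v$ and all $i,j,k$, $[ijk]>0$ implies $v_i-v_j-v_k+\hat v_1\le 0$. An *$H$-subalgebra* is an $\mathrm{Ad}(H)$-invariant Lie subalgebra $\mathfrak k$ with $\mathfrak h\subsetneq\mathfrak k\subsetneq\mathfrak g$; it is *toral* if $[\mathfrak k,\mathfrak k]\subset\mathfrak h$, and *non-toral* otherwise. A submersion direction $v$ is a *$\mathfrak k$-submersion direction* if $\sum_{i:\,v_i=\hat v_1}\mathfrak m_i=\mathfrak k\cap\mathfrak m$ for every good decomposition for $v$. **Theorem.** Let $\mathfrak k_1$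 be a non-toral $H$-subalgebra and let $v$ be a $\mathfrak k_1$-submersion direction. Then the norm of the Ricci tensor of $\gamma_v(t)$, measured with $\gamma_v(t)$, satisfies $$\lim_{t\to+\infty}\big|\mathrm{Ric}(\gamma_v(t))\big|_{\gamma_v(t)}=+\infty$$ at every point of $M$. -/

import Mathlib

open scoped Manifold ContDiff

noncomputable section

namespace HomogeneousSpace

/-! ### Riemannian curvature in a chart -/

section Curvature

variable {V : Type*} [AddCommGroup V] [Module ℝ V]

/-- A basis of the subspace `W` which is orthonormal for the inner product `B`. -/
def orthonormalFrame (B : V → V → ℝ) (W : Submodule ℝ V) : Fin (Module.finrank ℝ W) → V :=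
  Classical.epsilon fun e =>
    (∀ i, e i ∈ W) ∧ ∀ i j, B (e i) (e j) = if i = j then 1 else 0

/-- The choice in `orthonormalFrame` is from a non-empty set. -/
theorem orthonormalFrame_spec [FiniteDimensional ℝ V] (B : LinearMap.BilinForm ℝ V)
    (hsymm : ∀ X Y, B X Y = B Y X) (hpos : ∀ X, X ≠ 0 → 0 < B X X) (W : Submodule ℝ V) :
    (∀ i, orthonormalFrame (fun X Y => B X Y) W i ∈ W) ∧
      ∀ i j, B (orthonormalFrame (fun X Y => B X Y) W i)
        (orthonormalFrame (fun X Y => B X Y) W j) = if i = j then 1 else 0 := by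
  refine Classical.epsilon_spec (p := fun e : Fin (Module.finrank ℝ W) → V =>
    (∀ i, e i ∈ W) ∧ ∀ i j, B (e i) (e j) = if i = j then 1 else 0) ?_
  let c : InnerProductSpace.Core ℝ W :=
    { inner := fun X Y => B X Y
      conj_inner_symm := fun X Y => by simpa using hsymm Y X
      re_inner_nonneg := fun X => by
        by_cases h : (X : V) = 0
        · simp [h]
        · simpa using (hpos X h).le
      add_left := fun X Y Z => by simp
      smul_left := fun X Y r => by simp
      definite := fun X h => by
        by_contra hX
        have hX' : (X : V) ≠ 0 := fun h0 => hX (Subtype.ext h0)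
        exact (hpos X hX').ne' h }
  let _ : NormedAddCommGroup W := c.toNormedAddCommGroup
  let _ : InnerProductSpace ℝ W := InnerProductSpace.ofCore c.toCore
  let b := stdOrthonormalBasis ℝ W
  refine ⟨fun i => (b i : V), fun i => (b i).2, fun i j => ?_⟩
  exact (orthonormal_iff_ite.mp b.orthonormal) i j

variable {F : Type*} [NormedAddCommGroup F] [NormedSpace ℝ F]

/-- An orthonormal basis of `F` for the value at `y` of a metric `h` given in a chart. -/
def frameAt (h : F → LinearMap.BilinForm ℝ F) (y : F) :
    Fin (Module.finrank ℝ (⊤ : Submodule ℝ F)) → F :=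
  orthonormalFrame (fun u w => h y u w) ⊤

/-- Christoffel symbols of the first kind of the metric `h` at `y`. -/
def christoffelLower (h : F → LinearMap.BilinForm ℝ F) (y u w z : F) : ℝ :=
  (1 / 2) * (fderiv ℝ (fun y' => h y' w z) y u + fderiv ℝ (fun y' => h y' u z) y w
    - fderiv ℝ (fun y' => h y' u w) y z)

/-- Christoffel symbols of the second kind: `christoffel h y u w` is the vector representing
`christoffelLower h y u w` through the inner product `h y`. It is the covariant derivative at `y`,
for the Levi-Civita connection of `h`, of the constant field `w` in the direction `u`. -/
def christoffel (h : F → LinearMap.BilinForm ℝ F) (y u w : F) : F :=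
  ∑ i, christoffelLower h y u w (frameAt h y i) • frameAt h y i

/-- The Riemann curvature tensor `R(u, w) z` of the metric `h` at `y`. -/
def riemann (h : F → LinearMap.BilinForm ℝ F) (y u w z : F) : F :=
  fderiv ℝ (fun y' => christoffel h y' w z) y u - fderiv ℝ (fun y' => christoffel h y' u z) y w
    + christoffel h y u (christoffel h y w z) - christoffel h y w (christoffel h y u z)

/-- The Ricci tensor at `y`: `Ric(w, z)` is the trace of `u ↦ R(u, w) z`. -/
def ricci (h : F → LinearMap.BilinForm ℝ F) (y w z : F) : ℝ :=
  ∑ i, h y (riemann h y (frameAt h y i) w z) (frameAt h y i)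

/-- The norm of the Ricci tensor at `y`, measured with the metric `h y` itself. -/
def ricciNormCoord (h : F → LinearMap.BilinForm ℝ F) (y : F) : ℝ :=
  Real.sqrt (∑ i, ∑ j, ricci h y (frameAt h y i) (frameAt h y j) ^ 2)

variable {M : Type*} [TopologicalSpace M] [ChartedSpace F M]

/-- The expression of a Riemannian metric `g` on `M` in the preferred chart at `x`. -/
def chartMetric (g : ∀ x : M, LinearMap.BilinForm ℝ (TangentSpace 𝓘(ℝ, F) x)) (x : M) (y : F) :
    LinearMap.BilinForm ℝ F :=
  let D : F →ₗ[ℝ] TangentSpace 𝓘(ℝ, F) ((extChartAt 𝓘(ℝ, F) x).symm y) :=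
    (mfderiv 𝓘(ℝ, F) 𝓘(ℝ, F) (extChartAt 𝓘(ℝ, F) x).symm y).toLinearMap
  (g ((extChartAt 𝓘(ℝ, F) x).symm y)).comp D D

/-- The norm `|Ric(g)|_g` at the point `x` of the Ricci tensor of a Riemannian metric `g`. -/
def ricciNorm (g : ∀ x : M, LinearMap.BilinForm ℝ (TangentSpace 𝓘(ℝ, F) x)) (x : M) : ℝ :=
  ricciNormCoord (chartMetric g x) (extChartAt 𝓘(ℝ, F) x x)

end Curvature

/-! ### Homogeneous spaces -/

section Homogeneous

variable {E : Type*} [NormedAddCommGroup E] [NormedSpace ℝ E]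
  {G : Type*} [TopologicalSpace G] [ChartedSpace E G] [Group G]
  (F : Type*) [NormedAddCommGroup F] [NormedSpace ℝ F]
  (H : Subgroup G) [ChartedSpace F (G ⧸ H)]

variable (E) in
/-- The given smooth structure on `G ⧸ H` is the one of the homogeneous space: the projection
`G → G ⧸ H` is a smooth submersion. -/
structure IsQuotientManifold : Prop where
  contMDiff : ContMDiff 𝓘(ℝ, E) 𝓘(ℝ, F) ∞ (fun a : G => (a : G ⧸ H))
  submersion : ∀ a : G,
    Function.Surjective (mfderiv 𝓘(ℝ, E) 𝓘(ℝ, F) (fun a : G => (a : G ⧸ H)) a)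

/-- The adjoint representation: `Ad a` is the differential at `1` of `x ↦ a * x * a⁻¹`. -/
def Ad (a : G) : GroupLieAlgebra 𝓘(ℝ, E) G →ₗ[ℝ] GroupLieAlgebra 𝓘(ℝ, E) G :=
  (show TangentSpace 𝓘(ℝ, E) (1 : G) →L[ℝ] TangentSpace 𝓘(ℝ, E) (1 : G) from
    mfderiv 𝓘(ℝ, E) 𝓘(ℝ, E) (fun x : G => a * x * a⁻¹) 1).toLinearMap

/-- The differential at `1` of the projection `G → G ⧸ H`. -/
def projDeriv : GroupLieAlgebra 𝓘(ℝ, E) G →ₗ[ℝ] TangentSpace 𝓘(ℝ, F) ((1 : G) : G ⧸ H) :=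
  (mfderiv 𝓘(ℝ, E) 𝓘(ℝ, F) (fun a : G => (a : G ⧸ H)) 1).toLinearMap

variable (E) in
/-- The Lie algebra `𝔥` of `H`: the tangent space at `1` of `H`, the fibre of the submersion
`G → G ⧸ H` through `1`. -/
def isotropyAlgebra : Submodule ℝ (GroupLieAlgebra 𝓘(ℝ, E) G) :=
  LinearMap.ker (projDeriv F H)

/-- `Q` is an `Ad(G)`-invariant Euclidean inner product on the Lie algebra of `G`. -/
structure IsAdInvariantInner (Q : LinearMap.BilinForm ℝ (GroupLieAlgebra 𝓘(ℝ, E) G)) : Prop where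
  symm : ∀ X Y, Q X Y = Q Y X
  pos : ∀ X, X ≠ 0 → 0 < Q X X
  invariant : ∀ (a : G) X Y, Q (Ad a X) (Ad a Y) = Q X Y

/-- The subspace `W` of the Lie algebra of `G` is `Ad(H)`-invariant. -/
def IsAdInvariant (W : Submodule ℝ (GroupLieAlgebra 𝓘(ℝ, E) G)) : Prop :=
  ∀ h ∈ H, ∀ X ∈ W, Ad h X ∈ W

variable (Q : LinearMap.BilinForm ℝ (GroupLieAlgebra 𝓘(ℝ, E) G))

/-- `𝔪`, the `Q`-orthogonal complement of `𝔥`. -/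
def complement : Submodule ℝ (GroupLieAlgebra 𝓘(ℝ, E) G) :=
  Q.orthogonal (isotropyAlgebra E F H)

variable {F H}

/-- `g` is the `G`-invariant metric on `G ⧸ H` which corresponds to the inner product `B` on `𝔪`
under the identification of `𝔪` with the tangent space at the base point. -/
structure IsInvariantMetricOf
    (g : ∀ x : G ⧸ H, LinearMap.BilinForm ℝ (TangentSpace 𝓘(ℝ, F) x))
    (B : complement F H Q → complement F H Q → ℝ) : Prop where
  invariant : ∀ (a : G) (x : G ⧸ H) (u w : TangentSpace 𝓘(ℝ, F) x),
    g (a • x) (mfderiv 𝓘(ℝ, F) 𝓘(ℝ, F) (fun z : G ⧸ H => a • z) x u)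
      (mfderiv 𝓘(ℝ, F) 𝓘(ℝ, F) (fun z : G ⧸ H => a • z) x w) = g x u w
  eval_base : ∀ X Y : complement F H Q,
    g ((1 : G) : G ⧸ H) (projDeriv F H (X : GroupLieAlgebra 𝓘(ℝ, E) G))
      (projDeriv F H (Y : GroupLieAlgebra 𝓘(ℝ, E) G)) = B X Y

/-- The inner product `Q(exp(t v) X, Y)` on `𝔪`. As `t` varies it is the geodesic issuing from the
restriction of `Q` to `𝔪` with velocity `v`, in the symmetric space of inner products on `𝔪`. It
multiplies `Q` by `exp(t μ)` on the eigenspace of `v` for the eigenvalue `μ`. -/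
def geodesic (v : Module.End ℝ (complement F H Q)) (t : ℝ) (X Y : complement F H Q) : ℝ :=
  ∑' n : ℕ, t ^ n / (n.factorial : ℝ) * Q ((v ^ n) X) Y

/-- `v` is in the unit sphere of the tangent space at `Q` of the space of `G`-invariant metrics of
unit volume: a `Q`-symmetric, `Ad(H)`-equivariant endomorphism of `𝔪` with `Tr(v²) = 1`, `Tr v = 0`. -/
structure IsUnitDirection (v : Module.End ℝ (complement F H Q)) : Prop where
  symm : ∀ X Y : complement F H Q, Q (v X) Y = Q X (v Y)
  equivariant : ∀ h ∈ H, ∀ X Y : complement F H Q, Ad h (X : GroupLieAlgebra 𝓘(ℝ, E) G) = Y →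
    Ad h (v X : GroupLieAlgebra 𝓘(ℝ, E) G) = v Y
  trace_sq : LinearMap.trace ℝ _ (v * v) = 1
  trace_zero : LinearMap.trace ℝ _ v = 0

/-- `φ` is an ordered, `Q`-orthogonal, `Ad(H)`-invariant, irreducible decomposition of `𝔪`. -/
structure IsDecomposition {l : ℕ} (φ : Fin l → Submodule ℝ (GroupLieAlgebra 𝓘(ℝ, E) G)) :
    Prop where
  iSup_eq : ⨆ i, φ i = complement F H Q
  orthogonal : ∀ i j, i ≠ j → ∀ X ∈ φ i, ∀ Y ∈ φ j, Q X Y = 0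
  invariant : ∀ i, IsAdInvariant H (φ i)
  ne_bot : ∀ i, φ i ≠ ⊥
  irreducible : ∀ i, ∀ W ≤ φ i, IsAdInvariant H W → W = ⊥ ∨ W = φ i

/-- `φ` is a good decomposition for `v`, and `v` is multiplication by `c i` on `φ i`. -/
structure IsGoodDecomposition (v : Module.End ℝ (complement F H Q)) {l : ℕ}
    (φ : Fin l → Submodule ℝ (GroupLieAlgebra 𝓘(ℝ, E) G)) (c : Fin l → ℝ) : Prop where
  isDecomposition : IsDecomposition (F := F) (H := H) Q φ
  eigen : ∀ i, ∀ X : complement F H Q, (X : GroupLieAlgebra 𝓘(ℝ, E) G) ∈ φ i → v X = c i • X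

/-- The coefficient `[A B C]`: the sum of `Q([e_α, e_β], e_γ)²` over `Q`-orthonormal bases
`(e_α)`, `(e_β)`, `(e_γ)` of `A`, `B`, `C`. -/
def bracketCoeff (A B C : Submodule ℝ (GroupLieAlgebra 𝓘(ℝ, E) G)) : ℝ :=
  ∑ α, ∑ β, ∑ γ,
    Q ⁅orthonormalFrame (fun X Y => Q X Y) A α, orthonormalFrame (fun X Y => Q X Y) B β⁆
      (orthonormalFrame (fun X Y => Q X Y) C γ) ^ 2

/-- The smallest eigenvalue of `v`. -/
def minEigenvalue (v : Module.End ℝ (complement F H Q)) : ℝ :=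
  sInf {μ : ℝ | v.HasEigenvalue μ}

/-- `v` is a submersion direction. -/
structure IsSubmersionDirection (v : Module.End ℝ (complement F H Q)) : Prop where
  isUnitDirection : IsUnitDirection Q v
  nonpos : ∀ (l : ℕ) (φ : Fin l → Submodule ℝ (GroupLieAlgebra 𝓘(ℝ, E) G)) (c : Fin l → ℝ),
    IsGoodDecomposition Q v φ c → ∀ i j k, 0 < bracketCoeff Q (φ i) (φ j) (φ k) →
      c i - c j - c k + minEigenvalue Q v ≤ 0

variable (F H) in
/-- `𝔨` is an `H`-subalgebra: an `Ad(H)`-invariant Lie subalgebra strictly between `𝔥` and `𝔤`. -/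
structure IsHSubalgebra (𝔨 : Submodule ℝ (GroupLieAlgebra 𝓘(ℝ, E) G)) : Prop where
  lie_mem : ∀ X ∈ 𝔨, ∀ Y ∈ 𝔨, ⁅X, Y⁆ ∈ 𝔨
  isotropy_lt : isotropyAlgebra E F H < 𝔨
  lt_top : 𝔨 < ⊤
  invariant : IsAdInvariant H 𝔨

variable (F H) in
/-- `𝔨` is toral: `[𝔨, 𝔨] ⊆ 𝔥`. -/
def IsToral (𝔨 : Submodule ℝ (GroupLieAlgebra 𝓘(ℝ, E) G)) : Prop :=
  ∀ X ∈ 𝔨, ∀ Y ∈ 𝔨, ⁅X, Y⁆ ∈ isotropyAlgebra E F H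

/-- `v` is a `𝔨`-submersion direction: it is a submersion direction and, for every good
decomposition, the sum of the summands with the smallest eigenvalue is `𝔪_𝔨 = 𝔨 ∩ 𝔪`. -/
structure IsSubmersionDirectionFor (𝔨 : Submodule ℝ (GroupLieAlgebra 𝓘(ℝ, E) G))
    (v : Module.End ℝ (complement F H Q)) : Prop where
  isSubmersionDirection : IsSubmersionDirection Q v
  first_eq : ∀ (l : ℕ) (φ : Fin l → Submodule ℝ (GroupLieAlgebra 𝓘(ℝ, E) G)) (c : Fin l → ℝ),
    IsGoodDecomposition Q v φ c →
      ⨆ (i : Fin l) (_ : c i = minEigenvalue Q v), φ i = 𝔨 ⊓ complement F H Q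

end Homogeneous

end HomogeneousSpace

end

open scoped Manifold ContDiff Topology

set_option maxSynthPendingDepth 3
set_option linter.unusedSectionVars false

noncomputable section

/-! Write `c` for the smallest eigenvalue of `v`. Since `Tr v = 0` and `Tr v² = 1`, `c < 0`
(`minEigenvalue_neg`). A vector `X` of `𝔨₁ ∩ 𝔪` is a `c`-eigenvector, so its squared length in
`γ_v(t)` is `exp(tc) Q(X,X)`, which tends to zero. It is therefore enough to find such an `X` with
`Ric(X,X)` bounded below by a positive constant independent of `t`: as `Ric(X,X) ≤ |Ric| |X|²`
(`ricci_le`), the norm then grows at least like `exp(-tc)`.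

The Ricci curvature comes from Bochner's formula for the Killing field `K` of `X`. If `|K|²` is
stationary at the point, then `g(R(u,K)K,u) = |∇_u K|² - ½ Hess|K|²(u,u)`
(`riemann_killing_bochner`). Killing fields turn derivatives of inner products into brackets, and
Koszul's formula does the same for `∇K`; hence `Ric(X,X)` is an algebraic sum over a basis of `𝔪`
(`IsKillingFamily.ricci_eq`). The length is stationary because `γ_v(t)(·,X)` is a multiple of
`Q(·,X)` and `Q([Z,X],X) = 0`.

When one of the two lower eigenvalues in the submersion inequality is `c`, it cancels against the
added `c`. Together with the symmetry of `[ijk]` this shows that `ad X` does not mix different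
eigenspaces of `v`, up to components in `𝔥` (`IsSubmersionDirectionFor.lie_eq_zero`). Take a
`Q`-orthonormal eigenbasis `e_i` with eigenvalues `μ_i`, and put `σ = exp(t(c - μ_i))`, `N =
|[X,e_i]|²_Q`, and `S ≤ N` the same for the `𝔪`-component of `[X,e_i]`. The `i`-th term of the Ricci
sum is then `σ(N - S) + σ²S/4`. It is never negative, and for `μ_i = c` it is at least `N/4`
whatever `t` is (`le_ricci_sum`).

The bound is positive once `[X,Y] ≠ 0` for some `Y` in `𝔨₁ ∩ 𝔪`, and non-torality provides such a
pair (`IsHSubalgebra.exists_lie_ne_zero`). The remaining work links the abstract Killing algebra to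
the group: in charts, invariant metrics are smooth, the fundamental fields of the action are
Killing, and their bracket is the opposite of that of `𝔤`. -/

namespace HomogeneousSpace

/-! ### Linear algebra of orthonormal families. -/

section Algebra

variable {V : Type*} [AddCommGroup V] [Module ℝ V]

/-- A family orthonormal for a bilinear form is linearly independent. -/
theorem linearIndependent_of_orthonormal {ι : Type*} [DecidableEq ι]
    (B : LinearMap.BilinForm ℝ V) (e : ι → V)
    (he : ∀ i j, B (e i) (e j) = if i = j then 1 else 0) : LinearIndependent ℝ e := by
  rw [linearIndependent_iff']
  intro s g hg i hi
  have := congrArg (fun x => B x (e i)) hg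
  simpa [LinearMap.BilinForm.sum_left, he, hi] using this

/-- An orthonormal family of full cardinality expands every vector. -/
theorem sum_smul_of_orthonormal {ι : Type*} [Fintype ι] [DecidableEq ι] [FiniteDimensional ℝ V]
    (B : LinearMap.BilinForm ℝ V) (e : ι → V)
    (he : ∀ i j, B (e i) (e j) = if i = j then 1 else 0)
    (hcard : Fintype.card ι = Module.finrank ℝ V) (x : V) : ∑ i, B x (e i) • e i = x := by
  have hspan : Submodule.span ℝ (Set.range e) = ⊤ :=
    (linearIndependent_of_orthonormal B e he).span_eq_top_of_card_eq_finrank' hcard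
  have hx : x ∈ Submodule.span ℝ (Set.range e) := by rw [hspan]; trivial
  obtain ⟨c, rfl⟩ := (Submodule.mem_span_range_iff_exists_fun ℝ).1 hx
  refine Finset.sum_congr rfl fun i _ => ?_
  simp [he]

/-- The trace of a bilinear form is independent of the orthonormal basis. -/
theorem sum_diag_eq_of_orthonormal {ι κ : Type*} [Fintype ι] [DecidableEq ι] [Fintype κ]
    [DecidableEq κ] [FiniteDimensional ℝ V] (B T : LinearMap.BilinForm ℝ V)
    (hsymm : ∀ x y, B x y = B y x) (e : ι → V) (f : κ → V)
    (he : ∀ i j, B (e i) (e j) = if i = j then 1 else 0)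
    (hf : ∀ i j, B (f i) (f j) = if i = j then 1 else 0)
    (hcarde : Fintype.card ι = Module.finrank ℝ V)
    (hcardf : Fintype.card κ = Module.finrank ℝ V) :
    ∑ i, T (e i) (e i) = ∑ k, T (f k) (f k) := by
  have h1 : ∀ i, T (e i) (e i) = ∑ k, B (e i) (f k) * T (f k) (e i) := by
    intro i
    conv_lhs => rw [← sum_smul_of_orthonormal B f hf hcardf (e i)]
    rw [LinearMap.BilinForm.sum_left]
    refine Finset.sum_congr rfl fun k _ => ?_
    rw [LinearMap.BilinForm.smul_left, sum_smul_of_orthonormal B f hf hcardf (e i)]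
  have h2 : ∀ k, T (f k) (f k) = ∑ i, B (f k) (e i) * T (f k) (e i) := by
    intro k
    conv_lhs => rw [← sum_smul_of_orthonormal B e he hcarde (f k)]
    rw [LinearMap.BilinForm.sum_right]
    refine Finset.sum_congr rfl fun i _ => ?_
    rw [LinearMap.BilinForm.smul_right, sum_smul_of_orthonormal B e he hcarde (f k)]
  simp_rw [h1, h2]
  rw [Finset.sum_comm]
  simp_rw [hsymm]

/-- The squared length in terms of coordinates in an orthonormal basis. -/
theorem apply_eq_sum_of_orthonormal {ι : Type*} [Fintype ι] [DecidableEq ι]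
    [FiniteDimensional ℝ V] (B : LinearMap.BilinForm ℝ V) (hsymm : ∀ x y, B x y = B y x) (e : ι → V)
    (he : ∀ i j, B (e i) (e j) = if i = j then 1 else 0)
    (hcard : Fintype.card ι = Module.finrank ℝ V) (x y : V) :
    B x y = ∑ i, B x (e i) * B y (e i) := by
  conv_lhs => rw [← sum_smul_of_orthonormal B e he hcard x]
  rw [LinearMap.BilinForm.sum_left]
  refine Finset.sum_congr rfl fun i _ => ?_
  rw [LinearMap.BilinForm.smul_left, hsymm (e i) y]

/-- An endomorphism symmetric for an inner product has an orthonormal basis of eigenvectors. -/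
theorem exists_orthonormal_eigenvectors [FiniteDimensional ℝ V] (B : LinearMap.BilinForm ℝ V)
    (hsymm : ∀ x y, B x y = B y x) (hpos : ∀ x, x ≠ 0 → 0 < B x x) (T : Module.End ℝ V)
    (hT : ∀ x y, B (T x) y = B x (T y)) :
    ∃ (e : Module.Basis (Fin (Module.finrank ℝ V)) ℝ V) (μ : Fin (Module.finrank ℝ V) → ℝ),
      (∀ i j, B (e i) (e j) = if i = j then 1 else 0) ∧ ∀ i, T (e i) = μ i • e i := by
  let c : InnerProductSpace.Core ℝ V :=
    { inner := fun X Y => B X Y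
      conj_inner_symm := fun X Y => by simpa using hsymm Y X
      re_inner_nonneg := fun X => by
        by_cases h : X = 0
        · simp [h]
        · simpa using (hpos X h).le
      add_left := fun X Y Z => by simp
      smul_left := fun X Y r => by simp
      definite := fun X h => by
        by_contra hX
        exact (hpos X hX).ne' h }
  let _ : NormedAddCommGroup V := c.toNormedAddCommGroup
  let _ : InnerProductSpace ℝ V := InnerProductSpace.ofCore c.toCore
  have hS : T.IsSymmetric := fun x y => hT x y
  let b := hS.eigenvectorBasis rfl
  refine ⟨b.toBasis, hS.eigenvalues rfl, fun i j => ?_, fun i => ?_⟩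
  · rw [OrthonormalBasis.coe_toBasis]
    exact (orthonormal_iff_ite.mp b.orthonormal) i j
  · rw [OrthonormalBasis.coe_toBasis]
    exact hS.apply_eigenvectorBasis rfl i

end Algebra

/-! ### Leibniz rules and second derivatives. -/

section Calculus

variable {F : Type*} [NormedAddCommGroup F] [NormedSpace ℝ F]
  {E₁ : Type*} [NormedAddCommGroup E₁] [NormedSpace ℝ E₁]
  {E₂ : Type*} [NormedAddCommGroup E₂] [NormedSpace ℝ E₂]
  {E₃ : Type*} [NormedAddCommGroup E₃] [NormedSpace ℝ E₃]

/-- Leibniz rule for a field of bilinear maps applied to two vector fields. -/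
theorem fderiv_bilinear_apply {a : F → E₁ →L[ℝ] E₂ →L[ℝ] E₃} {V : F → E₁} {W : F → E₂} {y : F}
    (ha : DifferentiableAt ℝ a y) (hV : DifferentiableAt ℝ V y) (hW : DifferentiableAt ℝ W y)
    (u : F) :
    fderiv ℝ (fun y => a y (V y) (W y)) y u =
      fderiv ℝ a y u (V y) (W y) + a y (fderiv ℝ V y u) (W y) + a y (V y) (fderiv ℝ W y u) := by
  rw [((ha.hasFDerivAt.clm_apply hV.hasFDerivAt).clm_apply hW.hasFDerivAt).fderiv]
  simp
  abel

theorem fderiv_linear_apply {a : F → E₁ →L[ℝ] E₃} {V : F → E₁} {y : F}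
    (ha : DifferentiableAt ℝ a y) (hV : DifferentiableAt ℝ V y) (u : F) :
    fderiv ℝ (fun y => a y (V y)) y u = fderiv ℝ a y u (V y) + a y (fderiv ℝ V y u) := by
  rw [(ha.hasFDerivAt.clm_apply hV.hasFDerivAt).fderiv]
  simp
  abel

theorem differentiableAt_fderiv_of_contDiffAt_two {f : F → E₃} {y : F} (hf : ContDiffAt ℝ 2 f y) :
    DifferentiableAt ℝ (fderiv ℝ f) y :=
  (hf.fderiv_right (m := 1) (by norm_num)).differentiableAt (by norm_num)

theorem differentiableAt_of_contDiffAt_two {f : F → E₃} {y : F} (hf : ContDiffAt ℝ 2 f y) :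
    DifferentiableAt ℝ f y := hf.differentiableAt (by norm_num)

theorem second_fderiv_symm {f : F → E₃} {y : F} (hf : ContDiffAt ℝ 2 f y) (u w : F) :
    fderiv ℝ (fderiv ℝ f) y u w = fderiv ℝ (fderiv ℝ f) y w u :=
  hf.isSymmSndFDerivAt (by simp) u w

end Calculus

/-! ### The Levi-Civita connection in a chart. -/

section ChartCurvature

variable {F : Type*} [NormedAddCommGroup F] [NormedSpace ℝ F] [FiniteDimensional ℝ F]

/-- The frame used to contract tensors in a chart is orthonormal and spans. -/
theorem frameAt_orthonormal {h : F → LinearMap.BilinForm ℝ F} {y : F}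
    (hsymm : ∀ u w, h y u w = h y w u) (hpos : ∀ u, u ≠ 0 → 0 < h y u u) (i j) :
    h y (frameAt h y i) (frameAt h y j) = if i = j then 1 else 0 :=
  (orthonormalFrame_spec (h y) hsymm hpos ⊤).2 i j

theorem apply_christoffel {h : F → LinearMap.BilinForm ℝ F} {a : F → F →L[ℝ] F →L[ℝ] ℝ}
    (ha : ∀ y u w, h y u w = a y u w) {y : F} (hd : DifferentiableAt ℝ a y)
    (hsymm : ∀ u w, h y u w = h y w u) (hpos : ∀ u, u ≠ 0 → 0 < h y u u) (u w z : F) :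
    h y (christoffel h y u w) z = (1 / 2) * (fderiv ℝ a y u w z + fderiv ℝ a y w u z
      - fderiv ℝ a y z u w) := by
  have hlow : ∀ z, christoffelLower h y u w z = (1 / 2) * (fderiv ℝ a y u w z + fderiv ℝ a y w u z
      - fderiv ℝ a y z u w) := by
    intro z
    have key : ∀ p q r : F, fderiv ℝ (fun y' => h y' p q) y r = fderiv ℝ a y r p q := by
      intro p q r
      simp_rw [ha]
      rw [fderiv_bilinear_apply hd (differentiableAt_const p) (differentiableAt_const q)]
      simp
    simp only [christoffelLower, key]
  have hadd : ∀ z, (1 / 2) * (fderiv ℝ a y u w z + fderiv ℝ a y w u z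
      - fderiv ℝ a y z u w) = ((1 / 2 : ℝ) • (fderiv ℝ a y u w + fderiv ℝ a y w u
      - ((fderiv ℝ a y).flip u).flip w)) z := by
    intro z; simp
  simp only [christoffel, hlow]
  simp only [hadd]
  set ℓ := (1 / 2 : ℝ) • (fderiv ℝ a y u w + fderiv ℝ a y w u
      - ((fderiv ℝ a y).flip u).flip w)
  have hz := sum_smul_of_orthonormal (h y) (frameAt h y) (frameAt_orthonormal hsymm hpos)
    (by simp) z
  conv_rhs => rw [← hz]
  rw [LinearMap.BilinForm.sum_left, map_sum]
  refine Finset.sum_congr rfl fun i _ => ?_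
  rw [LinearMap.BilinForm.smul_left, map_smul, smul_eq_mul, hsymm z, mul_comm]

/-- The Christoffel symbols of a `C²` metric are, near the point, a `C¹` field of symmetric bilinear
maps compatible with the metric. -/
theorem exists_connection {h : F → LinearMap.BilinForm ℝ F} {a : F → F →L[ℝ] F →L[ℝ] ℝ}
    (ha : ∀ y u w, h y u w = a y u w) {y₀ : F} (hd : ContDiffAt ℝ 2 a y₀)
    (hsymm : ∀ᶠ y in 𝓝 y₀, ∀ u w, h y u w = h y w u)
    (hpos : ∀ᶠ y in 𝓝 y₀, ∀ u, u ≠ 0 → 0 < h y u u) :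
    ∃ Γ : F → F →L[ℝ] F →L[ℝ] F, ContDiffAt ℝ 1 Γ y₀ ∧
      ∀ᶠ y in 𝓝 y₀, (∀ u w, christoffel h y u w = Γ y u w) ∧ (∀ u w, Γ y u w = Γ y w u) ∧
        ∀ u w z, fderiv ℝ a y u w z = a y (Γ y u w) z + a y w (Γ y u z) := by
  let D : F → F →L[ℝ] F →L[ℝ] F →L[ℝ] ℝ := fderiv ℝ a
  let fl := (ContinuousLinearMap.flipₗᵢ ℝ F F ℝ).toContinuousLinearEquiv.toContinuousLinearMap
  let fl' := (ContinuousLinearMap.flipₗᵢ ℝ F F (F →L[ℝ] ℝ)).toContinuousLinearEquiv.toContinuousLinearMap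
  let low : F → F →L[ℝ] F →L[ℝ] F →L[ℝ] ℝ := fun y =>
    (1 / 2 : ℝ) • (D y + fl' (D y) - fl.comp (fl' (D y)))
  have hlow : ∀ y u w z, low y u w z =
      (1 / 2) * (fderiv ℝ a y u w z + fderiv ℝ a y w u z - fderiv ℝ a y z u w) := by
    intro y u w z; simp [low, fl, fl', D]
  -- The frames in `christoffel` are chosen point by point and need not depend continuously on `y`.
  -- Inverting the metric as a map to the dual gives the same tensor in a form whose smoothness is
  -- visible.
  let Γ : F → F →L[ℝ] F →L[ℝ] F := fun y =>
    (ContinuousLinearMap.compL ℝ F (F →L[ℝ] ℝ) F (a y).inverse).comp (low y)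
  have hΓ : ∀ y u w, Γ y u w = (a y).inverse (low y u w) := fun y u w => rfl
  have hinv : ∀ y, (∀ u, u ≠ 0 → 0 < h y u u) → (a y).IsInvertible := by
    intro y hp
    have hinj : Function.Injective (a y) := by
      rw [injective_iff_map_eq_zero]
      intro u hu
      by_contra hne
      have := hp u hne
      rw [ha, hu] at this
      simp at this
    have hfr : Module.finrank ℝ F = Module.finrank ℝ (F →L[ℝ] ℝ) := by
      rw [← (LinearMap.toContinuousLinearMap (𝕜 := ℝ) (E := F) (F' := ℝ)).finrank_eq]
      exact (Subspace.dual_finrank_eq (K := ℝ) (V := F)).symm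
    let e : F ≃L[ℝ] (F →L[ℝ] ℝ) :=
      (LinearEquiv.ofInjectiveOfFinrankEq (a y : F →ₗ[ℝ] (F →L[ℝ] ℝ)) hinj hfr).toContinuousLinearEquiv
    exact ⟨e, by ext u w; rfl⟩
  refine ⟨Γ, ?_, ?_⟩
  · have hD : ContDiffAt ℝ 1 D y₀ := hd.fderiv_right (by norm_num)
    have hl : ContDiffAt ℝ 1 low y₀ := by
      have h1 : ContDiffAt ℝ 1 (fun y => fl' (D y)) y₀ := fl'.contDiff.contDiffAt.comp y₀ hD
      have h2 : ContDiffAt ℝ 1 (fun y => fl.comp (fl' (D y))) y₀ := contDiffAt_const.clm_comp h1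
      exact ((hD.add h1).sub h2).const_smul _
    have hi : ContDiffAt ℝ 1 (fun y => (a y).inverse) y₀ :=
      ((hinv y₀ hpos.self_of_nhds).contDiffAt_map_inverse).comp y₀ (hd.of_le (by norm_num))
    exact ((ContinuousLinearMap.compL ℝ F (F →L[ℝ] ℝ) F).contDiff.contDiffAt.comp y₀ hi).clm_comp hl
  · have hd' : ∀ᶠ y in 𝓝 y₀, ContDiffAt ℝ 2 a y := hd.eventually (by simp)
    filter_upwards [hd', hsymm, hsymm.eventually_nhds, hpos] with y hdy hs hsn hp
    have hdiff := differentiableAt_of_contDiffAt_two hdy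
    have hi := hinv y hp
    have haΓ : ∀ u w z, a y (Γ y u w) z =
        (1 / 2) * (fderiv ℝ a y u w z + fderiv ℝ a y w u z - fderiv ℝ a y z u w) := by
      intro u w z
      rw [hΓ, ← ContinuousLinearMap.comp_apply (a y), hi.self_comp_inverse]
      exact hlow y u w z
    have hnd : ∀ x x', (∀ z, a y x z = a y x' z) → x = x' := by
      intro x x' hx
      by_contra hne
      have := hp (x - x') (sub_ne_zero.2 hne)
      rw [ha] at this
      simp [hx] at this
    have hDs : ∀ u w z, fderiv ℝ a y u w z = fderiv ℝ a y u z w := by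
      intro u w z
      have e1 := fderiv_bilinear_apply hdiff (differentiableAt_const w) (differentiableAt_const z) u
      have e2 := fderiv_bilinear_apply hdiff (differentiableAt_const z) (differentiableAt_const w) u
      have : (fun y' => a y' w z) =ᶠ[𝓝 y] fun y' => a y' z w := by
        filter_upwards [hsn] with y' hy'
        rw [← ha, ← ha, hy']
      rw [this.fderiv_eq, e2] at e1
      simpa using e1.symm
    refine ⟨fun u w => hnd _ _ fun z => ?_, fun u w => hnd _ _ fun z => ?_, fun u w z => ?_⟩
    · rw [← ha, apply_christoffel ha hdiff hs hp, haΓ]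
    · rw [haΓ, haΓ, hDs z u w]; ring
    · have : a y w (Γ y u z) = a y (Γ y u z) w := by rw [← ha, ← ha, hs]
      rw [this, haΓ, haΓ, hDs z u w, hDs u z w, hDs w u z]; ring

end ChartCurvature

/-! ### Killing fields and Bochner's formula. -/

section Killing

variable {F : Type*} [NormedAddCommGroup F] [NormedSpace ℝ F]

/-- The curvature in terms of the derivative of the Christoffel symbols. -/
theorem riemann_eq_of_connection {h : F → LinearMap.BilinForm ℝ F}
    {Γ : F → F →L[ℝ] F →L[ℝ] F} {y₀ : F} (hΓ : ContDiffAt ℝ 1 Γ y₀)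
    (hch : ∀ᶠ y in 𝓝 y₀, ∀ u w, christoffel h y u w = Γ y u w) (u w z : F) :
    riemann h y₀ u w z = fderiv ℝ Γ y₀ u w z - fderiv ℝ Γ y₀ w u z
      + Γ y₀ u (Γ y₀ w z) - Γ y₀ w (Γ y₀ u z) := by
  have hd : DifferentiableAt ℝ Γ y₀ := hΓ.differentiableAt (by norm_num)
  have key : ∀ p q r : F, fderiv ℝ (fun y' => christoffel h y' p q) y₀ r = fderiv ℝ Γ y₀ r p q := by
    intro p q r
    have : (fun y' => christoffel h y' p q) =ᶠ[𝓝 y₀] fun y' => Γ y' p q := by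
      filter_upwards [hch] with y hy using hy p q
    rw [this.fderiv_eq, fderiv_bilinear_apply hd (differentiableAt_const p)
      (differentiableAt_const q)]
    simp
  simp only [riemann, key, hch.self_of_nhds]

/-- The infinitesimal isometry equation for a vector field `K`. -/
def IsKillingAt (a : F → F →L[ℝ] F →L[ℝ] ℝ) (K : F → F) (y : F) : Prop :=
  ∀ u w, fderiv ℝ a y (K y) u w + a y (fderiv ℝ K y u) w + a y u (fderiv ℝ K y w) = 0

/-- The covariant derivative `u ↦ ∇_u K` of a vector field. -/
def covDeriv (Γ : F → F →L[ℝ] F →L[ℝ] F) (K : F → F) (y : F) : F →L[ℝ] F :=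
  fderiv ℝ K y + (Γ y).flip (K y)

theorem covDeriv_apply (Γ : F → F →L[ℝ] F →L[ℝ] F) (K : F → F) (y u : F) :
    covDeriv Γ K y u = fderiv ℝ K y u + Γ y u (K y) := by simp [covDeriv]

/-- Metric compatibility replaces the derivative of the metric along `K` by Christoffel terms; the
Killing equation then says exactly that `∇K` is skew. -/
theorem covDeriv_skew {a : F → F →L[ℝ] F →L[ℝ] ℝ} {Γ : F → F →L[ℝ] F →L[ℝ] F} {y : F}
    (hΓs : ∀ u w, Γ y u w = Γ y w u)
    (hΓc : ∀ u w z, fderiv ℝ a y u w z = a y (Γ y u w) z + a y w (Γ y u z))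
    {K : F → F} (hK : IsKillingAt a K y) (u w : F) :
    a y (covDeriv Γ K y u) w + a y u (covDeriv Γ K y w) = 0 := by
  have := hK u w
  rw [hΓc, hΓs _ u, hΓs _ w] at this
  simp only [covDeriv_apply, map_add, add_apply]
  linarith

/-- Derivative of the inner product of two fields along a Killing field. -/
theorem fderiv_inner_killing {a : F → F →L[ℝ] F →L[ℝ] ℝ} {y : F} (ha : DifferentiableAt ℝ a y)
    {K V W : F → F} (hV : DifferentiableAt ℝ V y) (hW : DifferentiableAt ℝ W y)
    (hK : IsKillingAt a K y) :
    fderiv ℝ (fun y => a y (V y) (W y)) y (K y) =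
      a y (fderiv ℝ V y (K y) - fderiv ℝ K y (V y)) (W y)
        + a y (V y) (fderiv ℝ W y (K y) - fderiv ℝ K y (W y)) := by
  rw [fderiv_bilinear_apply ha hV hW]
  have := hK (V y) (W y)
  simp only [map_sub, sub_apply]
  linarith

/-- Bochner's formula for a Killing field whose length is stationary at the point. -/
theorem riemann_killing_bochner {h : F → LinearMap.BilinForm ℝ F}
    {a : F → F →L[ℝ] F →L[ℝ] ℝ} {Γ : F → F →L[ℝ] F →L[ℝ] F} {y₀ : F}
    (hd : ContDiffAt ℝ 2 a y₀) (hΓ : ContDiffAt ℝ 1 Γ y₀)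
    (hch : ∀ᶠ y in 𝓝 y₀, ∀ u w, christoffel h y u w = Γ y u w)
    (hsymm : ∀ᶠ y in 𝓝 y₀, ∀ u w, a y u w = a y w u)
    (hnd : ∀ x, (∀ z, a y₀ x z = 0) → x = 0)
    (hΓs : ∀ᶠ y in 𝓝 y₀, ∀ u w, Γ y u w = Γ y w u)
    (hΓc : ∀ᶠ y in 𝓝 y₀, ∀ u w z, fderiv ℝ a y u w z = a y (Γ y u w) z + a y w (Γ y u z))
    {K : F → F} (hKd : ContDiffAt ℝ 2 K y₀) (hK : ∀ᶠ y in 𝓝 y₀, IsKillingAt a K y)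
    (hcrit : ∀ u, fderiv ℝ (fun y => a y (K y) (K y)) y₀ u = 0) (u : F) :
    a y₀ (riemann h y₀ u (K y₀) (K y₀)) u =
      a y₀ (covDeriv Γ K y₀ u) (covDeriv Γ K y₀ u)
        - (1 / 2) * fderiv ℝ (fderiv ℝ (fun y => a y (K y) (K y))) y₀ u u := by
  have hΓd : DifferentiableAt ℝ Γ y₀ := hΓ.differentiableAt (by norm_num)
  have had : DifferentiableAt ℝ a y₀ := differentiableAt_of_contDiffAt_two hd
  have hK1 : DifferentiableAt ℝ K y₀ := differentiableAt_of_contDiffAt_two hKd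
  have hK2 := differentiableAt_fderiv_of_contDiffAt_two hKd
  let fl := (ContinuousLinearMap.flipₗᵢ ℝ F F F).toContinuousLinearEquiv.toContinuousLinearMap
  have hfl : DifferentiableAt ℝ (fun y => fl (Γ y)) y₀ := fl.differentiableAt.comp y₀ hΓd
  have hAd : DifferentiableAt ℝ (covDeriv Γ K) y₀ := hK2.add (hfl.clm_apply hK1)
  have hDA : ∀ p q, fderiv ℝ (covDeriv Γ K) y₀ p q =
      fderiv ℝ (fderiv ℝ K) y₀ p q + fderiv ℝ Γ y₀ p q (K y₀) + Γ y₀ q (fderiv ℝ K y₀ p) := by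
    intro p q
    have h1 : fderiv ℝ (fun y => covDeriv Γ K y q) y₀ p = fderiv ℝ (covDeriv Γ K) y₀ p q := by
      rw [fderiv_linear_apply hAd (differentiableAt_const q)]; simp
    have hq : DifferentiableAt ℝ (fun y => fderiv ℝ K y q) y₀ :=
      hK2.clm_apply (differentiableAt_const q)
    have hr : DifferentiableAt ℝ (fun y => Γ y q (K y)) y₀ :=
      (hΓd.clm_apply (differentiableAt_const q)).clm_apply hK1
    rw [← h1]
    simp only [covDeriv_apply]
    rw [fderiv_fun_add hq hr, add_apply,
      fderiv_linear_apply hK2 (differentiableAt_const q),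
      fderiv_bilinear_apply hΓd (differentiableAt_const q) hK1]
    simp
    abel
  set A := covDeriv Γ K with hA
  have hskew : ∀ᶠ y in 𝓝 y₀, ∀ u w, a y (A y u) w + a y u (A y w) = 0 := by
    filter_upwards [hΓs, hΓc, hK] with y h1 h2 h3 u w using covDeriv_skew h1 h2 h3 u w
  have hsk := hskew.self_of_nhds
  have hs := hsymm.self_of_nhds
  have hc := hΓc.self_of_nhds
  have hΓs0 := hΓs.self_of_nhds
  have hdf : ∀ᶠ y in 𝓝 y₀, ∀ p, fderiv ℝ (fun y => a y (K y) (K y)) y p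
      = -2 * a y p (A y (K y)) := by
    filter_upwards [hΓs, hΓc, hskew, hsymm, hd.eventually (by simp), hKd.eventually (by simp)]
      with y h1 h2 h3 h4 h5 h6 p
    rw [fderiv_bilinear_apply (differentiableAt_of_contDiffAt_two h5)
      (differentiableAt_of_contDiffAt_two h6) (differentiableAt_of_contDiffAt_two h6), h2]
    have e1 := h3 p (K y)
    have e2 := h4 (K y) (A y p)
    rw [hA, covDeriv_apply, map_add, add_apply] at e1
    rw [h4 (K y) (fderiv ℝ K y p), h4 (K y) (Γ y p (K y))]
    linarith
  -- Skewness gives `d|K|² = -2 g(·, ∇_K K)`, so stationary length means `∇_K K = 0` at the point.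
  have hAk : A y₀ (K y₀) = 0 := by
    refine hnd _ fun z => ?_
    have := hdf.self_of_nhds z
    rw [hcrit, hs z] at this
    linarith
  -- With `A = ∇K`, `R(u,K)K = (∇_u A)K - (∇_K A)u`. The function `g(A u, u)` vanishes identically,
  -- and its derivative along `K` eliminates the second term once paired with `u`.
  have e1 : fderiv ℝ (fun y => a y (A y u) u) y₀ (K y₀) = 0 := by
    have : (fun y => a y (A y u) u) =ᶠ[𝓝 y₀] fun _ => 0 := by
      filter_upwards [hskew, hsymm] with y h1 h2
      have := h1 u u
      rw [h2 u] at this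
      linarith
    rw [this.fderiv_eq]; simp
  rw [fderiv_bilinear_apply had (hAd.clm_apply (differentiableAt_const u))
    (differentiableAt_const u), fderiv_linear_apply hAd (differentiableAt_const u)] at e1
  -- Since `A K = 0` at the point, `(∇_u A)K = ∇_u(A K) - A(A u)`. The first part is the Hessian
  -- computed here; the second, by skewness, gives `|A u|²`.
  have e2 : fderiv ℝ (fderiv ℝ (fun y => a y (K y) (K y))) y₀ u u =
      -2 * fderiv ℝ (fun y => a y u (A y (K y))) y₀ u := by
    have hf2 : ContDiffAt ℝ 2 (fun y => a y (K y) (K y)) y₀ := (hd.clm_apply hKd).clm_apply hKd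
    have h1 := fderiv_linear_apply (differentiableAt_fderiv_of_contDiffAt_two hf2)
      (differentiableAt_const u) u
    have h2 : (fun y => fderiv ℝ (fun y => a y (K y) (K y)) y u)
        =ᶠ[𝓝 y₀] fun y => -2 * a y u (A y (K y)) := by
      filter_upwards [hdf] with y hy using hy u
    rw [h2.fderiv_eq, fderiv_const_mul] at h1
    · simpa using h1.symm
    · exact (had.clm_apply (differentiableAt_const u)).clm_apply (hAd.clm_apply hK1)
  rw [fderiv_bilinear_apply had (differentiableAt_const u) (hAd.clm_apply hK1),
    fderiv_linear_apply hAd hK1, hAk] at e2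
  rw [riemann_eq_of_connection hΓ hch]
  simp only [hDA, hc, fderiv_fun_const, map_zero, add_zero, Pi.zero_apply,
    zero_apply, zero_add, map_add, add_apply] at e1 e2
  rw [second_fderiv_symm hKd] at e1
  have h3 := hAk
  rw [hA, covDeriv_apply] at h3
  have h4 : fderiv ℝ K y₀ (K y₀) = - Γ y₀ (K y₀) (K y₀) := eq_neg_of_add_eq_zero_left h3
  have h5 := hsk u (fderiv ℝ K y₀ u)
  have h6 : A y₀ u = fderiv ℝ K y₀ u + Γ y₀ u (K y₀) := covDeriv_apply _ _ _ _
  rw [e2]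
  rw [h4] at e1
  simp only [map_add, map_sub, map_neg, add_apply, sub_apply, neg_apply] at e1 ⊢
  rw [hs u, hs u, hs u, hs u] at *
  have h7 : a y₀ (A y₀ u) (A y₀ u) = a y₀ (A y₀ u) (fderiv ℝ K y₀ u)
    + a y₀ (A y₀ u) (Γ y₀ (K y₀) u) := by
    conv_lhs => rw [h6]
    rw [map_add, ← h6, hΓs0 u]
  have h8 : a y₀ (Γ y₀ (K y₀) (A y₀ u)) u = a y₀ (Γ y₀ (K y₀) (fderiv ℝ K y₀ u)) u
    + a y₀ (Γ y₀ (K y₀) (Γ y₀ u (K y₀))) u := by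
    rw [h6]; simp
  linarith

end Killing

/-! ### Derivatives of inner products as brackets. -/

section KillingAlgebra

variable {F : Type*} [NormedAddCommGroup F] [NormedSpace ℝ F] {𝔤 : Type*}

/-- A family of Killing fields near `y₀`, closed under the Lie bracket of vector fields. -/
structure IsKillingFamily (a : F → F →L[ℝ] F →L[ℝ] ℝ) (y₀ : F) (K : 𝔤 → F → F)
    (br : 𝔤 → 𝔤 → 𝔤) : Prop where
  contDiffAt : ∀ X, ContDiffAt ℝ 2 (K X) y₀
  killing : ∀ X, ∀ᶠ y in 𝓝 y₀, IsKillingAt a (K X) y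
  bracket : ∀ X Y, ∀ᶠ y in 𝓝 y₀,
    fderiv ℝ (K Y) y (K X y) - fderiv ℝ (K X) y (K Y y) = K (br X Y) y

variable {a : F → F →L[ℝ] F →L[ℝ] ℝ} {y₀ : F} {K : 𝔤 → F → F} {br : 𝔤 → 𝔤 → 𝔤}

/-- The Lie derivative of the metric along `K U` is zero, so only the brackets of `K U` with the two
arguments remain. These are again fields of the family, so the rule can be iterated for second
derivatives. -/
theorem IsKillingFamily.fderiv_inner (hK : IsKillingFamily a y₀ K br) (hd : ContDiffAt ℝ 2 a y₀)
    (U V W : 𝔤) : ∀ᶠ y in 𝓝 y₀, fderiv ℝ (fun y => a y (K V y) (K W y)) y (K U y) =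
      a y (K (br U V) y) (K W y) + a y (K V y) (K (br U W) y) := by
  filter_upwards [hd.eventually (by simp), (hK.contDiffAt V).eventually (by simp),
    (hK.contDiffAt W).eventually (by simp), hK.killing U, hK.bracket U V, hK.bracket U W]
    with y h1 h2 h3 h4 h5 h6
  rw [fderiv_inner_killing (differentiableAt_of_contDiffAt_two h1)
    (differentiableAt_of_contDiffAt_two h2) (differentiableAt_of_contDiffAt_two h3) h4, h5, h6]

/-- Koszul's formula for Killing fields. -/
theorem IsKillingFamily.koszul (hK : IsKillingFamily a y₀ K br)
    {Γ : F → F →L[ℝ] F →L[ℝ] F}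
    (hsymm : ∀ u w, a y₀ u w = a y₀ w u)
    (hΓs : ∀ u w, Γ y₀ u w = Γ y₀ w u)
    (hΓc : ∀ u w z, fderiv ℝ a y₀ u w z = a y₀ (Γ y₀ u w) z + a y₀ w (Γ y₀ u z)) (X U V : 𝔤) :
    2 * a y₀ (covDeriv Γ (K X) y₀ (K U y₀)) (K V y₀) =
      a y₀ (K (br U X) y₀) (K V y₀) + a y₀ (K (br U V) y₀) (K X y₀)
        + a y₀ (K U y₀) (K (br X V) y₀) := by
  -- Torsion-freeness writes each bracket as a difference of covariant derivatives; skewness of the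
  -- three operators `∇K` then leaves only the term on the left.
  have hb : ∀ P R, K (br P R) y₀ = covDeriv Γ (K R) y₀ (K P y₀) - covDeriv Γ (K P) y₀ (K R y₀) := by
    intro P R
    rw [← (hK.bracket P R).self_of_nhds, covDeriv_apply, covDeriv_apply, hΓs (K R y₀)]
    abel
  have hsk : ∀ P u w, a y₀ (covDeriv Γ (K P) y₀ u) w + a y₀ u (covDeriv Γ (K P) y₀ w) = 0 :=
    fun P u w => covDeriv_skew hΓs hΓc (hK.killing P).self_of_nhds u w
  simp only [hb, map_sub, sub_apply]
  have h1 := hsk X (K U y₀) (K V y₀)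
  have h2 := hsk U (K X y₀) (K V y₀)
  have h3 := hsk V (K U y₀) (K X y₀)
  have h4 := hsymm (covDeriv Γ (K U) y₀ (K V y₀)) (K X y₀)
  linarith

end KillingAlgebra

/-! ### Ricci curvature from the Killing algebra. -/

section RicciKilling

variable {F : Type*} [NormedAddCommGroup F] [NormedSpace ℝ F] [FiniteDimensional ℝ F] {𝔤 : Type*}
  {h : F → LinearMap.BilinForm ℝ F} {a : F → F →L[ℝ] F →L[ℝ] ℝ} {y₀ : F}
  {K : 𝔤 → F → F} {br : 𝔤 → 𝔤 → 𝔤}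

/-- The curvature in a chart as a multilinear expression. -/
theorem exists_ricci_bilinForm (ha : ∀ y u w, h y u w = a y u w) (hd : ContDiffAt ℝ 2 a y₀)
    (hsymm : ∀ᶠ y in 𝓝 y₀, ∀ u w, h y u w = h y w u)
    (hpos : ∀ᶠ y in 𝓝 y₀, ∀ u, u ≠ 0 → 0 < h y u u) :
    ∃ R : LinearMap.BilinForm ℝ F, ∀ w z, ricci h y₀ w z = R w z := by
  obtain ⟨Γ, hΓ, hall⟩ := exists_connection ha hd hsymm hpos
  have hR := riemann_eq_of_connection hΓ (hall.mono fun y hy => hy.1)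
  refine ⟨LinearMap.mk₂ ℝ (fun w z => ricci h y₀ w z) ?_ ?_ ?_ ?_, fun w z => rfl⟩
  · intro w w' z
    simp only [ricci, hR, ← Finset.sum_add_distrib]
    refine Finset.sum_congr rfl fun i _ => ?_
    rw [← LinearMap.BilinForm.add_left]
    congr 2
    simp only [map_add, add_apply]
    abel
  · intro c w z
    simp only [ricci, hR, smul_eq_mul, Finset.mul_sum]
    refine Finset.sum_congr rfl fun i _ => ?_
    rw [← LinearMap.BilinForm.smul_left]
    congr 2
    simp only [map_smul, smul_apply, smul_add, smul_sub]
  · intro w z z'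
    simp only [ricci, hR, ← Finset.sum_add_distrib]
    refine Finset.sum_congr rfl fun i _ => ?_
    rw [← LinearMap.BilinForm.add_left]
    congr 2
    simp only [map_add]
    abel
  · intro c w z
    simp only [ricci, hR, smul_eq_mul, Finset.mul_sum]
    refine Finset.sum_congr rfl fun i _ => ?_
    rw [← LinearMap.BilinForm.smul_left]
    congr 2
    simp only [map_smul, smul_add, smul_sub]

/-- The norm of the Ricci tensor bounds its values. -/
theorem ricci_le (ha : ∀ y u w, h y u w = a y u w) (hd : ContDiffAt ℝ 2 a y₀)
    (hsymm : ∀ᶠ y in 𝓝 y₀, ∀ u w, h y u w = h y w u)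
    (hpos : ∀ᶠ y in 𝓝 y₀, ∀ u, u ≠ 0 → 0 < h y u u) (w : F) :
    ricci h y₀ w w ≤ ricciNormCoord h y₀ * h y₀ w w := by
  obtain ⟨R, hR⟩ := exists_ricci_bilinForm ha hd hsymm hpos
  have hs := hsymm.self_of_nhds
  have ho := frameAt_orthonormal hs hpos.self_of_nhds
  have hcard : Fintype.card (Fin (Module.finrank ℝ (⊤ : Submodule ℝ F))) = Module.finrank ℝ F := by
    simp
  have hexp := sum_smul_of_orthonormal (h y₀) _ ho hcard w
  set e := frameAt h y₀
  have h1 : ricci h y₀ w w = ∑ p ∈ Finset.univ ×ˢ Finset.univ,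
      (h y₀ w (e p.1) * h y₀ w (e p.2)) * ricci h y₀ (e p.1) (e p.2) := by
    rw [Finset.sum_product]
    simp only [hR]
    conv_lhs => rw [← hexp]
    rw [LinearMap.BilinForm.sum_left]
    refine Finset.sum_congr rfl fun i _ => ?_
    rw [LinearMap.BilinForm.sum_right]
    refine Finset.sum_congr rfl fun j _ => ?_
    rw [LinearMap.BilinForm.smul_left, LinearMap.BilinForm.smul_right]
    ring
  have h2 : h y₀ w w = ∑ i, h y₀ w (e i) ^ 2 := by
    rw [apply_eq_sum_of_orthonormal (h y₀) hs e ho hcard w w]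
    exact Finset.sum_congr rfl fun i _ => by ring
  -- The matrix `(w_i w_j)` has Hilbert–Schmidt norm `|w|²`, so Cauchy–Schwarz against the matrix of
  -- the Ricci tensor gives the bound.
  have h3 : Real.sqrt (∑ p ∈ Finset.univ ×ˢ Finset.univ, (h y₀ w (e p.1) * h y₀ w (e p.2)) ^ 2)
      = h y₀ w w := by
    rw [Finset.sum_product]
    have : ∑ i, ∑ j, (h y₀ w (e i) * h y₀ w (e j)) ^ 2 = (h y₀ w w) ^ 2 := by
      rw [h2, sq, Finset.sum_mul_sum]
      refine Finset.sum_congr rfl fun i _ => Finset.sum_congr rfl fun j _ => by ring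
    rw [this, Real.sqrt_sq]
    rw [h2]; positivity
  rw [h1]
  refine (Real.sum_mul_le_sqrt_mul_sqrt _ _ _).trans ?_
  rw [h3, mul_comm, ricciNormCoord, Finset.sum_product]

/-- The Ricci curvature of a homogeneous metric in the direction of a Killing field of stationary
length, in terms of the Lie algebra of Killing fields. -/
theorem IsKillingFamily.ricci_eq (hK : IsKillingFamily a y₀ K br)
    (ha : ∀ y u w, h y u w = a y u w) (hd : ContDiffAt ℝ 2 a y₀)
    (hsymm : ∀ᶠ y in 𝓝 y₀, ∀ u w, h y u w = h y w u)
    (hpos : ∀ᶠ y in 𝓝 y₀, ∀ u, u ≠ 0 → 0 < h y u u)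
    (hsurj : ∀ u, ∃ X, K X y₀ = u) (X : 𝔤)
    (hX : ∀ Z, h y₀ (K (br Z X) y₀) (K X y₀) = 0)
    {ι : Type*} [Fintype ι] [DecidableEq ι] (U : ι → 𝔤)
    (hU : ∀ i j, h y₀ (K (U i) y₀) (K (U j) y₀) = if i = j then 1 else 0)
    (hcard : Fintype.card ι = Module.finrank ℝ F) :
    ricci h y₀ (K X y₀) (K X y₀) = ∑ i, ((∑ j, (1 / 4) *
      (h y₀ (K (br (U i) X) y₀) (K (U j) y₀) + h y₀ (K (br (U i) (U j)) y₀) (K X y₀)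
        + h y₀ (K (U i) y₀) (K (br X (U j)) y₀)) ^ 2)
      - h y₀ (K (br (U i) (br (U i) X)) y₀) (K X y₀)
      - h y₀ (K (br (U i) X) y₀) (K (br (U i) X) y₀)) := by
  obtain ⟨Γ, hΓ, hall⟩ := exists_connection ha hd hsymm hpos
  have hch := hall.mono fun y hy => hy.1
  have hΓs := hall.mono fun y hy => hy.2.1
  have hΓc := hall.mono fun y hy => hy.2.2
  have hs := hsymm.self_of_nhds
  have hp := hpos.self_of_nhds
  have hsa : ∀ᶠ y in 𝓝 y₀, ∀ u w, a y u w = a y w u := by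
    filter_upwards [hsymm] with y hy u w
    rw [← ha, ← ha, hy]
  have hnd : ∀ x, (∀ z, a y₀ x z = 0) → x = 0 := by
    intro x hx
    by_contra hne
    have := hp x hne
    rw [ha, hx] at this
    exact lt_irrefl _ this
  have hKX := hK.contDiffAt X
  have hf2 : ContDiffAt ℝ 2 (fun y => a y (K X y) (K X y)) y₀ := (hd.clm_apply hKX).clm_apply hKX
  have hcrit : ∀ u, fderiv ℝ (fun y => a y (K X y) (K X y)) y₀ u = 0 := by
    intro u
    obtain ⟨Z, rfl⟩ := hsurj u
    rw [(hK.fderiv_inner hd Z X X).self_of_nhds, hsa.self_of_nhds (K X y₀), ← ha, hX]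
    simp
  have hB := riemann_killing_bochner hd hΓ hch hsa hnd hΓs hΓc hKX (hK.killing X) hcrit
  -- the trace may be taken in the given basis
  have hR := riemann_eq_of_connection hΓ hch
  let T : LinearMap.BilinForm ℝ F := LinearMap.mk₂ ℝ
    (fun u z => h y₀ (riemann h y₀ u (K X y₀) (K X y₀)) z)
    (fun u u' z => by
      rw [← LinearMap.BilinForm.add_left]; congr 2
      simp only [hR, map_add, add_apply]; abel)
    (fun c u z => by
      rw [smul_eq_mul, ← LinearMap.BilinForm.smul_left]; congr 2
      simp only [hR, map_smul, smul_apply, smul_add, smul_sub])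
    (fun u z z' => by rw [map_add])
    (fun c u z => by rw [map_smul])
  have htr : ricci h y₀ (K X y₀) (K X y₀) = ∑ i, T (K (U i) y₀) (K (U i) y₀) :=
    sum_diag_eq_of_orthonormal (h y₀) T hs (frameAt h y₀) (fun i => K (U i) y₀)
      (frameAt_orthonormal hs hp) hU (by simp) hcard
  rw [htr]
  refine Finset.sum_congr rfl fun i _ => ?_
  have hT : T (K (U i) y₀) (K (U i) y₀) =
    a y₀ (riemann h y₀ (K (U i) y₀) (K X y₀) (K X y₀)) (K (U i) y₀) := ha _ _ _
  rw [hT, hB]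
  -- The derivative of `|K X|²` along `K (U i)` is an inner product of Killing fields, which is
  -- differentiated once more along `K (U i)`. The term containing the derivative of `K (U i)` drops
  -- out because the point is critical.
  have hhess : fderiv ℝ (fderiv ℝ (fun y => a y (K X y) (K X y))) y₀ (K (U i) y₀) (K (U i) y₀) =
      2 * (a y₀ (K (br (U i) (br (U i) X)) y₀) (K X y₀)
        + a y₀ (K (br (U i) X) y₀) (K (br (U i) X) y₀)) := by
    have h1 := fderiv_linear_apply (differentiableAt_fderiv_of_contDiffAt_two hf2)
      (differentiableAt_of_contDiffAt_two (hK.contDiffAt (U i))) (K (U i) y₀)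
    rw [hcrit, add_zero] at h1
    rw [← h1]
    have h2 : (fun y => fderiv ℝ (fun y => a y (K X y) (K X y)) y (K (U i) y)) =ᶠ[𝓝 y₀]
        fun y => 2 * a y (K (br (U i) X) y) (K X y) := by
      filter_upwards [hK.fderiv_inner hd (U i) X X, hsa] with y h3 h4
      rw [h3, h4 (K X y)]; ring
    rw [h2.fderiv_eq, fderiv_const_mul, smul_apply, (hK.fderiv_inner hd _ _ _).self_of_nhds,
      smul_eq_mul]
    exact ((differentiableAt_of_contDiffAt_two hd).clm_apply
      (differentiableAt_of_contDiffAt_two (hK.contDiffAt _))).clm_apply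
      (differentiableAt_of_contDiffAt_two hKX)
  rw [hhess, ← ha, apply_eq_sum_of_orthonormal (h y₀) hs (fun i => K (U i) y₀) hU hcard]
  have hkz : ∀ j, h y₀ (covDeriv Γ (K X) y₀ (K (U i) y₀)) (K (U j) y₀)
      * h y₀ (covDeriv Γ (K X) y₀ (K (U i) y₀)) (K (U j) y₀) = (1 / 4) *
      (h y₀ (K (br (U i) X) y₀) (K (U j) y₀) + h y₀ (K (br (U i) (U j)) y₀) (K X y₀)
        + h y₀ (K (U i) y₀) (K (br X (U j)) y₀)) ^ 2 := by
    intro j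
    have := hK.koszul hsa.self_of_nhds hΓs.self_of_nhds hΓc.self_of_nhds X (U i) (U j)
    simp only [ha, ← this]
    ring
  simp only [hkz, ← ha]
  ring

end RicciKilling

/-! ### Partial derivatives and related vector fields. -/

section Calculus

variable {E₁ : Type*} [NormedAddCommGroup E₁] [NormedSpace ℝ E₁]
  {E₂ : Type*} [NormedAddCommGroup E₂] [NormedSpace ℝ E₂]
  {E₃ : Type*} [NormedAddCommGroup E₃] [NormedSpace ℝ E₃]

theorem fderiv_partial_snd {f : E₁ × E₂ → E₃} {p : E₁ × E₂} (hf : DifferentiableAt ℝ f p) :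
    fderiv ℝ (fun y => f (p.1, y)) p.2 = (fderiv ℝ f p).comp (ContinuousLinearMap.inr ℝ E₁ E₂) := by
  have h1 : HasFDerivAt (fun y : E₂ => (p.1, y)) (ContinuousLinearMap.inr ℝ E₁ E₂) p.2 :=
    hasFDerivAt_prodMk_right p.1 p.2
  exact (HasFDerivAt.comp (f := fun y : E₂ => (p.1, y)) p.2 hf.hasFDerivAt h1).fderiv

theorem fderiv_partial_fst {f : E₁ × E₂ → E₃} {p : E₁ × E₂} (hf : DifferentiableAt ℝ f p) :
    fderiv ℝ (fun x => f (x, p.2)) p.1 = (fderiv ℝ f p).comp (ContinuousLinearMap.inl ℝ E₁ E₂) := by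
  have h1 : HasFDerivAt (fun x : E₁ => (x, p.2)) (ContinuousLinearMap.inl ℝ E₁ E₂) p.1 :=
    hasFDerivAt_prodMk_left p.1 p.2
  exact (HasFDerivAt.comp (f := fun x : E₁ => (x, p.2)) p.1 hf.hasFDerivAt h1).fderiv

/-- Partial derivatives in the second variable of a smooth map are smooth in both variables. -/
theorem contDiffAt_partial_snd {f : E₁ × E₂ → E₃} {p : E₁ × E₂} {n m : ℕ} (hf : ContDiffAt ℝ n f p)
    (hm : m + 1 ≤ n) :
    ContDiffAt ℝ m (fun q : E₁ × E₂ => fderiv ℝ (fun y => f (q.1, y)) q.2) p := by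
  have h1 : ContDiffAt ℝ m (fun q => (fderiv ℝ f q).comp (ContinuousLinearMap.inr ℝ E₁ E₂)) p :=
    (hf.fderiv_right (by exact_mod_cast hm)).clm_comp contDiffAt_const
  refine h1.congr_of_eventuallyEq ?_
  have hn : (n : WithTop ℕ∞) ≠ 0 := by
    have : n ≠ 0 := by omega
    exact_mod_cast this
  filter_upwards [hf.eventually (by simp)] with q hq
  exact fderiv_partial_snd (hq.differentiableAt hn)

theorem contDiffAt_partial_fst {f : E₁ × E₂ → E₃} {p : E₁ × E₂} {n m : ℕ} (hf : ContDiffAt ℝ n f p)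
    (hm : m + 1 ≤ n) :
    ContDiffAt ℝ m (fun q : E₁ × E₂ => fderiv ℝ (fun x => f (x, q.2)) q.1) p := by
  have h1 : ContDiffAt ℝ m (fun q => (fderiv ℝ f q).comp (ContinuousLinearMap.inl ℝ E₁ E₂)) p :=
    (hf.fderiv_right (by exact_mod_cast hm)).clm_comp contDiffAt_const
  refine h1.congr_of_eventuallyEq ?_
  have hn : (n : WithTop ℕ∞) ≠ 0 := by
    have : n ≠ 0 := by omega
    exact_mod_cast this
  filter_upwards [hf.eventually (by simp)] with q hq
  exact fderiv_partial_fst (hq.differentiableAt hn)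

/-- Equality of the mixed partial derivatives. -/
theorem fderiv_partial_comm {f : E₁ × E₂ → E₃} {p : E₁ × E₂} (hf : ContDiffAt ℝ 2 f p)
    (u : E₁) (v : E₂) :
    fderiv ℝ (fun x => fderiv ℝ (fun y => f (x, y)) p.2 v) p.1 u =
      fderiv ℝ (fun y => fderiv ℝ (fun x => f (x, y)) p.1 u) p.2 v := by
  have hev : ∀ᶠ q in 𝓝 p, DifferentiableAt ℝ f q :=
    (hf.eventually (by simp)).mono fun q hq => differentiableAt_of_contDiffAt_two hq
  have hd := differentiableAt_fderiv_of_contDiffAt_two hf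
  have ht1 : Filter.Tendsto (fun x : E₁ => (x, p.2)) (𝓝 p.1) (𝓝 p) :=
    (Continuous.prodMk_left p.2).tendsto p.1
  have ht2 : Filter.Tendsto (fun y : E₂ => (p.1, y)) (𝓝 p.2) (𝓝 p) :=
    (Continuous.prodMk_right p.1).tendsto p.2
  have h1 : (fun x => fderiv ℝ (fun y => f (x, y)) p.2 v) =ᶠ[𝓝 p.1]
      fun x => fderiv ℝ f (x, p.2) (0, v) := by
    filter_upwards [ht1.eventually hev] with x hx
    rw [fderiv_partial_snd (p := (x, p.2)) hx]; simp
  have h2 : (fun y => fderiv ℝ (fun x => f (x, y)) p.1 u) =ᶠ[𝓝 p.2]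
      fun y => fderiv ℝ f (p.1, y) (u, 0) := by
    filter_upwards [ht2.eventually hev] with y hy
    rw [fderiv_partial_fst (p := (p.1, y)) hy]; simp
  rw [h1.fderiv_eq, h2.fderiv_eq]
  have hd1 := fderiv_partial_fst (f := fun q => fderiv ℝ f q (0, v)) (p := p)
    (hd.clm_apply (differentiableAt_const _))
  have hd2 := fderiv_partial_snd (f := fun q => fderiv ℝ f q (u, 0)) (p := p)
    (hd.clm_apply (differentiableAt_const _))
  rw [hd1, hd2]
  simp only [ContinuousLinearMap.comp_apply, ContinuousLinearMap.inl_apply,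
    ContinuousLinearMap.inr_apply]
  rw [fderiv_linear_apply hd (differentiableAt_const _),
    fderiv_linear_apply hd (differentiableAt_const _)]
  simpa using second_fderiv_symm hf (u, 0) (0, v)

/-- The Lie bracket of vector fields is natural for related vector fields. -/
theorem fderiv_bracket_of_related {f : E₁ → E₂} {x : E₁} (hf : ContDiffAt ℝ 2 f x)
    {V W : E₁ → E₁} {V' W' : E₂ → E₂} (hV : DifferentiableAt ℝ V x) (hW : DifferentiableAt ℝ W x)
    (hV' : DifferentiableAt ℝ V' (f x)) (hW' : DifferentiableAt ℝ W' (f x))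
    (hVV : ∀ᶠ z in 𝓝 x, fderiv ℝ f z (V z) = V' (f z))
    (hWW : ∀ᶠ z in 𝓝 x, fderiv ℝ f z (W z) = W' (f z)) :
    fderiv ℝ W' (f x) (V' (f x)) - fderiv ℝ V' (f x) (W' (f x)) =
      fderiv ℝ f x (fderiv ℝ W x (V x) - fderiv ℝ V x (W x)) := by
  -- Differentiating the relation `df(Z) = Z' ∘ f` produces a second derivative of `f`, which
  -- cancels by symmetry in the difference forming the bracket.
  have key : ∀ {Z : E₁ → E₁} {Z' : E₂ → E₂}, DifferentiableAt ℝ Z x → DifferentiableAt ℝ Z' (f x) →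
      (∀ᶠ z in 𝓝 x, fderiv ℝ f z (Z z) = Z' (f z)) → ∀ u,
      fderiv ℝ (fderiv ℝ f) x u (Z x) + fderiv ℝ f x (fderiv ℝ Z x u) =
        fderiv ℝ Z' (f x) (fderiv ℝ f x u) := by
    intro Z Z' hZ hZ' h u
    rw [← fderiv_linear_apply (differentiableAt_fderiv_of_contDiffAt_two hf) hZ,
      Filter.EventuallyEq.fderiv_eq h]
    rw [fderiv_fun_comp x hZ' (differentiableAt_of_contDiffAt_two hf)]
    simp
  have h1 := key hW hW' hWW (V x)
  have h2 := key hV hV' hVV (W x)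
  rw [hVV.self_of_nhds] at h1
  rw [hWW.self_of_nhds] at h2
  rw [← h1, ← h2, second_fderiv_symm hf (V x), map_sub]
  abel

end Calculus

/-! ### Differentials of charts. -/

section Charts

variable {F : Type*} [NormedAddCommGroup F] [NormedSpace ℝ F]
  {M : Type*} [TopologicalSpace M] [ChartedSpace F M]
  {F' : Type*} [NormedAddCommGroup F'] [NormedSpace ℝ F']
  {M' : Type*} [TopologicalSpace M'] [ChartedSpace F' M']
  {F'' : Type*} [NormedAddCommGroup F''] [NormedSpace ℝ F'']
  {M'' : Type*} [TopologicalSpace M''] [ChartedSpace F'' M'']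

/-- The differential of a map of manifolds as a map of model spaces. -/
def modelDeriv (f : M → M') (p : M) : F →L[ℝ] F' :=
  (show TangentSpace 𝓘(ℝ, F) p →L[ℝ] TangentSpace 𝓘(ℝ, F') (f p) from
    mfderiv 𝓘(ℝ, F) 𝓘(ℝ, F') f p)

theorem modelDeriv_comp {g : M' → M''} {f : M → M'} {p : M}
    (hg : MDifferentiableAt 𝓘(ℝ, F') 𝓘(ℝ, F'') g (f p))
    (hf : MDifferentiableAt 𝓘(ℝ, F) 𝓘(ℝ, F') f p) :
    modelDeriv (F := F) (F' := F'') (fun q => g (f q)) p =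
      (modelDeriv (F := F') (F' := F'') g (f p)).comp (modelDeriv (F := F) (F' := F') f p) :=
  mfderiv_comp p hg hf

theorem modelDeriv_comp_apply {g : M' → M''} {f : M → M'} {p : M}
    (hg : MDifferentiableAt 𝓘(ℝ, F') 𝓘(ℝ, F'') g (f p))
    (hf : MDifferentiableAt 𝓘(ℝ, F) 𝓘(ℝ, F') f p) (u : F) :
    modelDeriv (F := F) (F' := F'') (fun q => g (f q)) p u =
      modelDeriv (F := F') (F' := F'') g (f p) (modelDeriv (F := F) (F' := F') f p u) := by
  rw [modelDeriv_comp hg hf]; rfl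

theorem modelDeriv_congr {f f' : M → M'} {p : M} (h : f =ᶠ[𝓝 p] f') :
    modelDeriv (F := F) (F' := F') f p = modelDeriv (F := F) (F' := F') f' p :=
  Filter.EventuallyEq.mfderiv_eq h

theorem modelDeriv_id (p : M) :
    modelDeriv (F := F) (F' := F) (fun q : M => q) p = ContinuousLinearMap.id ℝ F :=
  mfderiv_id

theorem modelDeriv_eq_fderiv (f : F → F') (p : F) :
    modelDeriv (F := F) (F' := F') f p = fderiv ℝ f p :=
  mfderiv_eq_fderiv

theorem extChartAt_target_mem (x : M) {y : F} (hy : y ∈ (extChartAt 𝓘(ℝ, F) x).target) :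
    (extChartAt 𝓘(ℝ, F) x).target ∈ 𝓝 y :=
  (isOpen_extChartAt_target x).mem_nhds hy

theorem extChartAt_source_mem (x : M) {p : M} (hp : p ∈ (extChartAt 𝓘(ℝ, F) x).source) :
    (extChartAt 𝓘(ℝ, F) x).source ∈ 𝓝 p :=
  (isOpen_extChartAt_source x).mem_nhds hp

variable [IsManifold 𝓘(ℝ, F) ∞ M]

theorem contMDiffAt_extChartAt_symm (x : M) {y : F} (hy : y ∈ (extChartAt 𝓘(ℝ, F) x).target) :
    ContMDiffAt 𝓘(ℝ, F) 𝓘(ℝ, F) ∞ (extChartAt 𝓘(ℝ, F) x).symm y :=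
  (contMDiffOn_extChartAt_symm x).contMDiffAt (extChartAt_target_mem x hy)

theorem contMDiffAt_extChartAt_of_mem (x : M) {p : M} (hp : p ∈ (extChartAt 𝓘(ℝ, F) x).source) :
    ContMDiffAt 𝓘(ℝ, F) 𝓘(ℝ, F) ∞ (extChartAt 𝓘(ℝ, F) x) p :=
  contMDiffAt_extChartAt' (by simpa using hp)

theorem mdifferentiableAt_extChartAt_symm' (x : M) {y : F}
    (hy : y ∈ (extChartAt 𝓘(ℝ, F) x).target) :
    MDifferentiableAt 𝓘(ℝ, F) 𝓘(ℝ, F) (extChartAt 𝓘(ℝ, F) x).symm y :=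
  (contMDiffAt_extChartAt_symm x hy).mdifferentiableAt (by simp)

theorem mdifferentiableAt_extChartAt_of_mem (x : M) {p : M}
    (hp : p ∈ (extChartAt 𝓘(ℝ, F) x).source) :
    MDifferentiableAt 𝓘(ℝ, F) 𝓘(ℝ, F) (extChartAt 𝓘(ℝ, F) x) p :=
  (contMDiffAt_extChartAt_of_mem x hp).mdifferentiableAt (by simp)

theorem modelDeriv_symm_apply_chart (x : M) {p : M}
    (hp : p ∈ (extChartAt 𝓘(ℝ, F) x).source) (u : F) :
    modelDeriv (F := F) (F' := F) (extChartAt 𝓘(ℝ, F) x).symm (extChartAt 𝓘(ℝ, F) x p)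
      (modelDeriv (F := F) (F' := F) (extChartAt 𝓘(ℝ, F) x) p u) = u := by
  rw [← modelDeriv_comp_apply
    (mdifferentiableAt_extChartAt_symm' x ((extChartAt 𝓘(ℝ, F) x).map_source hp))
    (mdifferentiableAt_extChartAt_of_mem x hp)]
  have : (fun q => (extChartAt 𝓘(ℝ, F) x).symm (extChartAt 𝓘(ℝ, F) x q)) =ᶠ[𝓝 p] fun q => q := by
    filter_upwards [extChartAt_source_mem x hp] with q hq
    exact (extChartAt 𝓘(ℝ, F) x).left_inv hq
  rw [modelDeriv_congr this, modelDeriv_id]; rfl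

theorem modelDeriv_chart_apply_symm (x : M) {y : F}
    (hy : y ∈ (extChartAt 𝓘(ℝ, F) x).target) (u : F) :
    modelDeriv (F := F) (F' := F) (extChartAt 𝓘(ℝ, F) x) ((extChartAt 𝓘(ℝ, F) x).symm y)
      (modelDeriv (F := F) (F' := F) (extChartAt 𝓘(ℝ, F) x).symm y u) = u := by
  rw [← modelDeriv_comp_apply
    (mdifferentiableAt_extChartAt_of_mem x ((extChartAt 𝓘(ℝ, F) x).map_target hy))
    (mdifferentiableAt_extChartAt_symm' x hy)]
  have : (fun q => (extChartAt 𝓘(ℝ, F) x) ((extChartAt 𝓘(ℝ, F) x).symm q)) =ᶠ[𝓝 y] fun q => q := by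
    filter_upwards [extChartAt_target_mem x hy] with q hq
    exact (extChartAt 𝓘(ℝ, F) x).right_inv hq
  rw [modelDeriv_congr this, modelDeriv_id]; rfl

theorem modelDeriv_chart_self (x : M) :
    modelDeriv (F := F) (F' := F) (extChartAt 𝓘(ℝ, F) x) x = ContinuousLinearMap.id ℝ F := by
  have : IsManifold 𝓘(ℝ, F) 1 M := IsManifold.of_le (n := ∞) (by simp)
  exact mfderiv_extChartAt_self

theorem modelDeriv_symm_self (x : M) :
    modelDeriv (F := F) (F' := F) (extChartAt 𝓘(ℝ, F) x).symm (extChartAt 𝓘(ℝ, F) x x)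
      = ContinuousLinearMap.id ℝ F := by
  ext u
  have := modelDeriv_symm_apply_chart (F := F) x (mem_extChartAt_source x) u
  rwa [modelDeriv_chart_self] at this

end Charts

/-! ### Multiplication and invariant fields in the chart at the identity. -/

section LieGroupChart

variable {E : Type*} [NormedAddCommGroup E] [NormedSpace ℝ E]
  {G : Type*} [TopologicalSpace G] [ChartedSpace E G] [Group G]

variable (E G) in
/-- The multiplication of a Lie group in the chart at `1`. -/
def chartMul (p : E × E) : E :=
  extChartAt 𝓘(ℝ, E) (1 : G)
    ((extChartAt 𝓘(ℝ, E) (1 : G)).symm p.1 * (extChartAt 𝓘(ℝ, E) (1 : G)).symm p.2)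

variable (E G) in
/-- The coordinates of `1`. -/
def chartOne : E := extChartAt 𝓘(ℝ, E) (1 : G) (1 : G)

variable (E G) in
/-- The left invariant vector field with value `X` at `1`, in the chart at `1`. -/
def leftField (X : E) (y : E) : E := fderiv ℝ (fun z => chartMul E G (y, z)) (chartOne E G) X

variable (E G) in
/-- The right invariant vector field with value `X` at `1`, in the chart at `1`. -/
def rightField (X : E) (y : E) : E := fderiv ℝ (fun z => chartMul E G (z, y)) (chartOne E G) X

theorem chartOne_mem_target : chartOne E G ∈ (extChartAt 𝓘(ℝ, E) (1 : G)).target :=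
  mem_extChartAt_target (1 : G)

theorem chartSymm_chartOne : (extChartAt 𝓘(ℝ, E) (1 : G)).symm (chartOne E G) = 1 :=
  extChartAt_to_inv (I := 𝓘(ℝ, E)) (1 : G)

theorem chartMul_chartOne_left :
    ∀ᶠ y in 𝓝 (chartOne E G), chartMul E G (chartOne E G, y) = y := by
  filter_upwards [extChartAt_target_mem (1 : G) (chartOne_mem_target (E := E))] with y hy
  simp only [chartMul, chartSymm_chartOne, one_mul]
  exact (extChartAt 𝓘(ℝ, E) (1 : G)).right_inv hy

theorem chartMul_chartOne_right :
    ∀ᶠ y in 𝓝 (chartOne E G), chartMul E G (y, chartOne E G) = y := by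
  filter_upwards [extChartAt_target_mem (1 : G) (chartOne_mem_target (E := E))] with y hy
  simp only [chartMul, chartSymm_chartOne, mul_one]
  exact (extChartAt 𝓘(ℝ, E) (1 : G)).right_inv hy

theorem leftField_chartOne (X : E) : leftField E G X (chartOne E G) = X := by
  have : (fun z => chartMul E G (chartOne E G, z)) =ᶠ[𝓝 (chartOne E G)] fun z => z :=
    chartMul_chartOne_left
  rw [leftField, this.fderiv_eq]; simp

theorem rightField_chartOne (X : E) : rightField E G X (chartOne E G) = X := by
  have : (fun z => chartMul E G (z, chartOne E G)) =ᶠ[𝓝 (chartOne E G)] fun z => z :=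
    chartMul_chartOne_right
  rw [rightField, this.fderiv_eq]; simp

variable [LieGroup 𝓘(ℝ, E) ∞ G]

theorem contDiffAt_chartMul : ContDiffAt ℝ ∞ (chartMul E G) (chartOne E G, chartOne E G) := by
  rw [← contMDiffAt_iff_contDiffAt]
  have h1 : ContMDiffAt 𝓘(ℝ, E × E) 𝓘(ℝ, E) ∞
      (fun p : E × E => (extChartAt 𝓘(ℝ, E) (1 : G)).symm p.1) (chartOne E G, chartOne E G) :=
    (contMDiffAt_extChartAt_symm (1 : G) chartOne_mem_target).comp
      (chartOne E G, chartOne E G) contDiffAt_fst.contMDiffAt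
  have h2 : ContMDiffAt 𝓘(ℝ, E × E) 𝓘(ℝ, E) ∞
      (fun p : E × E => (extChartAt 𝓘(ℝ, E) (1 : G)).symm p.2) (chartOne E G, chartOne E G) :=
    (contMDiffAt_extChartAt_symm (1 : G) chartOne_mem_target).comp
      (chartOne E G, chartOne E G) contDiffAt_snd.contMDiffAt
  refine ContMDiffAt.comp (chartOne E G, chartOne E G) (I' := 𝓘(ℝ, E)) ?_ (h1.mul h2)
  simp only [chartSymm_chartOne, mul_one]
  exact contMDiffAt_extChartAt

theorem contDiffAt_chartMul_nat (n : ℕ) :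
    ContDiffAt ℝ n (chartMul E G) (chartOne E G, chartOne E G) :=
  contDiffAt_chartMul.of_le (by exact_mod_cast le_top)

theorem contDiffAt_leftField (X : E) : ContDiffAt ℝ 2 (leftField E G X) (chartOne E G) := by
  have h := contDiffAt_partial_snd (m := 2) (contDiffAt_chartMul_nat (E := E) (G := G) 3) le_rfl
  have h2 : ContDiffAt ℝ 2 (fun y : E => (y, chartOne E G)) (chartOne E G) :=
    contDiffAt_id.prodMk contDiffAt_const
  exact (ContDiffAt.comp (f := fun y : E => (y, chartOne E G)) _ h h2).clm_apply contDiffAt_const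

theorem contDiffAt_rightOperator : ContDiffAt ℝ 2
    (fun y => fderiv ℝ (fun z => chartMul E G (z, y)) (chartOne E G)) (chartOne E G) := by
  have h := contDiffAt_partial_fst (m := 2) (contDiffAt_chartMul_nat (E := E) (G := G) 3) le_rfl
  have h2 : ContDiffAt ℝ 2 (fun y : E => (chartOne E G, y)) (chartOne E G) :=
    contDiffAt_const.prodMk contDiffAt_id
  exact ContDiffAt.comp (f := fun y : E => (chartOne E G, y)) _ h h2

theorem contDiffAt_rightField (X : E) : ContDiffAt ℝ 2 (rightField E G X) (chartOne E G) :=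
  contDiffAt_rightOperator.clm_apply contDiffAt_const

/-- Both sides are the mixed second partial derivative of the multiplication at the identity.
Consequently right invariant fields have the opposite bracket to left invariant ones. -/
theorem fderiv_rightField (X Y : E) : fderiv ℝ (rightField E G Y) (chartOne E G) X =
    fderiv ℝ (leftField E G X) (chartOne E G) Y :=
  (fderiv_partial_comm (p := (chartOne E G, chartOne E G))
    (contDiffAt_chartMul_nat (E := E) (G := G) 2) Y X).symm

end LieGroupChart

/-! ### The Lie bracket and the adjoint representation. -/

section LieBracketChart

variable {E : Type*} [NormedAddCommGroup E] [NormedSpace ℝ E]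
  {G : Type*} [TopologicalSpace G] [ChartedSpace E G] [Group G] [LieGroup 𝓘(ℝ, E) ∞ G]

theorem mdifferentiableAt_mul_left' (a b : G) :
    MDifferentiableAt 𝓘(ℝ, E) 𝓘(ℝ, E) (fun x : G => a * x) b :=
  (contMDiff_mul_left (I := 𝓘(ℝ, E)) (n := ∞)).contMDiffAt.mdifferentiableAt (by simp)

theorem mdifferentiableAt_mul_right' (a b : G) :
    MDifferentiableAt 𝓘(ℝ, E) 𝓘(ℝ, E) (fun x : G => x * a) b :=
  (contMDiff_mul_right (I := 𝓘(ℝ, E)) (n := ∞)).contMDiffAt.mdifferentiableAt (by simp)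

theorem mdifferentiableAt_conj (a b : G) :
    MDifferentiableAt 𝓘(ℝ, E) 𝓘(ℝ, E) (fun x : G => a * x * a⁻¹) b :=
  MDifferentiableAt.comp (g := fun x : G => x * a⁻¹) (f := fun x : G => a * x) b
    (mdifferentiableAt_mul_right' _ _) (mdifferentiableAt_mul_left' _ _)

/-- The derivative at `1` of a map from a Lie group to a manifold, in charts. -/
theorem fderiv_chart_comp {F : Type*} [NormedAddCommGroup F] [NormedSpace ℝ F]
    {M : Type*} [TopologicalSpace M] [ChartedSpace F M] [IsManifold 𝓘(ℝ, F) ∞ M] (x : M)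
    {c : G → M} (hc : MDifferentiableAt 𝓘(ℝ, E) 𝓘(ℝ, F) c 1)
    (hx : c 1 ∈ (extChartAt 𝓘(ℝ, F) x).source) (X : E) :
    fderiv ℝ (fun z => extChartAt 𝓘(ℝ, F) x (c ((extChartAt 𝓘(ℝ, E) (1 : G)).symm z)))
      (chartOne E G) X =
      modelDeriv (F := F) (F' := F) (extChartAt 𝓘(ℝ, F) x) (c 1)
        (modelDeriv (F := E) (F' := F) c 1 X) := by
  have h1 : MDifferentiableAt 𝓘(ℝ, E) 𝓘(ℝ, E) (extChartAt 𝓘(ℝ, E) (1 : G)).symm (chartOne E G) :=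
    mdifferentiableAt_extChartAt_symm' _ chartOne_mem_target
  have h2 : MDifferentiableAt 𝓘(ℝ, E) 𝓘(ℝ, F) c
      ((extChartAt 𝓘(ℝ, E) (1 : G)).symm (chartOne E G)) := by rwa [chartSymm_chartOne]
  have h3 : MDifferentiableAt 𝓘(ℝ, F) 𝓘(ℝ, F) (extChartAt 𝓘(ℝ, F) x)
      (c ((extChartAt 𝓘(ℝ, E) (1 : G)).symm (chartOne E G))) := by
    rw [chartSymm_chartOne]; exact mdifferentiableAt_extChartAt_of_mem _ hx
  rw [← modelDeriv_eq_fderiv,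
    modelDeriv_comp_apply (F' := F) (f := fun z => c ((extChartAt 𝓘(ℝ, E) (1 : G)).symm z)) h3
    (MDifferentiableAt.comp (g := c) _ h2 h1),
    modelDeriv_comp_apply (F' := E) (g := c) h2 h1, chartSymm_chartOne]
  have : modelDeriv (F := E) (F' := E) (extChartAt 𝓘(ℝ, E) (1 : G)).symm (chartOne E G)
    = ContinuousLinearMap.id ℝ E := modelDeriv_symm_self (1 : G)
  rw [this]; rfl

theorem leftField_eq_modelDeriv {y : E} (hy : y ∈ (extChartAt 𝓘(ℝ, E) (1 : G)).target) (X : E) :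
    leftField E G X y =
      modelDeriv (F := E) (F' := E) (extChartAt 𝓘(ℝ, E) (1 : G))
        ((extChartAt 𝓘(ℝ, E) (1 : G)).symm y)
        (modelDeriv (F := E) (F' := E)
          (fun x : G => (extChartAt 𝓘(ℝ, E) (1 : G)).symm y * x) 1 X) := by
  have := fderiv_chart_comp (1 : G) (c := fun x : G => (extChartAt 𝓘(ℝ, E) (1 : G)).symm y * x)
    (mdifferentiableAt_mul_left' (E := E) _ _)
    (by rw [mul_one]; exact (extChartAt 𝓘(ℝ, E) (1 : G)).map_target hy) X
  rwa [mul_one] at this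

theorem rightField_eq_modelDeriv {y : E} (hy : y ∈ (extChartAt 𝓘(ℝ, E) (1 : G)).target) (X : E) :
    rightField E G X y =
      modelDeriv (F := E) (F' := E) (extChartAt 𝓘(ℝ, E) (1 : G))
        ((extChartAt 𝓘(ℝ, E) (1 : G)).symm y)
        (modelDeriv (F := E) (F' := E)
          (fun x : G => x * (extChartAt 𝓘(ℝ, E) (1 : G)).symm y) 1 X) := by
  have := fderiv_chart_comp (1 : G) (c := fun x : G => x * (extChartAt 𝓘(ℝ, E) (1 : G)).symm y)
    (mdifferentiableAt_mul_right' (E := E) _ _)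
    (by rw [one_mul]; exact (extChartAt 𝓘(ℝ, E) (1 : G)).map_target hy) X
  rwa [one_mul] at this

variable (E G) in
/-- The bracket of `GroupLieAlgebra`, on the model space. -/
def modelBracket (X Y : E) : E :=
  @Bracket.bracket (GroupLieAlgebra 𝓘(ℝ, E) G) (GroupLieAlgebra 𝓘(ℝ, E) G) _ X Y

/-- The Lie bracket of the Lie algebra of a Lie group in the chart at `1`. -/
theorem modelBracket_eq_fderiv_leftField (X Y : E) :
    modelBracket E G X Y = fderiv ℝ (leftField E G Y) (chartOne E G) X -
      fderiv ℝ (leftField E G X) (chartOne E G) Y := by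
  have : IsManifold 𝓘(ℝ, E) 1 G := IsManifold.of_le (n := ∞) (by simp)
  let P : E → E → E := fun Z => VectorField.mpullbackWithin 𝓘(ℝ, E) 𝓘(ℝ, E)
      (extChartAt 𝓘(ℝ, E) (1 : G)).symm (mulInvariantVectorField (I := 𝓘(ℝ, E)) (G := G) Z)
      (Set.range 𝓘(ℝ, E))
  have hpb : ∀ Z : E, P Z =ᶠ[𝓝 (chartOne E G)] leftField E G Z := by
    intro Z
    filter_upwards [extChartAt_target_mem (1 : G) (chartOne_mem_target (E := E))] with y hy
    rw [leftField_eq_modelDeriv hy]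
    have hinv : (mfderivWithin 𝓘(ℝ, E) 𝓘(ℝ, E) (extChartAt 𝓘(ℝ, E) (1 : G)).symm
        (Set.range 𝓘(ℝ, E)) y).inverse = mfderiv 𝓘(ℝ, E) 𝓘(ℝ, E) (extChartAt 𝓘(ℝ, E) (1 : G))
          ((extChartAt 𝓘(ℝ, E) (1 : G)).symm y) :=
      ContinuousLinearMap.inverse_eq
        (mfderivWithin_extChartAt_symm_comp_mfderiv_extChartAt hy)
        (mfderiv_extChartAt_comp_mfderivWithin_extChartAt_symm hy)
    simp only [P, VectorField.mpullbackWithin_apply]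
    rw [hinv]
    rfl
  have hs : ((extChartAt 𝓘(ℝ, E) (1 : G)).symm ⁻¹' Set.univ ∩ Set.range 𝓘(ℝ, E)) = Set.univ := by
    simp
  have h := Filter.EventuallyEq.lieBracket_vectorField_eq (𝕜 := ℝ) (hpb X) (hpb Y)
  -- Unfolding the manifold bracket at `1`: pull both fields back to the chart, take the bracket
  -- there, and transport it by the inverse differential of the chart, which is the identity at its
  -- centre.
  have h1 : modelBracket E G X Y =
      (modelDeriv (F := E) (F' := E) (extChartAt 𝓘(ℝ, E) (1 : G)) 1).inverse
        (VectorField.lieBracketWithin ℝ (P X) (P Y)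
          ((extChartAt 𝓘(ℝ, E) (1 : G)).symm ⁻¹' Set.univ ∩ Set.range 𝓘(ℝ, E))
          (chartOne E G)) := rfl
  rw [h1, modelDeriv_chart_self, ContinuousLinearMap.inverse_id, hs,
    VectorField.lieBracketWithin_univ, h, VectorField.lieBracket_eq]
  simp only [leftField_chartOne, ContinuousLinearMap.id_apply]

/-- The adjoint representation on the model space. -/
def modelAd (a : G) : E →L[ℝ] E := modelDeriv (F := E) (F' := E) (fun x : G => a * x * a⁻¹) 1

/-- This is `a x = (a x a⁻¹) a`, differentiated in `x` at the identity. -/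
theorem leftField_eq_rightField_modelAd {y : E}
    (hy : y ∈ (extChartAt 𝓘(ℝ, E) (1 : G)).target) (X : E) :
    leftField E G X y =
      rightField E G (modelAd (E := E) ((extChartAt 𝓘(ℝ, E) (1 : G)).symm y) X) y := by
  rw [leftField_eq_modelDeriv hy, rightField_eq_modelDeriv hy, modelAd]
  set a := (extChartAt 𝓘(ℝ, E) (1 : G)).symm y
  congr 1
  have h := modelDeriv_comp_apply (F := E) (F' := E) (F'' := E) (g := fun x : G => x * a)
    (f := fun x : G => a * x * a⁻¹) (p := 1)
    (mdifferentiableAt_mul_right' (E := E) _ _) (mdifferentiableAt_conj (E := E) _ _) X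
  simp only [inv_mul_cancel_right, mul_one, mul_inv_cancel] at h
  exact h

/-- The adjoint representation is differentiable at `1`, with derivative the Lie bracket. -/
theorem hasFDerivAt_modelAd (Y : E) [CompleteSpace E] :
    DifferentiableAt ℝ (fun y => modelAd (E := E) ((extChartAt 𝓘(ℝ, E) (1 : G)).symm y) Y)
      (chartOne E G) ∧ ∀ X : E,
    fderiv ℝ (fun y => modelAd (E := E) ((extChartAt 𝓘(ℝ, E) (1 : G)).symm y) Y)
      (chartOne E G) X = modelBracket E G X Y := by
  set A : E → E := fun y => modelAd (E := E) ((extChartAt 𝓘(ℝ, E) (1 : G)).symm y) Y with hA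
  let R : E → E →L[ℝ] E := fun y => fderiv ℝ (fun z => chartMul E G (z, y)) (chartOne E G)
  have hR : ContDiffAt ℝ 2 R (chartOne E G) := contDiffAt_rightOperator
  have hR1 : R (chartOne E G) = ContinuousLinearMap.id ℝ E := by
    ext u; exact rightField_chartOne u
  -- `R` is smooth and invertible near the identity, so this relation can be solved for `A`; this is
  -- how `Ad` is seen to be differentiable.
  have hRA : (fun y => R y (A y)) =ᶠ[𝓝 (chartOne E G)] leftField E G Y := by
    filter_upwards [extChartAt_target_mem (1 : G) (chartOne_mem_target (E := E))] with y hy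
    exact (leftField_eq_rightField_modelAd hy Y).symm
  have hinv : ∀ᶠ y in 𝓝 (chartOne E G), (R y).IsInvertible := by
    have hopen : IsOpen (Set.range ((↑) : (E ≃L[ℝ] E) → E →L[ℝ] E)) :=
      ContinuousLinearEquiv.isOpen
    refine hR.continuousAt.eventually (hopen.mem_nhds ?_)
    rw [hR1]
    exact ⟨ContinuousLinearEquiv.refl ℝ E, rfl⟩
  have hAe : A =ᶠ[𝓝 (chartOne E G)] fun y => (R y).inverse (leftField E G Y y) := by
    filter_upwards [hRA, hinv] with y h1 h2
    rw [← h1, ← ContinuousLinearMap.comp_apply, h2.inverse_comp_self]; rfl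
  have hAd : DifferentiableAt ℝ A (chartOne E G) := by
    refine DifferentiableAt.congr_of_eventuallyEq ?_ hAe
    have h1 : DifferentiableAt ℝ (fun y => (R y).inverse) (chartOne E G) :=
      ((hinv.self_of_nhds.contDiffAt_map_inverse (n := 2)).comp (chartOne E G) hR).differentiableAt
        (by norm_num)
    exact h1.clm_apply (differentiableAt_of_contDiffAt_two (contDiffAt_leftField Y))
  refine ⟨hAd, fun X => ?_⟩
  have hA1 : A (chartOne E G) = Y := by
    have : R (chartOne E G) (A (chartOne E G)) = leftField E G Y (chartOne E G) := hRA.self_of_nhds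
    rwa [leftField_chartOne, hR1] at this
  have h1 := Filter.EventuallyEq.fderiv_eq (𝕜 := ℝ) hRA
  have h2 := fderiv_linear_apply (differentiableAt_of_contDiffAt_two hR) hAd X
  have h3 : fderiv ℝ R (chartOne E G) X Y = fderiv ℝ (rightField E G Y) (chartOne E G) X := by
    have := fderiv_linear_apply (differentiableAt_of_contDiffAt_two hR)
      (differentiableAt_const (c := Y)) X
    simp only [fderiv_fun_const, Pi.zero_apply, zero_apply, map_zero, add_zero] at this
    exact this.symm
  -- The derivative of `R y (A y)` at the identity now reads `DL_Y(X) = DL_X(Y) + dA(X)`, `L` being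
  -- the left invariant fields, so `dA(X)` is the bracket.
  rw [h1, hA1, h3, hR1, fderiv_rightField] at h2
  rw [modelBracket_eq_fderiv_leftField]
  exact eq_sub_of_add_eq' h2.symm

/-- An `Ad`-invariant bilinear form makes the bracket skew. -/
theorem apply_modelBracket_of_invariant [FiniteDimensional ℝ E] (Q : LinearMap.BilinForm ℝ E)
    (hQ : ∀ (a : G) (X Y : E), Q (modelAd a X) (modelAd a Y) = Q X Y) (X Y Z : E) :
    Q (modelBracket E G X Y) Z + Q Y (modelBracket E G X Z) = 0 := by
  have : CompleteSpace E := FiniteDimensional.complete ℝ E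
  obtain ⟨hY, hYX⟩ := hasFDerivAt_modelAd (G := G) Y
  obtain ⟨hZ, hZX⟩ := hasFDerivAt_modelAd (G := G) Z
  let q : E →L[ℝ] E →L[ℝ] ℝ := LinearMap.toContinuousBilinearMap Q
  -- The function `Q(Ad_y Y, Ad_y Z)` is constant in `y`; its derivative at the identity is the
  -- claim.
  have h1 := fderiv_bilinear_apply (a := fun _ : E => q) (differentiableAt_const q) hY hZ X
  have h2 : (fun y => q (modelAd (E := E) ((extChartAt 𝓘(ℝ, E) (1 : G)).symm y) Y)
      (modelAd (E := E) ((extChartAt 𝓘(ℝ, E) (1 : G)).symm y) Z)) = fun _ => Q Y Z := by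
    funext y; exact hQ _ _ _
  have h3 : ∀ W : E, modelAd (E := E) ((extChartAt 𝓘(ℝ, E) (1 : G)).symm (chartOne E G)) W = W := by
    intro W
    rw [chartSymm_chartOne, modelAd]
    simp only [one_mul, inv_one, mul_one]
    rw [modelDeriv_id]; rfl
  rw [h2, hYX, hZX, h3, h3] at h1
  simpa [q] using h1.symm

end LieBracketChart

/-! ### Local sections of submersions. -/

section LocalSection

variable {E : Type*} [NormedAddCommGroup E] [NormedSpace ℝ E]
  {G : Type*} [TopologicalSpace G] [ChartedSpace E G] [IsManifold 𝓘(ℝ, E) ∞ G]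
  {F : Type*} [NormedAddCommGroup F] [NormedSpace ℝ F] [FiniteDimensional ℝ F]
  {M : Type*} [TopologicalSpace M] [ChartedSpace F M] [IsManifold 𝓘(ℝ, F) ∞ M]

/-- A submersion has smooth local sections. -/
theorem exists_local_section {π : G → M} (hπ : ContMDiff 𝓘(ℝ, E) 𝓘(ℝ, F) ∞ π) (a : G)
    (hs : Function.Surjective (modelDeriv (F := E) (F' := F) π a)) :
    ∃ s : M → G, ContMDiffAt 𝓘(ℝ, F) 𝓘(ℝ, E) ∞ s (π a) ∧ ∀ᶠ p in 𝓝 (π a), π (s p) = p := by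
  have hFc : CompleteSpace F := FiniteDimensional.complete ℝ F
  obtain ⟨r, hr⟩ := (modelDeriv (F := E) (F' := F) π a : E →ₗ[ℝ] F).exists_rightInverse_of_surjective
    (LinearMap.range_eq_top.2 hs)
  let R : F →L[ℝ] E := LinearMap.toContinuousLinearMap r
  have hR : ∀ z, modelDeriv (F := E) (F' := F) π a (R z) = z := fun z =>
    LinearMap.congr_fun hr z
  set χ := extChartAt 𝓘(ℝ, E) a with hχ
  set φ := extChartAt 𝓘(ℝ, F) (π a) with hφ
  have haff : ContDiff ℝ ∞ (fun z => χ a + R z) := contDiff_const.add R.contDiff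
  have h0 : χ a + R 0 = χ a := by simp
  have hsym : ContMDiffAt 𝓘(ℝ, E) 𝓘(ℝ, E) ∞ χ.symm (χ a + R 0) := by
    rw [h0]; exact contMDiffAt_extChartAt_symm a (mem_extChartAt_target a)
  have hup : ContMDiffAt 𝓘(ℝ, F) 𝓘(ℝ, E) ∞ (fun z => χ.symm (χ a + R z)) 0 :=
    ContMDiffAt.comp (0 : F) (g := χ.symm) (f := fun z => χ a + R z) hsym
      haff.contDiffAt.contMDiffAt
  have hup0 : χ.symm (χ a + R 0) = a := by rw [h0]; exact extChartAt_to_inv a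
  have hdown : ContMDiffAt 𝓘(ℝ, F) 𝓘(ℝ, F) ∞ (fun z => π (χ.symm (χ a + R z))) 0 :=
    ContMDiffAt.comp (0 : F) (g := π) hπ.contMDiffAt hup
  -- Along the affine slice in the direction of a linear right inverse `R` of the differential, the
  -- projection has derivative the identity at `0`. Its local inverse, followed by the slice, is the
  -- section.
  let ρ : F → F := fun z => φ (π (χ.symm (χ a + R z)))
  have hρM : ContMDiffAt 𝓘(ℝ, F) 𝓘(ℝ, F) ∞ ρ 0 := by
    refine ContMDiffAt.comp (0 : F) (g := φ) ?_ hdown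
    rw [hup0]; exact contMDiffAt_extChartAt
  have hρ : ContDiffAt ℝ ∞ ρ 0 := contMDiffAt_iff_contDiffAt.1 hρM
  have hρ0 : ρ 0 = φ (π a) := by simp only [ρ]; rw [hup0]
  have hder : fderiv ℝ ρ 0 = ContinuousLinearMap.id ℝ F := by
    ext u
    have e1 : MDifferentiableAt 𝓘(ℝ, F) 𝓘(ℝ, F) φ (π (χ.symm (χ a + R 0))) := by
      rw [hup0]; exact mdifferentiableAt_extChartAt_of_mem _ (mem_extChartAt_source _)
    have e2 : MDifferentiableAt 𝓘(ℝ, E) 𝓘(ℝ, F) π (χ.symm (χ a + R 0)) :=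
      hπ.contMDiffAt.mdifferentiableAt (by simp)
    have e3 : MDifferentiableAt 𝓘(ℝ, E) 𝓘(ℝ, E) χ.symm (χ a + R 0) :=
      hsym.mdifferentiableAt (by simp)
    have e4 : MDifferentiableAt 𝓘(ℝ, F) 𝓘(ℝ, E) (fun z => χ a + R z) 0 :=
      haff.contDiffAt.contMDiffAt.mdifferentiableAt (by simp)
    rw [← modelDeriv_eq_fderiv,
      modelDeriv_comp_apply (F' := F) (g := φ) (f := fun z => π (χ.symm (χ a + R z))) e1
        (hdown.mdifferentiableAt (by simp)),
      modelDeriv_comp_apply (F' := E) (g := π) (f := fun z => χ.symm (χ a + R z)) e2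
        (hup.mdifferentiableAt (by simp)),
      modelDeriv_comp_apply (F' := E) (g := χ.symm) (f := fun z => χ a + R z) e3 e4,
      hup0, h0, hχ, modelDeriv_symm_self, hφ, modelDeriv_chart_self, modelDeriv_eq_fderiv]
    have : fderiv ℝ (fun z => χ a + R z) 0 u = R u := by simp
    rw [← hχ, this]
    exact hR u
  have hder' : HasFDerivAt ρ ((ContinuousLinearEquiv.refl ℝ F : F ≃L[ℝ] F) : F →L[ℝ] F) 0 := by
    have := (hρ.differentiableAt (by simp)).hasFDerivAt
    rw [hder] at this
    exact this
  have hn : (∞ : WithTop ℕ∞) ≠ 0 := by simp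
  let li := hρ.localInverse hder' hn
  have hli : ContDiffAt ℝ ∞ li (φ (π a)) := by
    rw [← hρ0]; exact hρ.to_localInverse hder' hn
  have hli0 : li (φ (π a)) = 0 := by rw [← hρ0]; exact hρ.localInverse_apply_image hder' hn
  have hri : ∀ᶠ y in 𝓝 (φ (π a)), ρ (li y) = y := by
    rw [← hρ0]; exact (hρ.hasStrictFDerivAt' hder' hn).eventually_right_inverse
  have hliφ : ContMDiffAt 𝓘(ℝ, F) 𝓘(ℝ, F) ∞ (fun p => li (φ p)) (π a) :=
    ContMDiffAt.comp (π a) (g := li) (f := φ) hli.contMDiffAt contMDiffAt_extChartAt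
  have hs : ContMDiffAt 𝓘(ℝ, F) 𝓘(ℝ, E) ∞ (fun p => χ.symm (χ a + R (li (φ p)))) (π a) := by
    refine ContMDiffAt.comp (π a) (g := fun z => χ.symm (χ a + R z)) (f := fun p => li (φ p)) ?_ hliφ
    rw [hli0]; exact hup
  refine ⟨_, hs, ?_⟩
  have hc1 : ∀ᶠ p in 𝓝 (π a), p ∈ φ.source := extChartAt_source_mem _ (mem_extChartAt_source _)
  have hc2 : ∀ᶠ p in 𝓝 (π a), ρ (li (φ p)) = φ p :=
    (contMDiffAt_extChartAt (I := 𝓘(ℝ, F)) (n := ∞) (x := π a)).continuousAt.eventually hri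
  have hc3 : ∀ᶠ p in 𝓝 (π a), π (χ.symm (χ a + R (li (φ p)))) ∈ φ.source := by
    have hcont : ContinuousAt (fun p => π (χ.symm (χ a + R (li (φ p))))) (π a) :=
      hπ.continuous.continuousAt.comp hs.continuousAt
    refine hcont.eventually ?_
    change ∀ᶠ q in 𝓝 (π (χ.symm (χ a + R (li (φ (π a)))))), q ∈ φ.source
    rw [hli0, hup0]; exact hc1
  filter_upwards [hc1, hc2, hc3] with p h1 h2 h3
  exact φ.injOn h3 h1 h2

end LocalSection

/-! ### The action on the quotient and invariant forms. -/

section Action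

variable {E : Type*} [NormedAddCommGroup E] [NormedSpace ℝ E]
  {G : Type*} [TopologicalSpace G] [ChartedSpace E G] [Group G] [LieGroup 𝓘(ℝ, E) ∞ G]
  {F : Type*} [NormedAddCommGroup F] [NormedSpace ℝ F] [FiniteDimensional ℝ F]
  {H : Subgroup G} [ChartedSpace F (G ⧸ H)] [IsManifold 𝓘(ℝ, F) ∞ (G ⧸ H)]

theorem IsQuotientManifold.exists_section (hM : IsQuotientManifold E F H) (p : G ⧸ H) :
    ∃ s : G ⧸ H → G, ContMDiffAt 𝓘(ℝ, F) 𝓘(ℝ, E) ∞ s p ∧ ∀ᶠ q in 𝓝 p, (s q : G ⧸ H) = q := by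
  obtain ⟨a, rfl⟩ := QuotientGroup.mk_surjective p
  exact exists_local_section (π := fun a : G => (a : G ⧸ H)) hM.contMDiff a (hM.submersion a)

/-- The action of `G` on `G ⧸ H` is smooth, also jointly with parameters. -/
theorem IsQuotientManifold.contMDiffAt_smul (hM : IsQuotientManifold E F H)
    {P : Type*} [NormedAddCommGroup P] [NormedSpace ℝ P]
    {N : Type*} [TopologicalSpace N] [ChartedSpace P N] {b : N → G} {f : N → G ⧸ H} {z : N}
    (hb : ContMDiffAt 𝓘(ℝ, P) 𝓘(ℝ, E) ∞ b z) (hf : ContMDiffAt 𝓘(ℝ, P) 𝓘(ℝ, F) ∞ f z) :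
    ContMDiffAt 𝓘(ℝ, P) 𝓘(ℝ, F) ∞ (fun w => b w • f w) z := by
  -- With a local section `s`, the action is locally the projection of a product in `G`: `b • f =
  -- π(b · s(f))`.
  obtain ⟨s, hs, hsec⟩ := hM.exists_section (f z)
  have h1 : ContMDiffAt 𝓘(ℝ, P) 𝓘(ℝ, F) ∞ (fun w => ((b w * s (f w) : G) : G ⧸ H)) z :=
    ContMDiffAt.comp z (g := fun a : G => (a : G ⧸ H)) hM.contMDiff.contMDiffAt
      (hb.mul (ContMDiffAt.comp z (g := s) hs hf))
  refine h1.congr_of_eventuallyEq ?_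
  filter_upwards [hf.continuousAt.eventually hsec] with w hw
  conv_lhs => rw [← hw]
  rfl

theorem IsQuotientManifold.mdifferentiableAt_smul (hM : IsQuotientManifold E F H) (b : G)
    (p : G ⧸ H) :
    MDifferentiableAt 𝓘(ℝ, F) 𝓘(ℝ, F) (fun q : G ⧸ H => b • q) p :=
  (hM.contMDiffAt_smul (b := fun _ => b) (f := fun q => q) contMDiffAt_const
    contMDiffAt_id).mdifferentiableAt (by simp)

theorem IsQuotientManifold.modelDeriv_smul_inv (hM : IsQuotientManifold E F H) (b : G)
    (p : G ⧸ H) (u : F) :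
    modelDeriv (F := F) (F' := F) (fun q : G ⧸ H => b • q) (b⁻¹ • p)
      (modelDeriv (F := F) (F' := F) (fun q : G ⧸ H => b⁻¹ • q) p u) = u := by
  rw [← modelDeriv_comp_apply (F' := F) (g := fun q : G ⧸ H => b • q)
    (f := fun q : G ⧸ H => b⁻¹ • q) (hM.mdifferentiableAt_smul _ _)
    (hM.mdifferentiableAt_smul _ _)]
  simp only [smul_inv_smul]
  rw [modelDeriv_id]; rfl

/-- `g` is a `G`-invariant metric on `G ⧸ H`, on the model space. -/
def IsInvariantForm (g : G ⧸ H → LinearMap.BilinForm ℝ F) : Prop :=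
  ∀ (a : G) (p : G ⧸ H) (u w : F),
    g (a • p) (modelDeriv (F := F) (F' := F) (fun q : G ⧸ H => a • q) p u)
      (modelDeriv (F := F) (F' := F) (fun q : G ⧸ H => a • q) p w) = g p u w

/-- The expression in the chart at `x` of a field of bilinear forms. -/
def chartForm (g : G ⧸ H → LinearMap.BilinForm ℝ F) (x : G ⧸ H) (y : F) :
    LinearMap.BilinForm ℝ F :=
  (g ((extChartAt 𝓘(ℝ, F) x).symm y)).comp
    (modelDeriv (F := F) (F' := F) (extChartAt 𝓘(ℝ, F) x).symm y).toLinearMap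
    (modelDeriv (F := F) (F' := F) (extChartAt 𝓘(ℝ, F) x).symm y).toLinearMap

omit [FiniteDimensional ℝ F] [IsManifold 𝓘(ℝ, F) ∞ (G ⧸ H)] in
theorem chartForm_apply (g : G ⧸ H → LinearMap.BilinForm ℝ F) (x : G ⧸ H) (y u w : F) :
    chartForm g x y u w = g ((extChartAt 𝓘(ℝ, F) x).symm y)
      (modelDeriv (F := F) (F' := F) (extChartAt 𝓘(ℝ, F) x).symm y u)
      (modelDeriv (F := F) (F' := F) (extChartAt 𝓘(ℝ, F) x).symm y w) := rfl

/-- Translation by `a⁻¹` moves any point `aH` to the base point; its differential is injective, so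
definiteness is transported with symmetry. -/
theorem IsInvariantForm.symm_pos (hM : IsQuotientManifold E F H)
    {g : G ⧸ H → LinearMap.BilinForm ℝ F} (hg : IsInvariantForm g)
    (hs : ∀ u w, g ((1 : G) : G ⧸ H) u w = g ((1 : G) : G ⧸ H) w u)
    (hp : ∀ u, u ≠ 0 → 0 < g ((1 : G) : G ⧸ H) u u) (p : G ⧸ H) :
    (∀ u w, g p u w = g p w u) ∧ ∀ u, u ≠ 0 → 0 < g p u u := by
  obtain ⟨a, rfl⟩ := QuotientGroup.mk_surjective p
  have h1 : a⁻¹ • (a : G ⧸ H) = ((1 : G) : G ⧸ H) := by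
    change ((a⁻¹ * a : G) : G ⧸ H) = _
    rw [inv_mul_cancel]
  have h2 := fun u w => hg a⁻¹ (a : G ⧸ H) u w
  simp only [h1] at h2
  refine ⟨fun u w => by rw [← h2, ← h2, hs], fun u hu => ?_⟩
  rw [← h2]
  refine hp _ fun h0 => hu ?_
  have := hM.modelDeriv_smul_inv a (a : G ⧸ H) u
  rw [h0, map_zero] at this
  exact this.symm

/-- Invariance in a chart. -/
theorem IsInvariantForm.chartForm_smul (hM : IsQuotientManifold E F H)
    {g : G ⧸ H → LinearMap.BilinForm ℝ F} (hg : IsInvariantForm g) (x : G ⧸ H) (b : G) {y : F}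
    (hy : y ∈ (extChartAt 𝓘(ℝ, F) x).target)
    (hb : b • (extChartAt 𝓘(ℝ, F) x).symm y ∈ (extChartAt 𝓘(ℝ, F) x).source) (u w : F) :
    let T := fderiv ℝ (fun z => extChartAt 𝓘(ℝ, F) x (b • (extChartAt 𝓘(ℝ, F) x).symm z)) y
    chartForm g x (extChartAt 𝓘(ℝ, F) x (b • (extChartAt 𝓘(ℝ, F) x).symm y)) (T u) (T w) =
      chartForm g x y u w := by
  intro T
  set φ := extChartAt 𝓘(ℝ, F) x
  have hT : ∀ v, T v = modelDeriv (F := F) (F' := F) φ (b • φ.symm y)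
      (modelDeriv (F := F) (F' := F) (fun q : G ⧸ H => b • q) (φ.symm y)
        (modelDeriv (F := F) (F' := F) φ.symm y v)) := by
    intro v
    have e1 := mdifferentiableAt_extChartAt_symm' x hy
    have e2 := hM.mdifferentiableAt_smul b (φ.symm y)
    have e3 := mdifferentiableAt_extChartAt_of_mem x hb
    simp only [T]
    rw [← modelDeriv_eq_fderiv,
      modelDeriv_comp_apply (F' := F) (g := φ) (f := fun z => b • φ.symm z) e3
        (MDifferentiableAt.comp (g := fun q : G ⧸ H => b • q) _ e2 e1),
      modelDeriv_comp_apply (F' := F) (g := fun q : G ⧸ H => b • q) (f := φ.symm) e2 e1]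
  rw [chartForm_apply, hT, hT, modelDeriv_symm_apply_chart x hb, modelDeriv_symm_apply_chart x hb,
    φ.left_inv hb, hg, chartForm_apply]

end Action

/-! ### Smoothness of invariant metrics; the fundamental fields. -/

section KillingFields

variable {E : Type*} [NormedAddCommGroup E] [NormedSpace ℝ E]
  {G : Type*} [TopologicalSpace G] [ChartedSpace E G] [Group G] [LieGroup 𝓘(ℝ, E) ∞ G]
  {F : Type*} [NormedAddCommGroup F] [NormedSpace ℝ F] [FiniteDimensional ℝ F]
  {H : Subgroup G} [ChartedSpace F (G ⧸ H)] [IsManifold 𝓘(ℝ, F) ∞ (G ⧸ H)]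

/-- An invariant metric is smooth in charts. -/
theorem IsInvariantForm.contDiffAt_chartForm (hM : IsQuotientManifold E F H)
    {g : G ⧸ H → LinearMap.BilinForm ℝ F} (hg : IsInvariantForm g) (x : G ⧸ H) :
    ContDiffAt ℝ 2 (fun y => LinearMap.toContinuousBilinearMap (chartForm g x y))
      (extChartAt 𝓘(ℝ, F) x x) := by
  obtain ⟨a, ha⟩ := QuotientGroup.mk_surjective x
  obtain ⟨s, hs, hsec⟩ := hM.exists_section x
  set φ := extChartAt 𝓘(ℝ, F) x
  have hφx : φ.symm (φ x) = x := extChartAt_to_inv x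
  have hsymm : ContMDiffAt 𝓘(ℝ, F) 𝓘(ℝ, F) ∞ φ.symm (φ x) :=
    contMDiffAt_extChartAt_symm x (mem_extChartAt_target x)
  -- In the first variable `y` this picks the translation `a s(y)⁻¹`, which carries `y` to `x`. By
  -- invariance the form at `y` is the fixed form at `x` pulled back by the derivative of that
  -- translation, so smoothness comes from the action alone and need not be assumed of `g`.
  let Λ : F × F → F := fun p => φ ((a * (s (φ.symm p.1))⁻¹) • φ.symm p.2)
  have hbase : ∀ q : G ⧸ H, (s q : G ⧸ H) = q → (a * (s q)⁻¹) • q = x := by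
    intro q hq
    conv_lhs => rw [← hq]
    change ((a * (s (s q : G ⧸ H))⁻¹ * s q : G) : G ⧸ H) = x
    rw [hq, inv_mul_cancel_right, ha]
  have hΛM : ContMDiffAt 𝓘(ℝ, F × F) 𝓘(ℝ, F) ∞ Λ (φ x, φ x) := by
    have h1 : ContMDiffAt 𝓘(ℝ, F × F) 𝓘(ℝ, F) ∞ (fun p : F × F => φ.symm p.1) (φ x, φ x) :=
      ContMDiffAt.comp (φ x, φ x) (g := φ.symm) (f := fun p : F × F => p.1) hsymm
        contDiffAt_fst.contMDiffAt
    have h2 : ContMDiffAt 𝓘(ℝ, F × F) 𝓘(ℝ, F) ∞ (fun p : F × F => φ.symm p.2) (φ x, φ x) :=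
      ContMDiffAt.comp (φ x, φ x) (g := φ.symm) (f := fun p : F × F => p.2) hsymm
        contDiffAt_snd.contMDiffAt
    have h3 : ContMDiffAt 𝓘(ℝ, F × F) 𝓘(ℝ, E) ∞ (fun p : F × F => s (φ.symm p.1)) (φ x, φ x) := by
      refine ContMDiffAt.comp (φ x, φ x) (g := s) (f := fun p : F × F => φ.symm p.1) ?_ h1
      simp only [hφx]; exact hs
    have h4 := hM.contMDiffAt_smul (contMDiffAt_const (c := a) |>.mul h3.inv) h2
    refine ContMDiffAt.comp (φ x, φ x) (g := φ) ?_ h4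
    have : (a * (s (φ.symm (φ x)))⁻¹) • φ.symm (φ x) = x := by
      rw [hφx]; exact hbase x hsec.self_of_nhds
    change ContMDiffAt _ _ _ φ ((a * (s (φ.symm (φ x)))⁻¹) • φ.symm (φ x))
    rw [this]
    exact contMDiffAt_extChartAt
  have hΛ : ContDiffAt ℝ (3 : ℕ) Λ (φ x, φ x) :=
    (contMDiffAt_iff_contDiffAt.1 hΛM).of_le (by norm_cast)
  let T : F → F →L[ℝ] F := fun y => fderiv ℝ (fun z => Λ (y, z)) y
  have hT : ContDiffAt ℝ 2 T (φ x) := by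
    have h1 := contDiffAt_partial_snd (m := 2) hΛ le_rfl
    have h2 : ContDiffAt ℝ 2 (fun y : F => (y, y)) (φ x) := contDiffAt_id.prodMk contDiffAt_id
    exact ContDiffAt.comp (f := fun y : F => (y, y)) _ h1 h2
  let b := LinearMap.toContinuousBilinearMap (chartForm g x (φ x))
  have hsm : ContDiffAt ℝ 2
      (fun y => ((ContinuousLinearMap.compL ℝ F F ℝ).flip (T y)).comp (b.comp (T y))) (φ x) :=
    ((ContinuousLinearMap.compL ℝ F F ℝ).flip.contDiff.contDiffAt.comp (φ x) hT).clm_comp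
      (contDiffAt_const.clm_comp hT)
  refine hsm.congr_of_eventuallyEq ?_
  have hc1 : ∀ᶠ y in 𝓝 (φ x), y ∈ φ.target := extChartAt_target_mem x (mem_extChartAt_target x)
  have hc2 : ∀ᶠ y in 𝓝 (φ x), (s (φ.symm y) : G ⧸ H) = φ.symm y := by
    refine hsymm.continuousAt.eventually (p := fun q => (s q : G ⧸ H) = q) ?_
    rw [hφx]; exact hsec
  filter_upwards [hc1, hc2] with y h1 h2
  have hy := hbase _ h2
  ext u w
  have := hg.chartForm_smul hM x (a * (s (φ.symm y))⁻¹) h1 (by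
    rw [hy]; exact mem_extChartAt_source x) u w
  rw [hy] at this
  exact this.symm

theorem IsInvariantForm.chartForm_symm_pos (hM : IsQuotientManifold E F H)
    {g : G ⧸ H → LinearMap.BilinForm ℝ F} (hg : IsInvariantForm g)
    (hs : ∀ u w, g ((1 : G) : G ⧸ H) u w = g ((1 : G) : G ⧸ H) w u)
    (hp : ∀ u, u ≠ 0 → 0 < g ((1 : G) : G ⧸ H) u u) (x : G ⧸ H) {y : F}
    (hy : y ∈ (extChartAt 𝓘(ℝ, F) x).target) :
    (∀ u w, chartForm g x y u w = chartForm g x y w u) ∧ ∀ u, u ≠ 0 → 0 < chartForm g x y u u := by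
  obtain ⟨h1, h2⟩ := hg.symm_pos hM hs hp ((extChartAt 𝓘(ℝ, F) x).symm y)
  refine ⟨fun u w => h1 _ _, fun u hu => h2 _ fun h0 => hu ?_⟩
  have := modelDeriv_chart_apply_symm x hy u
  have h0' : modelDeriv (F := F) (F' := F) (extChartAt 𝓘(ℝ, F) x).symm y u = 0 := h0
  rw [h0', map_zero] at this
  exact this.symm

/-- The action of `G` on `G ⧸ H`, conjugated by `a`, in the charts at `1` and at `aH`. -/
def chartAction (F : Type*) [NormedAddCommGroup F] [NormedSpace ℝ F] (H : Subgroup G)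
    [ChartedSpace F (G ⧸ H)] (a : G) (p : E × F) : F :=
  extChartAt 𝓘(ℝ, F) (a : G ⧸ H) ((a * (extChartAt 𝓘(ℝ, E) (1 : G)).symm p.1 * a⁻¹) •
    (extChartAt 𝓘(ℝ, F) (a : G ⧸ H)).symm p.2)

/-- The Killing field of the conjugated action, in the chart at `aH`. -/
def killingField (F : Type*) [NormedAddCommGroup F] [NormedSpace ℝ F] (H : Subgroup G)
    [ChartedSpace F (G ⧸ H)] (a : G) (X : E) (y : F) : F :=
  fderiv ℝ (fun z => chartAction F H a (z, y)) (chartOne E G) X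

/-- The coordinates of the point `aH`. -/
def chartBase (F : Type*) [NormedAddCommGroup F] [NormedSpace ℝ F] (H : Subgroup G)
    [ChartedSpace F (G ⧸ H)] (a : G) : F := extChartAt 𝓘(ℝ, F) (a : G ⧸ H) (a : G ⧸ H)

omit [TopologicalSpace G] in
theorem conj_smul_mk (a b : G) : (a * b * a⁻¹) • (a : G ⧸ H) = a • (b : G ⧸ H) := by
  change ((a * b * a⁻¹ * a : G) : G ⧸ H) = ((a * b : G) : G ⧸ H)
  rw [inv_mul_cancel_right]

theorem contMDiffAt_conj_smul (hM : IsQuotientManifold E F H) (a : G) :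
    ContMDiffAt 𝓘(ℝ, E × F) 𝓘(ℝ, F) ∞
      (fun p : E × F => (a * (extChartAt 𝓘(ℝ, E) (1 : G)).symm p.1 * a⁻¹) •
        (extChartAt 𝓘(ℝ, F) (a : G ⧸ H)).symm p.2) (chartOne E G, chartBase F H a) := by
  have h1 : ContMDiffAt 𝓘(ℝ, E × F) 𝓘(ℝ, E) ∞
      (fun p : E × F => (extChartAt 𝓘(ℝ, E) (1 : G)).symm p.1) (chartOne E G, chartBase F H a) :=
    ContMDiffAt.comp (chartOne E G, chartBase F H a) (g := (extChartAt 𝓘(ℝ, E) (1 : G)).symm)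
      (f := fun p : E × F => p.1)
      (contMDiffAt_extChartAt_symm _ chartOne_mem_target) contDiffAt_fst.contMDiffAt
  have h2 : ContMDiffAt 𝓘(ℝ, E × F) 𝓘(ℝ, F) ∞
      (fun p : E × F => (extChartAt 𝓘(ℝ, F) (a : G ⧸ H)).symm p.2)
      (chartOne E G, chartBase F H a) :=
    ContMDiffAt.comp (chartOne E G, chartBase F H a)
      (g := (extChartAt 𝓘(ℝ, F) (a : G ⧸ H)).symm) (f := fun p : E × F => p.2)
      (contMDiffAt_extChartAt_symm _ (mem_extChartAt_target _)) contDiffAt_snd.contMDiffAt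
  exact hM.contMDiffAt_smul ((contMDiffAt_const.mul h1).mul contMDiffAt_const) h2

omit [LieGroup 𝓘(ℝ, E) ∞ G] [FiniteDimensional ℝ F] [IsManifold 𝓘(ℝ, F) ∞ (G ⧸ H)] in
theorem conj_smul_base (a : G) : (a * (extChartAt 𝓘(ℝ, E) (1 : G)).symm (chartOne E G) * a⁻¹) •
        (extChartAt 𝓘(ℝ, F) (a : G ⧸ H)).symm (chartBase F H a) = (a : G ⧸ H) := by
  rw [chartSymm_chartOne, chartBase, extChartAt_to_inv]
  simp

theorem contDiffAt_chartAction (hM : IsQuotientManifold E F H) (a : G) (n : ℕ) :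
    ContDiffAt ℝ n (chartAction F H a) (chartOne E G, chartBase F H a) := by
  have h : ContMDiffAt 𝓘(ℝ, E × F) 𝓘(ℝ, F) ∞ (chartAction F H a)
      (chartOne E G, chartBase F H a) := by
    refine ContMDiffAt.comp (chartOne E G, chartBase F H a)
      (g := extChartAt 𝓘(ℝ, F) (a : G ⧸ H)) ?_ (contMDiffAt_conj_smul hM a)
    simp only [conj_smul_base]
    exact contMDiffAt_extChartAt
  exact (contMDiffAt_iff_contDiffAt.1 h).of_le (by exact_mod_cast le_top)

theorem eventually_conj_smul_mem (hM : IsQuotientManifold E F H) (a : G) :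
    ∀ᶠ p : E × F in 𝓝 (chartOne E G, chartBase F H a),
      (a * (extChartAt 𝓘(ℝ, E) (1 : G)).symm p.1 * a⁻¹) •
        (extChartAt 𝓘(ℝ, F) (a : G ⧸ H)).symm p.2 ∈ (extChartAt 𝓘(ℝ, F) (a : G ⧸ H)).source := by
  refine (contMDiffAt_conj_smul hM a).continuousAt.eventually ?_
  simp only [conj_smul_base]
  exact extChartAt_source_mem _ (mem_extChartAt_source _)

omit [LieGroup 𝓘(ℝ, E) ∞ G] [FiniteDimensional ℝ F] [IsManifold 𝓘(ℝ, F) ∞ (G ⧸ H)] in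
theorem chartAction_chartOne (a : G) {y : F}
    (hy : y ∈ (extChartAt 𝓘(ℝ, F) (a : G ⧸ H)).target) :
    chartAction F H a (chartOne E G, y) = y := by
  simp only [chartAction, chartSymm_chartOne, mul_one, mul_inv_cancel, one_smul]
  exact (extChartAt 𝓘(ℝ, F) (a : G ⧸ H)).right_inv hy

theorem contDiffAt_killingField (hM : IsQuotientManifold E F H) (a : G) (X : E) :
    ContDiffAt ℝ 2 (killingField F H a X) (chartBase F H a) := by
  have h := contDiffAt_partial_fst (m := 2) (contDiffAt_chartAction hM a 3) le_rfl
  have h2 : ContDiffAt ℝ 2 (fun y : F => (chartOne E G, y)) (chartBase F H a) :=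
    contDiffAt_const.prodMk contDiffAt_id
  exact (ContDiffAt.comp (f := fun y : F => (chartOne E G, y)) _ h h2).clm_apply contDiffAt_const

/-- Conjugating the action by `a` makes the value at `aH` the translate by `a` of the value at the
base point. No `Ad a` appears, so the same `X` serves at every point. -/
theorem killingField_base (hM : IsQuotientManifold E F H) (a : G) (X : E) :
    killingField F H a X (chartBase F H a) =
      modelDeriv (F := F) (F' := F) (fun q : G ⧸ H => a • q) ((1 : G) : G ⧸ H)
        (modelDeriv (F := E) (F' := F) (fun b : G => (b : G ⧸ H)) 1 X) := by
  have e1 : MDifferentiableAt 𝓘(ℝ, E) 𝓘(ℝ, F) (fun b : G => (b : G ⧸ H)) 1 :=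
    hM.contMDiff.contMDiffAt.mdifferentiableAt (by simp)
  have e2 := hM.mdifferentiableAt_smul a ((1 : G) : G ⧸ H)
  have h0 : a • ((1 : G) : G ⧸ H) = (a : G ⧸ H) := by
    change ((a * 1 : G) : G ⧸ H) = _; rw [mul_one]
  have h := fderiv_chart_comp (a : G ⧸ H) (c := fun b : G => a • (b : G ⧸ H))
    (MDifferentiableAt.comp (g := fun q : G ⧸ H => a • q) _ e2 e1)
    (by rw [h0]; exact mem_extChartAt_source _) X
  rw [h0, modelDeriv_chart_self] at h
  rw [modelDeriv_comp_apply (F' := F) (g := fun q : G ⧸ H => a • q)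
    (f := fun b : G => (b : G ⧸ H)) e2 e1] at h
  simp only [killingField, chartAction, chartBase, extChartAt_to_inv, conj_smul_mk]
  exact h

end KillingFields

/-! ### The fundamental fields form a Killing family. -/

section KillingEquations

variable {E : Type*} [NormedAddCommGroup E] [NormedSpace ℝ E]
  {G : Type*} [TopologicalSpace G] [ChartedSpace E G] [Group G] [LieGroup 𝓘(ℝ, E) ∞ G]
  {F : Type*} [NormedAddCommGroup F] [NormedSpace ℝ F] [FiniteDimensional ℝ F]
  {H : Subgroup G} [ChartedSpace F (G ⧸ H)] [IsManifold 𝓘(ℝ, F) ∞ (G ⧸ H)]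

/-- Associativity of the action in charts. The nested neighbourhoods allow differentiation in `z`
for each fixed `q` near the centre. -/
theorem chartAction_mul (hM : IsQuotientManifold E F H) (a : G) :
    ∀ᶠ q : E × F in 𝓝 (chartOne E G, chartBase F H a), ∀ᶠ z in 𝓝 (chartOne E G),
      chartAction F H a (chartMul E G (z, q.1), q.2) =
        chartAction F H a (z, chartAction F H a q) := by
  have hc : ContinuousAt (fun r : E × E => (extChartAt 𝓘(ℝ, E) (1 : G)).symm r.1 *
      (extChartAt 𝓘(ℝ, E) (1 : G)).symm r.2) (chartOne E G, chartOne E G) := by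
    have h0 : ContinuousAt (extChartAt 𝓘(ℝ, E) (1 : G)).symm (chartOne E G) :=
      (contMDiffAt_extChartAt_symm (1 : G) chartOne_mem_target).continuousAt
    have : ContinuousMul G := continuousMul_of_contMDiffMul 𝓘(ℝ, E) ∞
    exact (ContinuousAt.comp (x := (chartOne E G, chartOne E G)) (f := Prod.fst) h0
      continuousAt_fst).mul (ContinuousAt.comp (x := (chartOne E G, chartOne E G)) (f := Prod.snd)
        h0 continuousAt_snd)
  have h1 : ∀ᶠ r : E × E in 𝓝 (chartOne E G, chartOne E G),
      (extChartAt 𝓘(ℝ, E) (1 : G)).symm r.1 * (extChartAt 𝓘(ℝ, E) (1 : G)).symm r.2 ∈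
        (extChartAt 𝓘(ℝ, E) (1 : G)).source := by
    refine hc.eventually ?_
    simp only [chartSymm_chartOne, mul_one]
    exact extChartAt_source_mem _ (mem_extChartAt_source _)
  have h2 : ∀ᶠ y in 𝓝 (chartOne E G), ∀ᶠ z in 𝓝 (chartOne E G),
      (extChartAt 𝓘(ℝ, E) (1 : G)).symm z * (extChartAt 𝓘(ℝ, E) (1 : G)).symm y ∈
        (extChartAt 𝓘(ℝ, E) (1 : G)).source := by
    have hswap : Filter.Tendsto (Prod.swap : E × E → E × E) (𝓝 (chartOne E G, chartOne E G))
      (𝓝 (chartOne E G, chartOne E G)) := continuous_swap.tendsto _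
    have := hswap.eventually h1
    rw [nhds_prod_eq] at this
    exact this.curry
  have h3 : ∀ᶠ q : E × F in 𝓝 (chartOne E G, chartBase F H a), ∀ᶠ z in 𝓝 (chartOne E G),
      (extChartAt 𝓘(ℝ, E) (1 : G)).symm z * (extChartAt 𝓘(ℝ, E) (1 : G)).symm q.1 ∈
        (extChartAt 𝓘(ℝ, E) (1 : G)).source := by
    have hf : ContinuousAt (fun q : E × F => q.1) (chartOne E G, chartBase F H a) := continuousAt_fst
    exact hf.eventually h2
  filter_upwards [h3, eventually_conj_smul_mem hM a] with q h4 h5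
  filter_upwards [h4] with z h6
  simp only [chartAction, chartMul]
  rw [(extChartAt 𝓘(ℝ, E) (1 : G)).left_inv h6,
    (extChartAt 𝓘(ℝ, F) (a : G ⧸ H)).left_inv h5, smul_smul]
  congr 2
  group

/-- The right invariant fields are related to the Killing fields by the orbit maps. -/
theorem fderiv_chartAction_rightField (hM : IsQuotientManifold E F H) (a : G) :
    ∀ᶠ q : E × F in 𝓝 (chartOne E G, chartBase F H a), ∀ X : E,
      fderiv ℝ (fun z => chartAction F H a (z, q.2)) q.1 (rightField E G X q.1) =
        killingField F H a X (chartAction F H a q) := by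
  have h1 := (contDiffAt_chartAction hM a 2).eventually (by simp)
  have h2 : ∀ᶠ q : E × F in 𝓝 (chartOne E G, chartBase F H a),
      ContDiffAt ℝ (2 : ℕ) (chartMul E G) (chartOne E G, q.1) := by
    have hc : ContinuousAt (fun q : E × F => (chartOne E G, q.1))
      (chartOne E G, chartBase F H a) := by fun_prop
    exact hc.eventually (contDiffAt_chartMul_nat (E := E) (G := G) 2 |>.eventually (by simp))
  have h3 : ∀ᶠ q : E × F in 𝓝 (chartOne E G, chartBase F H a),
      chartMul E G (chartOne E G, q.1) = q.1 := by
    have hf : ContinuousAt (fun q : E × F => q.1) (chartOne E G, chartBase F H a) := continuousAt_fst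
    exact hf.eventually chartMul_chartOne_left
  filter_upwards [h1, h2, h3, chartAction_mul hM a] with q h4 h5 h6 h7 X
  have e1 : DifferentiableAt ℝ (fun z => chartAction F H a (z, q.2)) q.1 :=
    DifferentiableAt.comp (f := fun z : E => (z, q.2)) q.1 (differentiableAt_of_contDiffAt_two h4)
      (differentiableAt_id.prodMk (differentiableAt_const _))
  have e2 : DifferentiableAt ℝ (fun z => chartMul E G (z, q.1)) (chartOne E G) :=
    DifferentiableAt.comp (f := fun z : E => (z, q.1)) _ (differentiableAt_of_contDiffAt_two h5)
      (differentiableAt_id.prodMk (differentiableAt_const _))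
  have e1' : DifferentiableAt ℝ (fun z => chartAction F H a (z, q.2))
      (chartMul E G (chartOne E G, q.1)) := by rwa [h6]
  have h8 := fderiv_fun_comp (𝕜 := ℝ) (chartOne E G) e1' e2
  rw [h6] at h8
  rw [killingField, ← Filter.EventuallyEq.fderiv_eq h7, h8]
  rfl

/-- The bracket of the Killing fields. -/
theorem bracket_killingField (hM : IsQuotientManifold E F H) (a : G) (X Y : E) :
    ∀ᶠ y in 𝓝 (chartBase F H a),
      fderiv ℝ (killingField F H a Y) y (killingField F H a X y) -
        fderiv ℝ (killingField F H a X) y (killingField F H a Y y) =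
          killingField F H a (modelBracket E G Y X) y := by
  have hc : ContinuousAt (fun y : F => (chartOne E G, y)) (chartBase F H a) := by fun_prop
  have h1 := hc.eventually (contDiffAt_chartAction hM a 2 |>.eventually (by simp))
  have h2 := hc.eventually (fderiv_chartAction_rightField hM a).eventually_nhds
  have h3 := extChartAt_target_mem (a : G ⧸ H) (mem_extChartAt_target (I := 𝓘(ℝ, F)) (a : G ⧸ H))
  filter_upwards [h1, h2, h3, (contDiffAt_killingField hM a X).eventually (by simp),
    (contDiffAt_killingField hM a Y).eventually (by simp)] with y h4 h5 h6 h7 h8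
  have hy := chartAction_chartOne (E := E) a h6
  have hf : ContDiffAt ℝ 2 (fun z => chartAction F H a (z, y)) (chartOne E G) :=
    ContDiffAt.comp (f := fun z : E => (z, y)) _ h4 (contDiffAt_id.prodMk contDiffAt_const)
  have hc2 : ContinuousAt (fun z : E => (z, y)) (chartOne E G) := by fun_prop
  have h9 := hc2.eventually h5
  -- The orbit map of `y` relates right invariant fields to Killing fields. The bracket of right
  -- invariant fields is opposite to the Lie algebra bracket, whence the order `Y X`.
  have key := fderiv_bracket_of_related hf
    (V := rightField E G X) (W := rightField E G Y)
    (V' := killingField F H a X) (W' := killingField F H a Y)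
    (differentiableAt_of_contDiffAt_two (contDiffAt_rightField X))
    (differentiableAt_of_contDiffAt_two (contDiffAt_rightField Y))
    (by rw [hy]; exact differentiableAt_of_contDiffAt_two h7)
    (by rw [hy]; exact differentiableAt_of_contDiffAt_two h8)
    (h9.mono fun z hz => hz X) (h9.mono fun z hz => hz Y)
  simp only [hy, rightField_chartOne, fderiv_rightField] at key
  rw [key, modelBracket_eq_fderiv_leftField]
  rfl

/-- Invariant metrics are preserved by the Killing fields. -/
theorem IsInvariantForm.isKillingAt (hM : IsQuotientManifold E F H)
    {g : G ⧸ H → LinearMap.BilinForm ℝ F} (hg : IsInvariantForm g) (a : G) (X : E) :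
    ∀ᶠ y in 𝓝 (chartBase F H a),
      IsKillingAt (fun y => LinearMap.toContinuousBilinearMap (chartForm g (a : G ⧸ H) y))
        (killingField F H a X) y := by
  set m : F → F →L[ℝ] F →L[ℝ] ℝ :=
    fun y => LinearMap.toContinuousBilinearMap (chartForm g (a : G ⧸ H) y) with hm
  have hms : ContDiffAt ℝ 2 m (chartBase F H a) := hg.contDiffAt_chartForm hM (a : G ⧸ H)
  have hc : ContinuousAt (fun y : F => (chartOne E G, y)) (chartBase F H a) := by fun_prop
  have h1 := hc.eventually (contDiffAt_chartAction hM a 3 |>.eventually (by simp))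
  have h2 := hc.eventually (eventually_conj_smul_mem hM a).eventually_nhds
  have h3 := extChartAt_target_mem (a : G ⧸ H) (mem_extChartAt_target (I := 𝓘(ℝ, F)) (a : G ⧸ H))
  filter_upwards [h1, h2, h3, hms.eventually (by simp)] with y h4 h5 h6 h7 u w
  have hy := chartAction_chartOne (E := E) a h6
  have hc2 : ContinuousAt (fun z : E => (z, y)) (chartOne E G) := by fun_prop
  let D : E → F →L[ℝ] F := fun z => fderiv ℝ (fun y' => chartAction F H a (z, y')) y
  -- Invariance says that this function of the group variable is constant. Its derivative at the
  -- identity in the direction `X` is the Killing equation, mixed partials turning the derivative of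
  -- `D` into that of the Killing field.
  have hinv : ∀ᶠ z in 𝓝 (chartOne E G),
      m (chartAction F H a (z, y)) (D z u) (D z w) = m y u w := by
    filter_upwards [hc2.eventually h5] with z hz
    exact hg.chartForm_smul hM (a : G ⧸ H) _ h6 hz u w
  have hD : ContDiffAt ℝ (2 : ℕ) D (chartOne E G) := by
    have h := contDiffAt_partial_snd (m := 2) h4 le_rfl
    have h' : ContDiffAt ℝ (2 : ℕ) (fun z : E => (z, y)) (chartOne E G) :=
      contDiffAt_id.prodMk contDiffAt_const
    exact ContDiffAt.comp (f := fun z : E => (z, y)) _ h h'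
  have hDd : ∀ v, DifferentiableAt ℝ (fun z => D z v) (chartOne E G) := fun v =>
    (differentiableAt_of_contDiffAt_two hD).clm_apply (differentiableAt_const v)
  have hD1 : D (chartOne E G) = ContinuousLinearMap.id ℝ F := by
    have : (fun y' => chartAction F H a (chartOne E G, y')) =ᶠ[𝓝 y] fun y' => y' := by
      filter_upwards [extChartAt_target_mem (a : G ⧸ H) h6] with y' hy'
      exact chartAction_chartOne (E := E) a hy'
    simp only [D]
    rw [this.fderiv_eq]; exact fderiv_fun_id
  have hact : DifferentiableAt ℝ (fun z => chartAction F H a (z, y)) (chartOne E G) :=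
    DifferentiableAt.comp (f := fun z : E => (z, y)) _ (h4.differentiableAt (by norm_num))
      (differentiableAt_id.prodMk (differentiableAt_const _))
  have hmd : DifferentiableAt ℝ m (chartAction F H a (chartOne E G, y)) := by
    rw [hy]; exact differentiableAt_of_contDiffAt_two h7
  have hmix : ∀ v, fderiv ℝ (fun z => D z v) (chartOne E G) X =
      fderiv ℝ (killingField F H a X) y v := fun v =>
    fderiv_partial_comm (p := (chartOne E G, y)) (h4.of_le (by norm_num)) X v
  have key := fderiv_bilinear_apply (a := fun z => m (chartAction F H a (z, y)))
    (DifferentiableAt.comp (f := fun z => chartAction F H a (z, y)) _ hmd hact) (hDd u) (hDd w) X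
  rw [Filter.EventuallyEq.fderiv_eq hinv, fderiv_fun_comp (g := m)
    (f := fun z => chartAction F H a (z, y)) _ hmd hact] at key
  have hk : fderiv ℝ (fun z => chartAction F H a (z, y)) (chartOne E G) X =
    killingField F H a X y := rfl
  simp only [ContinuousLinearMap.comp_apply, hk, hD1, hmix, hy] at key
  simpa using key.symm

/-- The Killing fields of an invariant metric form a Killing family. -/
theorem IsInvariantForm.isKillingFamily (hM : IsQuotientManifold E F H)
    {g : G ⧸ H → LinearMap.BilinForm ℝ F} (hg : IsInvariantForm g) (a : G) :
    IsKillingFamily (fun y => LinearMap.toContinuousBilinearMap (chartForm g (a : G ⧸ H) y))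
      (chartBase F H a) (killingField F H a) (fun X Y => modelBracket E G Y X) where
  contDiffAt := contDiffAt_killingField hM a
  killing := hg.isKillingAt hM a
  bracket := bracket_killingField hM a

end KillingEquations

/-! ### Irreducible decompositions adapted to a symmetric endomorphism. -/

section Decomposition

variable {V : Type*} [AddCommGroup V] [Module ℝ V] [FiniteDimensional ℝ V]

theorem isCompl_orthogonal_of_pos (Q : LinearMap.BilinForm ℝ V) (hs : ∀ x y, Q x y = Q y x)
    (hp : ∀ x, x ≠ 0 → 0 < Q x x) (W : Submodule ℝ V) : IsCompl W (Q.orthogonal W) := by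
  have hrefl : Q.IsRefl := fun x y h => by rw [hs, h]
  refine (LinearMap.BilinForm.isCompl_orthogonal_iff_disjoint hrefl).2 ?_
  rw [Submodule.disjoint_def]
  intro x hx hx'
  by_contra hne
  exact (hp x hne).ne' (hx' x hx)

/-- Orthogonal decomposition into irreducible summands on which a commuting symmetric endomorphism
is scalar. -/
theorem exists_irreducible_eigen_decomposition (Q : LinearMap.BilinForm ℝ V)
    (hs : ∀ x y, Q x y = Q y x) (hp : ∀ x, x ≠ 0 → 0 < Q x x) (A : Set (V →ₗ[ℝ] V))
    (hA : ∀ a ∈ A, ∀ x y, Q (a x) (a y) = Q x y) (T : Module.End ℝ V)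
    (hT : ∀ x y, Q (T x) y = Q x (T y)) (n : ℕ) : ∀ W : Submodule ℝ V, Module.finrank ℝ W = n →
    (∀ a ∈ A, ∀ x ∈ W, a x ∈ W) → (∀ x ∈ W, T x ∈ W) → (∀ a ∈ A, ∀ x ∈ W, T (a x) = a (T x)) →
    ∃ (l : ℕ) (φ : Fin l → Submodule ℝ V) (c : Fin l → ℝ), ⨆ i, φ i = W ∧
      (∀ i j, i ≠ j → ∀ x ∈ φ i, ∀ y ∈ φ j, Q x y = 0) ∧ (∀ i, ∀ a ∈ A, ∀ x ∈ φ i, a x ∈ φ i) ∧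
      (∀ i, φ i ≠ ⊥) ∧ (∀ i, ∀ W' ≤ φ i, (∀ a ∈ A, ∀ x ∈ W', a x ∈ W') → W' = ⊥ ∨ W' = φ i) ∧
      ∀ i, ∀ x ∈ φ i, T x = c i • x := by
  induction n using Nat.strong_induction_on with
  | _ n ih =>
  intro W hn hWA hWT hcomm
  by_cases hW : W = ⊥
  · subst hW
    exact ⟨0, Fin.elim0, Fin.elim0, by simp, fun i => i.elim0, fun i => i.elim0,
      fun i => i.elim0, fun i => i.elim0, fun i => i.elim0⟩
  -- a minimal invariant subspace
  let S : Set (Submodule ℝ V) := {W' | W' ≤ W ∧ W' ≠ ⊥ ∧ (∀ a ∈ A, ∀ x ∈ W', a x ∈ W') ∧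
    ∀ x ∈ W', T x ∈ W'}
  obtain ⟨W₁, ⟨h1W, h1ne, h1A, h1T⟩, hmin⟩ := (wellFounded_lt (α := Submodule ℝ V)).has_min S
    ⟨W, le_rfl, hW, hWA, hWT⟩
  have hmin' : ∀ W' ≤ W₁, W' ≠ ⊥ → (∀ a ∈ A, ∀ x ∈ W', a x ∈ W') → (∀ x ∈ W', T x ∈ W') →
      W' = W₁ := by
    intro W' hle hne hA' hT'
    by_contra hneq
    exact hmin W' ⟨hle.trans h1W, hne, hA', hT'⟩ (lt_of_le_of_ne hle hneq)
  -- `W₁` is minimal among subspaces invariant under both `A` and `T`. An eigenspace of `T` in `W₁`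
  -- is again invariant under both, hence is all of `W₁`.
  obtain ⟨μ, hμ⟩ : ∃ μ : ℝ, ∀ x ∈ W₁, T x = μ • x := by
    obtain ⟨e, μ, -, heig⟩ := exists_orthonormal_eigenvectors (Q.restrict W₁)
      (fun x y => hs x y) (fun x hx => hp x fun h => hx (Subtype.ext h)) (T.restrict h1T)
      (fun x y => hT x y)
    have hpos : 0 < Module.finrank ℝ W₁ := by
      rw [Nat.pos_iff_ne_zero, Ne, Submodule.finrank_eq_zero]; exact h1ne
    let i0 : Fin (Module.finrank ℝ W₁) := ⟨0, hpos⟩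
    have hei : T (e i0 : V) = μ i0 • (e i0 : V) := congrArg Subtype.val (heig i0)
    let W₂ := W₁ ⊓ LinearMap.ker (T - μ i0 • LinearMap.id)
    have hmem : ∀ x, x ∈ W₂ ↔ x ∈ W₁ ∧ T x = μ i0 • x := by
      intro x
      simp [W₂, sub_eq_zero]
    have hW₂ : W₂ = W₁ := by
      refine hmin' W₂ inf_le_left ?_ ?_ ?_
      · intro hbot
        have : (e i0 : V) ∈ W₂ := (hmem _).2 ⟨(e i0).2, hei⟩
        rw [hbot, Submodule.mem_bot] at this
        exact e.ne_zero i0 (Subtype.ext this)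
      · intro a ha x hx
        obtain ⟨hx1, hx2⟩ := (hmem x).1 hx
        exact (hmem _).2 ⟨h1A a ha x hx1, by rw [hcomm a ha x (h1W hx1), hx2, map_smul]⟩
      · intro x hx
        obtain ⟨hx1, hx2⟩ := (hmem x).1 hx
        exact (hmem _).2 ⟨h1T x hx1, by rw [hx2, map_smul, hx2]⟩
    exact ⟨μ i0, fun x hx => ((hmem x).1 (hW₂.symm ▸ hx)).2⟩
  -- As `T` is scalar on `W₁`, invariance under `T` is automatic there, and minimality becomes
  -- irreducibility under `A` alone.
  have hirr : ∀ W' ≤ W₁, (∀ a ∈ A, ∀ x ∈ W', a x ∈ W') → W' = ⊥ ∨ W' = W₁ := by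
    intro W' hle hA'
    by_cases hb : W' = ⊥
    · exact Or.inl hb
    · exact Or.inr (hmin' W' hle hb hA' fun x hx => by
        rw [hμ x (hle hx)]; exact W'.smul_mem _ hx)
  -- the orthogonal complement in `W`
  let W₃ := W ⊓ Q.orthogonal W₁
  have hmem3 : ∀ x, x ∈ W₃ ↔ x ∈ W ∧ ∀ y ∈ W₁, Q y x = 0 := fun x => Iff.rfl
  have hc := isCompl_orthogonal_of_pos Q hs hp W₁
  have hsup : W₁ ⊔ W₃ = W := by
    refine le_antisymm (sup_le h1W inf_le_left) fun x hx => ?_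
    have hx' : x ∈ W₁ ⊔ Q.orthogonal W₁ := by rw [hc.sup_eq_top]; trivial
    obtain ⟨y, hy, z, hz, rfl⟩ := Submodule.mem_sup.1 hx'
    refine Submodule.mem_sup.2 ⟨y, hy, z, ⟨?_, hz⟩, rfl⟩
    simpa using W.sub_mem hx (h1W hy)
  have h3lt : Module.finrank ℝ W₃ < n := by
    rw [← hn]
    refine Submodule.finrank_lt_finrank_of_lt (lt_of_le_of_ne inf_le_left fun h => h1ne ?_)
    rw [Submodule.eq_bot_iff]
    intro x hx
    have hx3 : x ∈ W₃ := h.symm ▸ h1W hx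
    by_contra hne
    exact (hp x hne).ne' (((hmem3 x).1 hx3).2 x hx)
  have h3A : ∀ a ∈ A, ∀ x ∈ W₃, a x ∈ W₃ := by
    intro a ha x hx
    refine (hmem3 _).2 ⟨hWA a ha x hx.1, fun y hy => ?_⟩
    -- `A` is only a set of isometries, not assumed closed under inverses; injectivity in finite
    -- dimension shows that `a` maps `W₁` onto itself, hence preserves the orthogonal complement.
    have hinj : Function.Injective (a.restrict (h1A a ha)) := by
      rw [injective_iff_map_eq_zero]
      intro z hz
      have hz' : a (z : V) = 0 := congrArg Subtype.val hz
      by_contra hne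
      have h := hp z fun h => hne (Subtype.ext h)
      rw [← hA a ha, hz'] at h
      simp at h
    obtain ⟨z, hz⟩ := (LinearMap.injective_iff_surjective.1 hinj) ⟨y, hy⟩
    have hz' : a (z : V) = y := congrArg Subtype.val hz
    rw [← hz', hA a ha]
    exact hx.2 z z.2
  have h3T : ∀ x ∈ W₃, T x ∈ W₃ := by
    intro x hx
    refine (hmem3 _).2 ⟨hWT x hx.1, fun y hy => ?_⟩
    rw [← hT]
    exact hx.2 _ (h1T y hy)
  obtain ⟨l, φ, c, hsup', horth, hinv, hne, hir, heig⟩ := ih _ h3lt W₃ rfl h3A h3T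
    (fun a ha x hx => hcomm a ha x hx.1)
  have hφ : ∀ i, φ i ≤ W₃ := fun i => hsup' ▸ le_iSup φ i
  refine ⟨l + 1, Fin.cons W₁ φ, Fin.cons μ c, ?_, ?_, ?_, ?_, ?_, ?_⟩
  · rw [← hsup, ← hsup']
    refine le_antisymm (iSup_le fun i => ?_) (sup_le ?_ (iSup_le fun i => ?_))
    · refine Fin.cases ?_ (fun j => ?_) i
      · exact le_sup_left
      · exact (le_iSup φ j).trans le_sup_right
    · exact le_iSup (Fin.cons W₁ φ : Fin (l + 1) → Submodule ℝ V) 0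
    · exact le_iSup (Fin.cons W₁ φ : Fin (l + 1) → Submodule ℝ V) i.succ
  · intro i j
    refine Fin.cases ?_ (fun i => ?_) i <;> refine Fin.cases ?_ (fun j => ?_) j
    · intro h; exact absurd rfl h
    · intro _ x hx y hy
      exact (hφ j hy).2 x hx
    · intro _ x hx y hy
      rw [hs]; exact (hφ i hx).2 y hy
    · intro h x hx y hy
      exact horth i j (fun h' => h (congrArg Fin.succ h')) x hx y hy
  · intro i
    refine Fin.cases ?_ (fun i => ?_) i
    · exact h1A
    · exact hinv i
  · intro i
    refine Fin.cases ?_ (fun i => ?_) i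
    · exact h1ne
    · exact hne i
  · intro i
    refine Fin.cases ?_ (fun i => ?_) i
    · exact hirr
    · exact hir i
  · intro i
    refine Fin.cases ?_ (fun i => ?_) i
    · exact hμ
    · exact heig i

end Decomposition

/-! ### The algebraic lower bound. -/

section RicciSum

variable {V : Type*} [AddCommGroup V] [Module ℝ V]
  {Q : LinearMap.BilinForm ℝ V} {L : V →ₗ[ℝ] V →ₗ[ℝ] V}

theorem bracket_antisymm (hself : ∀ X, L X X = 0) (X Y : V) : L X Y = -L Y X := by
  have h := hself (X + Y)
  simp only [map_add, LinearMap.add_apply, hself, zero_add, add_zero] at h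
  exact eq_neg_of_add_eq_zero_right h

/-- Invariance of `Q` makes `Q([X,Y],Z)` alternating in all three arguments. -/
theorem apply_bracket_cycle (hs : ∀ X Y, Q X Y = Q Y X) (hself : ∀ X, L X X = 0)
    (hskew : ∀ X Y Z, Q (L X Y) Z + Q Y (L X Z) = 0) (X Y Z : V) :
    Q (L X Y) Z = Q (L Y Z) X := by
  have h1 := hskew Y X Z
  have h2 : Q (L X Y) Z = -Q (L Y X) Z := by rw [bracket_antisymm hself]; simp
  rw [h2, hs _ X]
  linarith

/-- A lower bound for the Bochner sum of a Killing field `X` along a diagonal family of metrics. -/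
theorem le_ricci_sum {ι : Type*} [Fintype ι] (hs : ∀ X Y, Q X Y = Q Y X)
    (hself : ∀ X, L X X = 0)
    (hskew : ∀ X Y Z, Q (L X Y) Z + Q Y (L X Z) = 0) (e U : ι → V) (μ : ι → ℝ) (X : V) (c t : ℝ)
    (hU : ∀ i, U i = Real.exp (-(t * μ i) / 2) • e i)
    (hbl : ∀ i j, μ i ≠ μ j → Q (L X (e i)) (e j) = 0) (b : LinearMap.BilinForm ℝ V)
    (hbs : ∀ X Y, b X Y = b Y X) (hb : ∀ Y i, b Y (e i) = Real.exp (t * μ i) * Q Y (e i))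
    (hbX : ∀ Y, b Y X = Real.exp (t * c) * Q Y X) (hbU : ∀ Y, b Y Y = ∑ j, b Y (U j) * b Y (U j))
    (hbessel : ∀ Y, ∑ j, Q Y (e j) ^ 2 ≤ Q Y Y) :
    (1 / 4) * ∑ i, (if μ i = c then Q (L X (e i)) (L X (e i)) else 0) ≤
      ∑ i, ((∑ j, (1 / 4) * (b (L X (U i)) (U j) + b (L (U j) (U i)) X + b (U i) (L (U j) X)) ^ 2)
        - b (L (L X (U i)) (U i)) X - b (L X (U i)) (L X (U i))) := by
  rw [Finset.mul_sum]
  refine Finset.sum_le_sum fun i _ => ?_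
  set q : ι → ℝ := fun j => Q (L X (e i)) (e j) with hq
  set N := Q (L X (e i)) (L X (e i)) with hN
  set S := ∑ j, q j ^ 2 with hS
  set σ := Real.exp (t * (c - μ i)) with hσ
  have hSN : S ≤ N := hbessel _
  have hS0 : 0 ≤ S := Finset.sum_nonneg fun j _ => sq_nonneg _
  have hσ0 : 0 < σ := Real.exp_pos _
  have hee : Real.exp (-(t * μ i) / 2) * Real.exp (-(t * μ i) / 2) * Real.exp (t * μ i) = 1 := by
    rw [← Real.exp_add, ← Real.exp_add, Real.exp_eq_one_iff]; ring
  have hec : Real.exp (-(t * μ i) / 2) * Real.exp (-(t * μ i) / 2) * Real.exp (t * c) = σ := by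
    rw [← Real.exp_add, ← Real.exp_add]; congr 1; ring
  -- By `hbl` only indices with `μ i = μ j` contribute, and for these the normalising exponentials
  -- cancel. The three terms of Koszul's formula become `q j`, `-σ q j` and `q j`.
  have h1 : ∀ j, b (L X (U i)) (U j) = q j := by
    intro j
    by_cases hij : μ i = μ j
    · simp only [hU, map_smul, LinearMap.smul_apply, smul_eq_mul, hb, ← hij]
      linear_combination (q j) * hee
    · simp [hU, hb, hq, hbl i j hij]
  have h2 : ∀ j, b (L (U j) (U i)) X = -(σ * q j) := by
    intro j
    have h3 : Q (L (e j) (e i)) X = -q j := by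
      rw [bracket_antisymm hself (e j), map_neg, LinearMap.neg_apply, hq]
      simp only [apply_bracket_cycle hs hself hskew X (e i) (e j)]
    by_cases hij : μ i = μ j
    · simp only [hU, map_smul, LinearMap.smul_apply, smul_eq_mul, hbX, ← hij, h3]
      linear_combination (-q j) * hec
    · have h4 : q j = 0 := hbl i j hij
      simp [hU, hbX, h3, h4]
  have h3 : ∀ j, b (U i) (L (U j) X) = q j := by
    intro j
    have h4 : Q (L (e j) X) (e i) = q j := by
      rw [hq]; simp only [apply_bracket_cycle hs hself hskew (e j) X (e i)]
    rw [hbs]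
    by_cases hij : μ i = μ j
    · simp only [hU, map_smul, LinearMap.smul_apply, smul_eq_mul, hb, ← hij, h4]
      linear_combination (q j) * hee
    · have h5 : q j = 0 := hbl i j hij
      simp [hU, hb, h4, h5]
  have h4 : b (L (L X (U i)) (U i)) X = -(σ * N) := by
    have h5 : Q (L (L X (e i)) (e i)) X = -N := by
      rw [apply_bracket_cycle hs hself hskew, bracket_antisymm hself, map_neg,
        LinearMap.neg_apply, hN]
    simp only [hU, map_smul, LinearMap.smul_apply, smul_eq_mul, hbX, h5]
    linear_combination (-N) * hec
  have h5 : b (L X (U i)) (L X (U i)) = S := by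
    rw [hbU]; simp only [h1, hS, sq]
  have h6 : ∑ j, (1 / 4) * (b (L X (U i)) (U j) + b (L (U j) (U i)) X + b (U i) (L (U j) X)) ^ 2 =
      (1 / 4) * (2 - σ) ^ 2 * S := by
    rw [hS, Finset.mul_sum]
    refine Finset.sum_congr rfl fun j _ => ?_
    rw [h1, h2, h3]; ring
  rw [h6, h4, h5]
  -- The summand equals `σ(N - S) + σ²S/4`. For `μ i = c` one has `σ = 1`, and `N - 3S/4 ≥ N/4`
  -- since `S ≤ N`.
  split_ifs with hc
  · have : σ = 1 := by rw [hσ, hc]; simp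
    rw [this]; linarith
  · have h7 : 0 ≤ σ * (N - S) := mul_nonneg hσ0.le (by linarith)
    have h8 : 0 ≤ σ ^ 2 * S := by positivity
    nlinarith

end RicciSum

/-! ### The bracket of the Lie algebra as a bilinear map. -/

section GroupBracket

variable {E : Type*} [NormedAddCommGroup E] [NormedSpace ℝ E] [FiniteDimensional ℝ E]
  {G : Type*} [TopologicalSpace G] [ChartedSpace E G] [Group G] [LieGroup 𝓘(ℝ, E) ∞ G]

omit [LieGroup 𝓘(ℝ, E) ∞ G] in
instance finiteDimensional_groupLieAlgebra :
    FiniteDimensional ℝ (GroupLieAlgebra 𝓘(ℝ, E) G) := inferInstanceAs (FiniteDimensional ℝ E)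

/-- The Lie bracket is bilinear and alternating. -/
theorem exists_bracket_bilinear :
    ∃ L : GroupLieAlgebra 𝓘(ℝ, E) G →ₗ[ℝ] GroupLieAlgebra 𝓘(ℝ, E) G →ₗ[ℝ]
      GroupLieAlgebra 𝓘(ℝ, E) G, (∀ X Y, L X Y = ⁅X, Y⁆) ∧ ∀ X, L X X = 0 := by
  have : CompleteSpace E := FiniteDimensional.complete ℝ E
  have : LieGroup 𝓘(ℝ, E) (minSmoothness ℝ 3) G :=
    LieGroup.of_le (n := ∞) (by
      rw [minSmoothness_of_isRCLikeNormedField]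
      exact WithTop.coe_le_coe.2 (le_top (a := (3 : ℕ∞))))
  exact ⟨LieModule.toEnd ℝ (GroupLieAlgebra 𝓘(ℝ, E) G) (GroupLieAlgebra 𝓘(ℝ, E) G),
    fun X Y => rfl, fun X => lie_self X⟩

variable {Q : LinearMap.BilinForm ℝ (GroupLieAlgebra 𝓘(ℝ, E) G)}

theorem IsAdInvariantInner.skew (hQ : IsAdInvariantInner Q)
    (X Y Z : GroupLieAlgebra 𝓘(ℝ, E) G) : Q ⁅X, Y⁆ Z + Q Y ⁅X, Z⁆ = 0 :=
  apply_modelBracket_of_invariant (E := E) (G := G) Q hQ.invariant X Y Z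

end GroupBracket

/-! ### The isotropy algebra, its complement, and good decompositions. -/

section Isotropy

variable {E : Type*} [NormedAddCommGroup E] [NormedSpace ℝ E] [FiniteDimensional ℝ E]
  {G : Type*} [TopologicalSpace G] [ChartedSpace E G] [Group G] [LieGroup 𝓘(ℝ, E) ∞ G]
  {F : Type*} [NormedAddCommGroup F] [NormedSpace ℝ F] [FiniteDimensional ℝ F]
  {H : Subgroup G} [ChartedSpace F (G ⧸ H)] [IsManifold 𝓘(ℝ, F) ∞ (G ⧸ H)]

theorem mem_isotropyAlgebra (X : GroupLieAlgebra 𝓘(ℝ, E) G) : X ∈ isotropyAlgebra E F H ↔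
    modelDeriv (F := E) (F' := F) (fun b : G => (b : G ⧸ H)) 1 X = 0 := Iff.rfl

theorem killingField_base_eq_zero_iff (hM : IsQuotientManifold E F H) (a : G) (X : E) :
    killingField F H a X (chartBase F H a) = 0 ↔
      modelDeriv (F := E) (F' := F) (fun b : G => (b : G ⧸ H)) 1 X = 0 := by
  rw [killingField_base hM]
  refine ⟨fun h => ?_, fun h => by rw [h, map_zero]⟩
  have h1 := hM.modelDeriv_smul_inv a⁻¹ ((1 : G) : G ⧸ H)
    (modelDeriv (F := E) (F' := F) (fun b : G => (b : G ⧸ H)) 1 X)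
  simp only [inv_inv] at h1
  rw [h, map_zero] at h1
  exact h1.symm

/-- The isotropy algebra is a Lie subalgebra. -/
theorem IsQuotientManifold.lie_mem_isotropyAlgebra (hM : IsQuotientManifold E F H)
    {X Y : GroupLieAlgebra 𝓘(ℝ, E) G} (hX : X ∈ isotropyAlgebra E F H)
    (hY : Y ∈ isotropyAlgebra E F H) : ⁅X, Y⁆ ∈ isotropyAlgebra E F H := by
  have hX' := (killingField_base_eq_zero_iff hM (1 : G) X).2 hX
  have hY' := (killingField_base_eq_zero_iff hM (1 : G) Y).2 hY
  refine (killingField_base_eq_zero_iff hM (1 : G) (modelBracket E G X Y)).1 ?_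
  -- Two fields that vanish at the base point have a bracket that vanishes there.
  rw [← (bracket_killingField hM (1 : G) Y X).self_of_nhds, hX', hY', map_zero, map_zero, sub_zero]

/-- For `h` in `H` the projection satisfies `π(h x h⁻¹) = h • π(x)`, so conjugation preserves the
kernel of its differential. -/
theorem IsQuotientManifold.isAdInvariant_isotropyAlgebra (hM : IsQuotientManifold E F H) :
    IsAdInvariant H (isotropyAlgebra E F H) := by
  intro h hh X hX
  have hπ : ∀ a : G, MDifferentiableAt 𝓘(ℝ, E) 𝓘(ℝ, F) (fun b : G => (b : G ⧸ H)) a :=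
    fun a => hM.contMDiff.contMDiffAt.mdifferentiableAt (by simp)
  have h1 := modelDeriv_comp_apply (F := E) (F' := E) (F'' := F) (g := fun b : G => (b : G ⧸ H))
    (f := fun x : G => h * x * h⁻¹) (p := 1) (hπ _) (mdifferentiableAt_conj (E := E) _ _) X
  have h2 := modelDeriv_comp_apply (F := E) (F' := F) (F'' := F) (g := fun q : G ⧸ H => h • q)
    (f := fun b : G => (b : G ⧸ H)) (p := 1) (hM.mdifferentiableAt_smul _ _) (hπ _) X
  have h3 : (fun x : G => ((h * x * h⁻¹ : G) : G ⧸ H)) = fun x : G => h • (x : G ⧸ H) := by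
    funext x
    change _ = ((h * x : G) : G ⧸ H)
    exact (QuotientGroup.mk_mul_of_mem _ (H.inv_mem hh))
  rw [mem_isotropyAlgebra] at hX ⊢
  rw [h3, h2, hX, map_zero] at h1
  simp only [mul_one, mul_inv_cancel] at h1
  exact h1.symm

theorem Ad_Ad_inv (a : G) (X : GroupLieAlgebra 𝓘(ℝ, E) G) : Ad a (Ad a⁻¹ X) = X := by
  have h1 := modelDeriv_comp_apply (F := E) (F' := E) (F'' := E) (g := fun x : G => a * x * a⁻¹)
    (f := fun x : G => a⁻¹ * x * a⁻¹⁻¹) (p := 1) (mdifferentiableAt_conj (E := E) _ _)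
    (mdifferentiableAt_conj (E := E) _ _) X
  have h2 : (fun x : G => a * (a⁻¹ * x * a⁻¹⁻¹) * a⁻¹) = fun x => x := by funext x; group
  have h3 : a⁻¹ * 1 * a⁻¹⁻¹ = 1 := by group
  rw [h2, h3, modelDeriv_id] at h1
  exact h1.symm

variable {Q : LinearMap.BilinForm ℝ (GroupLieAlgebra 𝓘(ℝ, E) G)}

theorem mem_complement {X : GroupLieAlgebra 𝓘(ℝ, E) G} : X ∈ complement F H Q ↔
    ∀ A ∈ isotropyAlgebra E F H, Q A X = 0 := Iff.rfl

theorem IsQuotientManifold.isAdInvariant_complement (hM : IsQuotientManifold E F H)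
    (hQ : IsAdInvariantInner Q) : IsAdInvariant H (complement F H Q) := by
  intro h hh X hX
  rw [mem_complement] at hX ⊢
  intro A hA
  rw [← Ad_Ad_inv h A, hQ.invariant]
  exact hX _ (hM.isAdInvariant_isotropyAlgebra _ (H.inv_mem hh) _ hA)

theorem IsAdInvariantInner.isCompl (hQ : IsAdInvariantInner Q) :
    IsCompl (isotropyAlgebra E F H) (complement F H Q) :=
  isCompl_orthogonal_of_pos Q hQ.symm hQ.pos _

/-- The extension of an endomorphism of `𝔪` by zero on `𝔥`. -/
theorem exists_extension (hQ : IsAdInvariantInner Q) (v : Module.End ℝ (complement F H Q)) :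
    ∃ T : Module.End ℝ (GroupLieAlgebra 𝓘(ℝ, E) G),
      (∀ X : complement F H Q, T X = v X) ∧ (∀ A ∈ isotropyAlgebra E F H, T A = 0) := by
  let P := (complement F H Q).projectionOnto _ (hQ.isCompl (F := F) (H := H)).symm
  refine ⟨(complement F H Q).subtype ∘ₗ v ∘ₗ P, fun X => ?_, fun A hA => ?_⟩
  · have : P X = X := Submodule.projectionOnto_apply_left _ X
    simp [this]
  · have : P A = 0 := Submodule.projectionOnto_apply_right _ ⟨A, hA⟩
    simp [this]

theorem IsAdInvariantInner.exists_add (hQ : IsAdInvariantInner Q)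
    (X : GroupLieAlgebra 𝓘(ℝ, E) G) :
    ∃ A ∈ isotropyAlgebra E F H, ∃ Y ∈ complement F H Q, A + Y = X :=
  Submodule.mem_sup.1 ((hQ.isCompl (F := F) (H := H)).sup_eq_top ▸ Submodule.mem_top)

/-- The conditions defining submersion directions quantify over good decompositions and carry
information only because one exists. Extended by zero on `𝔥`, `v` is symmetric on `𝔤` and commutes
with `Ad(H)` on `𝔪`, so `𝔪` splits as required. -/
theorem IsUnitDirection.exists_isGoodDecomposition (hM : IsQuotientManifold E F H)
    (hQ : IsAdInvariantInner Q) {v : Module.End ℝ (complement F H Q)} (hv : IsUnitDirection Q v) :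
    ∃ (l : ℕ) (φ : Fin l → Submodule ℝ (GroupLieAlgebra 𝓘(ℝ, E) G)) (c : Fin l → ℝ),
      IsGoodDecomposition Q v φ c := by
  obtain ⟨T, hTm, hTh⟩ := exists_extension hQ v
  have hort : ∀ A ∈ isotropyAlgebra E F H, ∀ Y ∈ complement F H Q, Q A Y = 0 :=
    fun A hA Y hY => hY A hA
  have hT : ∀ X Y, Q (T X) Y = Q X (T Y) := by
    intro X Y
    obtain ⟨A, hA, X', hX', rfl⟩ := hQ.exists_add (F := F) (H := H) X
    obtain ⟨B, hB, Y', hY', rfl⟩ := hQ.exists_add (F := F) (H := H) Y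
    have e1 := hTm ⟨X', hX'⟩
    have e2 := hTm ⟨Y', hY'⟩
    have e3 := hv.symm ⟨X', hX'⟩ ⟨Y', hY'⟩
    have e4 := hort A hA _ (v ⟨Y', hY'⟩).2
    have e5 := hort B hB _ (v ⟨X', hX'⟩).2
    rw [hQ.symm] at e5
    simp only [map_add, LinearMap.add_apply, hTh A hA, hTh B hB, e1, e2, zero_add, e3, e4, e5]
  obtain ⟨l, φ, c, h1, h2, h3, h4, h5, h6⟩ := exists_irreducible_eigen_decomposition Q hQ.symm
    hQ.pos {f | ∃ h ∈ H, f = Ad h} (by rintro _ ⟨h, -, rfl⟩ X Y; exact hQ.invariant h X Y) T hT _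
    (complement F H Q) rfl
    (by rintro _ ⟨h, hh, rfl⟩ X hX; exact hM.isAdInvariant_complement hQ h hh X hX)
    (fun X hX => by rw [hTm ⟨X, hX⟩]; exact (v ⟨X, hX⟩).2)
    (by
      rintro _ ⟨h, hh, rfl⟩ X hX
      rw [hTm ⟨X, hX⟩, hTm ⟨Ad h X, hM.isAdInvariant_complement hQ h hh X hX⟩]
      exact (hv.equivariant h hh _ _ rfl).symm)
  refine ⟨l, φ, c, ⟨h1, h2, fun i h hh X hX => h3 i _ ⟨h, hh, rfl⟩ X hX, h4, fun i W hW hinv =>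
    h5 i W hW ?_⟩, fun i X hX => ?_⟩
  · rintro _ ⟨h, hh, rfl⟩ X hX; exact hinv h hh X hX
  · apply Subtype.ext
    rw [← hTm]; exact h6 i X hX

end Isotropy

/-! ### Consequences of the submersion condition and of non-torality. -/

section SubmersionDirection

variable {E : Type*} [NormedAddCommGroup E] [NormedSpace ℝ E] [FiniteDimensional ℝ E]
  {G : Type*} [TopologicalSpace G] [ChartedSpace E G] [Group G] [LieGroup 𝓘(ℝ, E) ∞ G]
  {F : Type*} [NormedAddCommGroup F] [NormedSpace ℝ F] [FiniteDimensional ℝ F]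
  {H : Subgroup G} [ChartedSpace F (G ⧸ H)] [IsManifold 𝓘(ℝ, F) ∞ (G ⧸ H)]
  {Q : LinearMap.BilinForm ℝ (GroupLieAlgebra 𝓘(ℝ, E) G)}

omit [LieGroup 𝓘(ℝ, E) ∞ G] in
theorem IsAdInvariantInner.sum_smul_frame (hQ : IsAdInvariantInner Q)
    (W : Submodule ℝ (GroupLieAlgebra 𝓘(ℝ, E) G)) {X : GroupLieAlgebra 𝓘(ℝ, E) G} (hX : X ∈ W) :
    ∑ i, Q X (orthonormalFrame (fun X Y => Q X Y) W i) •
      orthonormalFrame (fun X Y => Q X Y) W i = X := by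
  obtain ⟨h1, h2⟩ := orthonormalFrame_spec Q hQ.symm hQ.pos W
  have h := sum_smul_of_orthonormal (Q.restrict W) (fun i => ⟨_, h1 i⟩) h2 (by simp) ⟨X, hX⟩
  simpa using congrArg Subtype.val h

/-- A sum of squares that is not positive has all its terms zero, and trilinearity passes from the
chosen frames to all vectors. -/
theorem apply_lie_eq_zero_of_bracketCoeff (hQ : IsAdInvariantInner Q)
    {A B C : Submodule ℝ (GroupLieAlgebra 𝓘(ℝ, E) G)} (h : ¬ 0 < bracketCoeff Q A B C)
    {X Y Z : GroupLieAlgebra 𝓘(ℝ, E) G} (hX : X ∈ A) (hY : Y ∈ B) (hZ : Z ∈ C) :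
    Q ⁅X, Y⁆ Z = 0 := by
  obtain ⟨L, hL, -⟩ := exists_bracket_bilinear (E := E) (G := G)
  simp only [← hL]
  have h0 : bracketCoeff Q A B C = 0 := le_antisymm (not_lt.1 h)
    (Finset.sum_nonneg fun _ _ => Finset.sum_nonneg fun _ _ => Finset.sum_nonneg fun _ _ =>
      sq_nonneg _)
  rw [bracketCoeff, Finset.sum_eq_zero_iff_of_nonneg (fun _ _ => Finset.sum_nonneg fun _ _ =>
    Finset.sum_nonneg fun _ _ => sq_nonneg _)] at h0
  have h1 : ∀ i j k, Q (L (orthonormalFrame (fun X Y => Q X Y) A i)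
      (orthonormalFrame (fun X Y => Q X Y) B j))
      (orthonormalFrame (fun X Y => Q X Y) C k) = 0 := by
    intro i j k
    have h2 := h0 i (Finset.mem_univ _)
    rw [Finset.sum_eq_zero_iff_of_nonneg (fun _ _ => Finset.sum_nonneg fun _ _ =>
      sq_nonneg _)] at h2
    have h3 := h2 j (Finset.mem_univ _)
    rw [Finset.sum_eq_zero_iff_of_nonneg (fun _ _ => sq_nonneg _)] at h3
    rw [hL]
    exact pow_eq_zero_iff (two_ne_zero) |>.1 (h3 k (Finset.mem_univ _))
  rw [← hQ.sum_smul_frame A hX, ← hQ.sum_smul_frame B hY, ← hQ.sum_smul_frame C hZ]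
  simp only [map_sum, LinearMap.sum_apply, map_smul, LinearMap.smul_apply, h1, smul_zero,
    Finset.sum_const_zero]

theorem IsAdInvariantInner.lie_cycle (hQ : IsAdInvariantInner Q)
    (X Y Z : GroupLieAlgebra 𝓘(ℝ, E) G) : Q ⁅X, Y⁆ Z = Q ⁅Y, Z⁆ X := by
  obtain ⟨L, hL, hself⟩ := exists_bracket_bilinear (E := E) (G := G)
  rw [← hL, ← hL]
  exact apply_bracket_cycle hQ.symm hself (fun X Y Z => by rw [hL, hL]; exact hQ.skew X Y Z) X Y Z

variable {𝔨 : Submodule ℝ (GroupLieAlgebra 𝓘(ℝ, E) G)} {v : Module.End ℝ (complement F H Q)}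

theorem IsSubmersionDirectionFor.apply_eq (hM : IsQuotientManifold E F H)
    (hQ : IsAdInvariantInner Q) (hv : IsSubmersionDirectionFor Q 𝔨 v) (X : complement F H Q)
    (hX : (X : GroupLieAlgebra 𝓘(ℝ, E) G) ∈ 𝔨) : v X = minEigenvalue Q v • X := by
  obtain ⟨l, φ, c, hφ⟩ := hv.isSubmersionDirection.isUnitDirection.exists_isGoodDecomposition hM hQ
  obtain ⟨T, hT, -⟩ := exists_extension hQ v
  have h1 : 𝔨 ⊓ complement F H Q ≤ LinearMap.ker (T - minEigenvalue Q v • LinearMap.id) := by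
    rw [← hv.first_eq l φ c hφ]
    refine iSup₂_le fun i hi Y hY => ?_
    have hYm : Y ∈ complement F H Q := hφ.isDecomposition.iSup_eq ▸ Submodule.mem_iSup_of_mem i hY
    have := congrArg Subtype.val (hφ.eigen i ⟨Y, hYm⟩ hY)
    rw [← hT, hi] at this
    simp only [LinearMap.mem_ker, LinearMap.sub_apply, LinearMap.smul_apply, LinearMap.id_apply,
      sub_eq_zero]
    exact this
  have h2 := h1 ⟨hX, X.2⟩
  simp only [LinearMap.mem_ker, LinearMap.sub_apply, LinearMap.smul_apply, LinearMap.id_apply,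
    sub_eq_zero, hT] at h2
  exact Subtype.ext h2

/-- The bracket with an element of `𝔨 ∩ 𝔪` preserves the eigenspaces of a `𝔨`-submersion
direction, up to components in `𝔥`. -/
theorem IsSubmersionDirectionFor.lie_eq_zero (hM : IsQuotientManifold E F H)
    (hQ : IsAdInvariantInner Q) (hv : IsSubmersionDirectionFor Q 𝔨 v)
    {X : GroupLieAlgebra 𝓘(ℝ, E) G} (hX : X ∈ 𝔨 ⊓ complement F H Q) {Y Z : complement F H Q}
    {a b : ℝ} (hY : v Y = a • Y) (hZ : v Z = b • Z) (hab : a ≠ b) :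
    Q ⁅X, (Y : GroupLieAlgebra 𝓘(ℝ, E) G)⁆ Z = 0 := by
  obtain ⟨L, hL, hself⟩ := exists_bracket_bilinear (E := E) (G := G)
  obtain ⟨l, φ, c, hφ⟩ := hv.isSubmersionDirection.isUnitDirection.exists_isGoodDecomposition hM hQ
  obtain ⟨T, hT, -⟩ := exists_extension hQ v
  have hTφ : ∀ i, ∀ Y ∈ φ i, T Y = c i • Y := by
    intro i Y hY
    have hYm : Y ∈ complement F H Q := hφ.isDecomposition.iSup_eq ▸ Submodule.mem_iSup_of_mem i hY
    have := congrArg Subtype.val (hφ.eigen i ⟨Y, hYm⟩ hY)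
    rw [← hT] at this
    exact this
  -- With `c i` minimal, the submersion inequality for `[k i j]` reads `c k ≤ c j`, and that for `[j
  -- i k]` the reverse. So the bracket vanishes unless `c j = c k`. Expressing this through `T`
  -- makes it linear in each vector, so that it extends from the summands to their sums.
  have h1 : ∀ i, c i = minEigenvalue Q v → ∀ X ∈ φ i, ∀ j, ∀ Y ∈ φ j, ∀ k, ∀ Z ∈ φ k,
      Q (L X (T Y)) Z = Q (L X Y) (T Z) := by
    intro i hi X hX j Y hY k Z hZ
    rw [hTφ j Y hY, hTφ k Z hZ]
    simp only [map_smul, LinearMap.smul_apply, smul_eq_mul]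
    rcases lt_trichotomy (c j) (c k) with h | h | h
    · have h2 : ¬ 0 < bracketCoeff Q (φ k) (φ i) (φ j) := fun h3 => by
        have := hv.isSubmersionDirection.nonpos l φ c hφ k i j h3
        linarith
      have h4 := apply_lie_eq_zero_of_bracketCoeff hQ h2 hZ hX hY
      rw [hQ.lie_cycle, ← hL] at h4
      rw [h4]; simp
    · rw [h]
    · have h2 : ¬ 0 < bracketCoeff Q (φ j) (φ i) (φ k) := fun h3 => by
        have := hv.isSubmersionDirection.nonpos l φ c hφ j i k h3
        linarith
      have h4 := apply_lie_eq_zero_of_bracketCoeff hQ h2 hY hX hZ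
      rw [← hL, bracket_antisymm hself, map_neg, LinearMap.neg_apply, neg_eq_zero] at h4
      rw [h4]; simp
  have hsup : ∀ f : GroupLieAlgebra 𝓘(ℝ, E) G →ₗ[ℝ] ℝ, (∀ i, ∀ Y ∈ φ i, f Y = 0) →
      ∀ Y : complement F H Q, f Y = 0 := by
    intro f hf Y
    have : complement F H Q ≤ LinearMap.ker f := by
      rw [← hφ.isDecomposition.iSup_eq]
      exact iSup_le hf
    exact this Y.2
  have h2 : ∀ i, c i = minEigenvalue Q v → ∀ X ∈ φ i, ∀ Y Z : complement F H Q,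
      Q (L X (T Y)) Z = Q (L X Y) (T Z) := by
    intro i hi X hX Y Z
    have h3 := hsup (Q.flip Z ∘ₗ L X ∘ₗ T - Q.flip (T Z) ∘ₗ L X) (fun j Y hY => ?_) Y
    · simpa [sub_eq_zero] using h3
    have h4 := hsup (Q (L X (T Y)) - Q (L X Y) ∘ₗ T) (fun k Z hZ => by
      simpa [sub_eq_zero] using h1 i hi X hX j Y hY k Z hZ) Z
    simpa [sub_eq_zero] using h4
  have h3 : 𝔨 ⊓ complement F H Q ≤
      LinearMap.ker (Q.flip Z ∘ₗ L.flip (T Y) - Q.flip (T Z) ∘ₗ L.flip Y) := by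
    rw [← hv.first_eq l φ c hφ]
    exact iSup₂_le fun i hi X hX => by simpa [sub_eq_zero] using h2 i hi X hX Y Z
  have h4 : Q (L X (T Y)) Z = Q (L X Y) (T Z) := by simpa [sub_eq_zero] using h3 hX
  rw [hT, hT, hY, hZ] at h4
  simp only [Submodule.coe_smul, map_smul, LinearMap.smul_apply, smul_eq_mul] at h4
  rw [← hL]
  exact (mul_eq_zero.1 (by linear_combination h4 : (a - b) * Q (L X Y) Z = 0)).resolve_left
    (sub_ne_zero.2 hab)

theorem IsUnitDirection.exists_eigenbasis (hQ : IsAdInvariantInner Q) (hv : IsUnitDirection Q v) :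
    ∃ (e : Module.Basis (Fin (Module.finrank ℝ (complement F H Q))) ℝ (complement F H Q))
      (μ : Fin (Module.finrank ℝ (complement F H Q)) → ℝ),
      (∀ i j, Q (e i) (e j) = if i = j then 1 else 0) ∧ ∀ i, v (e i) = μ i • e i :=
  exists_orthonormal_eigenvectors (Q.restrict (complement F H Q)) (fun X Y => hQ.symm X Y)
    (fun X hX => hQ.pos X fun h => hX (Subtype.ext h)) v hv.symm

theorem minEigenvalue_le (v : Module.End ℝ (complement F H Q)) {X : complement F H Q} (hX : X ≠ 0)
    {μ : ℝ} (h : v X = μ • X) : minEigenvalue Q v ≤ μ :=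
  csInf_le (Module.End.finite_hasEigenvalue v).bddBelow
    (Module.End.hasEigenvalue_of_hasEigenvector ⟨Module.End.mem_eigenspace_iff.2 h, hX⟩)

/-- Nonnegative eigenvalues with sum zero would all vanish, contradicting `Tr(v²) = 1`. -/
theorem IsUnitDirection.minEigenvalue_neg (hQ : IsAdInvariantInner Q) (hv : IsUnitDirection Q v) :
    minEigenvalue Q v < 0 := by
  obtain ⟨e, μ, he, hμ⟩ := hv.exists_eigenbasis hQ
  have h1 : ∑ i, μ i = 0 := by
    rw [← hv.trace_zero, LinearMap.trace_eq_matrix_trace ℝ e, Matrix.trace]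
    refine Finset.sum_congr rfl fun i _ => ?_
    simp [LinearMap.toMatrix_apply, hμ]
  have h2 : ∑ i, μ i * μ i = 1 := by
    rw [← hv.trace_sq, LinearMap.trace_eq_matrix_trace ℝ e, Matrix.trace]
    refine Finset.sum_congr rfl fun i _ => ?_
    simp [LinearMap.toMatrix_apply, hμ]
  by_contra hneg
  have h3 : ∀ i, 0 ≤ μ i := fun i => (not_lt.1 hneg).trans (minEigenvalue_le v (e.ne_zero i) (hμ i))
  have h4 := (Finset.sum_eq_zero_iff_of_nonneg fun i _ => h3 i).1 h1
  have h5 : ∑ i, μ i * μ i = 0 := Finset.sum_eq_zero fun i hi => by rw [h4 i hi, zero_mul]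
  linarith

/-- A non-toral `H`-subalgebra has a non-abelian complement of `𝔥`. -/
theorem IsHSubalgebra.exists_lie_ne_zero (hM : IsQuotientManifold E F H)
    (hQ : IsAdInvariantInner Q) (hk : IsHSubalgebra F H 𝔨) (hnt : ¬ IsToral F H 𝔨) :
    ∃ X ∈ 𝔨 ⊓ complement F H Q, ∃ Y ∈ 𝔨 ⊓ complement F H Q, ⁅X, Y⁆ ≠ 0 := by
  obtain ⟨L, hL, hself⟩ := exists_bracket_bilinear (E := E) (G := G)
  by_contra! h
  -- If `𝔨 ∩ 𝔪` is abelian, then `𝔥` commutes with it: `[A,X]` stays in `𝔨 ∩ 𝔪`, and `|[A,X]|² =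
  -- Q([X,[A,X]],A) = 0`. Then `[𝔨,𝔨] = [𝔥,𝔥] ⊆ 𝔥`, so `𝔨` would be toral.
  have h1 : ∀ A ∈ isotropyAlgebra E F H, ∀ X ∈ 𝔨 ⊓ complement F H Q, L A X = 0 := by
    intro A hA X hX
    have hAk : A ∈ 𝔨 := hk.isotropy_lt.le hA
    have hm : L A X ∈ complement F H Q := by
      rw [mem_complement]
      intro B hB
      rw [hQ.symm, hL, hQ.lie_cycle, hQ.lie_cycle]
      rw [hQ.symm, hQ.symm]
      exact hX.2 _ (hM.lie_mem_isotropyAlgebra hB hA)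
    have hk' : L A X ∈ 𝔨 := by rw [hL]; exact hk.lie_mem _ hAk _ hX.1
    by_contra hne
    refine (hQ.pos _ hne).ne' ?_
    nth_rewrite 1 [hL]
    rw [hQ.lie_cycle, h X hX _ ⟨hk', hm⟩]
    simp
  have hdec : ∀ X ∈ 𝔨, ∃ A ∈ isotropyAlgebra E F H, ∃ Y ∈ 𝔨 ⊓ complement F H Q, A + Y = X := by
    intro X hX
    obtain ⟨A, hA, Y, hY, rfl⟩ := hQ.exists_add (F := F) (H := H) X
    exact ⟨A, hA, Y, ⟨by simpa using 𝔨.sub_mem hX (hk.isotropy_lt.le hA), hY⟩, rfl⟩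
  refine hnt fun X hX Y hY => ?_
  obtain ⟨A, hA, X', hX', rfl⟩ := hdec X hX
  obtain ⟨B, hB, Y', hY', rfl⟩ := hdec Y hY
  have h2 : L X' B = 0 := by rw [bracket_antisymm hself, h1 B hB X' hX', neg_zero]
  have h3 : L X' Y' = 0 := by rw [hL]; exact h X' hX' Y' hY'
  rw [← hL]
  simp only [map_add, LinearMap.add_apply, h1 A hA Y' hY', h2, h3, add_zero]
  rw [hL]
  exact hM.lie_mem_isotropyAlgebra hA hB

end SubmersionDirection

/-! ### The metrics along the geodesic, pulled back to the Lie algebra. -/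

section Geodesic

variable {E : Type*} [NormedAddCommGroup E] [NormedSpace ℝ E] [FiniteDimensional ℝ E]
  {G : Type*} [TopologicalSpace G] [ChartedSpace E G] [Group G] [LieGroup 𝓘(ℝ, E) ∞ G]
  {F : Type*} [NormedAddCommGroup F] [NormedSpace ℝ F] [FiniteDimensional ℝ F]
  {H : Subgroup G} [ChartedSpace F (G ⧸ H)] [IsManifold 𝓘(ℝ, F) ∞ (G ⧸ H)]
  {Q : LinearMap.BilinForm ℝ (GroupLieAlgebra 𝓘(ℝ, E) G)}
  {v : Module.End ℝ (complement F H Q)}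

/-- Symmetry moves every power of `v` onto the eigenvector, and the defining series becomes the
exponential series. -/
theorem geodesic_apply_eigenvector (hv : IsUnitDirection Q v) (t : ℝ) (Y Z : complement F H Q)
    {μ : ℝ} (hZ : v Z = μ • Z) : geodesic Q v t Y Z = Real.exp (t * μ) * Q Y Z := by
  have h1 : ∀ n : ℕ, Q ((v ^ n) Y) Z = μ ^ n * Q Y Z := by
    intro n
    induction n with
    | zero => simp
    | succ n ih =>
      rw [pow_succ', Module.End.mul_apply, hv.symm, hZ]
      simp only [Submodule.coe_smul, map_smul, smul_eq_mul, ih]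
      ring
  rw [geodesic, Real.exp_eq_exp_ℝ, NormedSpace.exp_eq_tsum_div, ← tsum_mul_right]
  refine tsum_congr fun n => ?_
  rw [h1, mul_pow]; ring

/-- The pull-back to the Lie algebra of the value at the base point of a field of forms. -/
def pullbackForm (H : Subgroup G) [ChartedSpace F (G ⧸ H)]
    (g : G ⧸ H → LinearMap.BilinForm ℝ F) :
    LinearMap.BilinForm ℝ (GroupLieAlgebra 𝓘(ℝ, E) G) :=
  (g ((1 : G) : G ⧸ H)).comp (projDeriv F H) (projDeriv F H)

theorem pullbackForm_apply (g : G ⧸ H → LinearMap.BilinForm ℝ F)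
    (X Y : GroupLieAlgebra 𝓘(ℝ, E) G) :
    pullbackForm H g X Y = g ((1 : G) : G ⧸ H)
      (modelDeriv (F := E) (F' := F) (fun b : G => (b : G ⧸ H)) 1 X)
      (modelDeriv (F := E) (F' := F) (fun b : G => (b : G ⧸ H)) 1 Y) := rfl

theorem chartForm_killingField (hM : IsQuotientManifold E F H)
    {g : G ⧸ H → LinearMap.BilinForm ℝ F} (hg : IsInvariantForm g) (a : G) (X Y : E) :
    chartForm g (a : G ⧸ H) (chartBase F H a) (killingField F H a X (chartBase F H a))
      (killingField F H a Y (chartBase F H a)) = pullbackForm (E := E) H g X Y := by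
  have h0 : a • ((1 : G) : G ⧸ H) = (a : G ⧸ H) := by
    change ((a * 1 : G) : G ⧸ H) = _; rw [mul_one]
  have h1 := fun u => modelDeriv_symm_apply_chart (F := F) (a : G ⧸ H)
    (mem_extChartAt_source (I := 𝓘(ℝ, F)) (a : G ⧸ H)) u
  simp only [modelDeriv_chart_self, ContinuousLinearMap.id_apply] at h1
  have h2 := hg a ((1 : G) : G ⧸ H)
    (modelDeriv (F := E) (F' := F) (fun b : G => (b : G ⧸ H)) 1 X)
    (modelDeriv (F := E) (F' := F) (fun b : G => (b : G ⧸ H)) 1 Y)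
  rw [h0] at h2
  rw [chartForm_apply, killingField_base hM, killingField_base hM, chartBase, h1, h1,
    extChartAt_to_inv, h2]
  rfl

theorem pullbackForm_isotropy (g : G ⧸ H → LinearMap.BilinForm ℝ F)
    {A : GroupLieAlgebra 𝓘(ℝ, E) G} (hA : A ∈ isotropyAlgebra E F H)
    (Y : GroupLieAlgebra 𝓘(ℝ, E) G) : pullbackForm H g A Y = 0 := by
  have : modelDeriv (F := E) (F' := F) (fun b : G => (b : G ⧸ H)) 1 A = 0 := hA
  rw [pullbackForm_apply, this, map_zero, LinearMap.zero_apply]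

/-- `𝔥` lies in the kernel of the pulled-back form and is `Q`-orthogonal to `𝔪`, so the first
argument may be any element of `𝔤`; brackets need no projection to `𝔪`. -/
theorem pullbackForm_apply_eigenvector (hQ : IsAdInvariantInner Q) (hv : IsUnitDirection Q v)
    {t : ℝ} {g : G ⧸ H → LinearMap.BilinForm ℝ F}
    (hg : IsInvariantMetricOf Q (F := F) g (geodesic Q v t)) (Y : GroupLieAlgebra 𝓘(ℝ, E) G)
    {Z : complement F H Q} {μ : ℝ} (hZ : v Z = μ • Z) :
    pullbackForm H g Y Z = Real.exp (t * μ) * Q Y Z := by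
  obtain ⟨A, hA, Y, hY, rfl⟩ := hQ.exists_add (F := F) (H := H) Y
  rw [map_add, LinearMap.add_apply, pullbackForm_isotropy g hA, map_add, LinearMap.add_apply,
    mem_complement.1 Z.2 A hA, zero_add, zero_add, ← geodesic_apply_eigenvector hv t ⟨Y, hY⟩ Z hZ]
  exact hg.eval_base ⟨Y, hY⟩ Z

theorem sum_eigenbasis
    {e : Module.Basis (Fin (Module.finrank ℝ (complement F H Q))) ℝ (complement F H Q)}
    (he : ∀ i j, Q (e i) (e j) = if i = j then 1 else 0) (X : complement F H Q) :
    ∑ i, Q X (e i) • e i = X :=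
  sum_smul_of_orthonormal (Q.restrict (complement F H Q)) e he (by simp) X

theorem pullbackForm_eq_sum (hQ : IsAdInvariantInner Q) (hv : IsUnitDirection Q v)
    {t : ℝ} {g : G ⧸ H → LinearMap.BilinForm ℝ F}
    (hg : IsInvariantMetricOf Q (F := F) g (geodesic Q v t))
    {e : Module.Basis (Fin (Module.finrank ℝ (complement F H Q))) ℝ (complement F H Q)}
    {μ : Fin (Module.finrank ℝ (complement F H Q)) → ℝ}
    (he : ∀ i j, Q (e i) (e j) = if i = j then 1 else 0) (hμ : ∀ i, v (e i) = μ i • e i)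
    (X Y : GroupLieAlgebra 𝓘(ℝ, E) G) :
    pullbackForm H g X Y = ∑ j, Real.exp (t * μ j) * (Q X (e j) * Q Y (e j)) := by
  obtain ⟨B, hB, Y, hY, rfl⟩ := hQ.exists_add (F := F) (H := H) Y
  have hB0 : pullbackForm H g X B = 0 := by
    have : modelDeriv (F := E) (F' := F) (fun b : G => (b : G ⧸ H)) 1 B = 0 := hB
    rw [pullbackForm_apply, this, map_zero]
  have hQB : ∀ j, Q B (e j) = 0 := fun j => mem_complement.1 (e j).2 B hB
  have hexp := congrArg Subtype.val (sum_eigenbasis he ⟨Y, hY⟩)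
  simp only [map_add, LinearMap.add_apply, hB0, hQB, zero_add]
  rw [show pullbackForm H g X Y = pullbackForm H g X _ from congrArg _ hexp.symm]
  simp only [Submodule.coe_sum, Submodule.coe_smul, map_sum, map_smul, smul_eq_mul,
    pullbackForm_apply_eigenvector hQ hv hg _ (hμ _)]
  exact Finset.sum_congr rfl fun j _ => by ring

/-- Bessel's inequality; the deficit is the squared length of the `𝔥`-component. -/
theorem sum_sq_le (hQ : IsAdInvariantInner Q)
    {e : Module.Basis (Fin (Module.finrank ℝ (complement F H Q))) ℝ (complement F H Q)}
    (he : ∀ i j, Q (e i) (e j) = if i = j then 1 else 0) (Y : GroupLieAlgebra 𝓘(ℝ, E) G) :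
    ∑ j, Q Y (e j) ^ 2 ≤ Q Y Y := by
  obtain ⟨B, hB, Y, hY, rfl⟩ := hQ.exists_add (F := F) (H := H) Y
  have hQB : ∀ j, Q B (e j) = 0 := fun j => mem_complement.1 (e j).2 B hB
  have h1 : Q B Y = 0 := mem_complement.1 hY B hB
  have h2 : Q Y B = 0 := by rw [hQ.symm, h1]
  have h3 : 0 ≤ Q B B := by
    by_cases h : B = 0
    · simp [h]
    · exact (hQ.pos B h).le
  have h4 : Q Y Y = ∑ j, Q Y (e j) * Q Y (e j) :=
    apply_eq_sum_of_orthonormal (Q.restrict (complement F H Q)) (fun X Y => hQ.symm X Y) e he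
      (by simp) ⟨Y, hY⟩ ⟨Y, hY⟩
  simp only [map_add, LinearMap.add_apply, hQB, h1, h2, zero_add, add_zero, h4, sq]
  linarith

theorem IsQuotientManifold.exists_projDeriv_eq (hM : IsQuotientManifold E F H)
    (hQ : IsAdInvariantInner Q) (u : F) : ∃ X : complement F H Q,
      modelDeriv (F := E) (F' := F) (fun b : G => (b : G ⧸ H)) 1 (X : GroupLieAlgebra 𝓘(ℝ, E) G)
        = u := by
  obtain ⟨X, hX⟩ := hM.submersion 1 u
  obtain ⟨A, hA, Y, hY, rfl⟩ := hQ.exists_add (F := F) (H := H) X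
  refine ⟨⟨Y, hY⟩, ?_⟩
  have hA' : modelDeriv (F := E) (F' := F) (fun b : G => (b : G ⧸ H)) 1 A = 0 := hA
  have h := (modelDeriv (F := E) (F' := F) (fun b : G => (b : G ⧸ H)) 1).map_add A Y
  rw [hA', zero_add] at h
  exact h.symm.trans hX

theorem IsQuotientManifold.finrank_complement (hM : IsQuotientManifold E F H)
    (hQ : IsAdInvariantInner Q) : Module.finrank ℝ (complement F H Q) = Module.finrank ℝ F := by
  let f : complement F H Q →ₗ[ℝ] F :=
    (modelDeriv (F := E) (F' := F) (fun b : G => (b : G ⧸ H)) 1).toLinearMap ∘ₗ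
      (complement F H Q).subtype
  refine (LinearEquiv.ofBijective f ⟨?_, hM.exists_projDeriv_eq hQ⟩).finrank_eq
  refine (injective_iff_map_eq_zero f).2 fun X hX => ?_
  by_contra hne
  exact (hQ.pos X fun h => hne (Subtype.ext h)).ne' (mem_complement.1 X.2 X hX)

/-- The metrics along the geodesic are positive definite. -/
theorem IsInvariantMetricOf.symm_pos (hM : IsQuotientManifold E F H)
    (hQ : IsAdInvariantInner Q) (hv : IsUnitDirection Q v)
    {t : ℝ} {g : G ⧸ H → LinearMap.BilinForm ℝ F}
    (hg : IsInvariantMetricOf Q (F := F) g (geodesic Q v t)) :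
    (∀ u w, g ((1 : G) : G ⧸ H) u w = g ((1 : G) : G ⧸ H) w u) ∧
      ∀ u, u ≠ 0 → 0 < g ((1 : G) : G ⧸ H) u u := by
  obtain ⟨e, μ, he, hμ⟩ := hv.exists_eigenbasis hQ
  refine ⟨fun u w => ?_, fun u hu => ?_⟩
  · obtain ⟨X, rfl⟩ := hM.exists_projDeriv_eq hQ u
    obtain ⟨Y, rfl⟩ := hM.exists_projDeriv_eq hQ w
    rw [← pullbackForm_apply, ← pullbackForm_apply, pullbackForm_eq_sum hQ hv hg he hμ,
      pullbackForm_eq_sum hQ hv hg he hμ]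
    exact Finset.sum_congr rfl fun j _ => by ring
  · obtain ⟨X, rfl⟩ := hM.exists_projDeriv_eq hQ u
    rw [← pullbackForm_apply, pullbackForm_eq_sum hQ hv hg he hμ]
    have h1 : ∃ j, Q X (e j) ≠ 0 := by
      by_contra! h
      have h2 := sum_eigenbasis he X
      simp only [h, zero_smul, Finset.sum_const_zero] at h2
      exact hu (by rw [← h2]; exact map_zero _)
    obtain ⟨j, hj⟩ := h1
    exact Finset.sum_pos' (fun i _ => mul_nonneg (Real.exp_pos _).le (mul_self_nonneg _))
      ⟨j, Finset.mem_univ _, mul_pos (Real.exp_pos _) (mul_self_pos.2 hj)⟩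

end Geodesic

/-! ### The lower bound on the norm of the Ricci tensor. -/

section RicciBound

variable {E : Type*} [NormedAddCommGroup E] [NormedSpace ℝ E] [FiniteDimensional ℝ E]
  {G : Type*} [TopologicalSpace G] [ChartedSpace E G] [Group G] [LieGroup 𝓘(ℝ, E) ∞ G]
  {F : Type*} [NormedAddCommGroup F] [NormedSpace ℝ F] [FiniteDimensional ℝ F]
  {H : Subgroup G} [ChartedSpace F (G ⧸ H)] [IsManifold 𝓘(ℝ, F) ∞ (G ⧸ H)]
  {Q : LinearMap.BilinForm ℝ (GroupLieAlgebra 𝓘(ℝ, E) G)}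
  {v : Module.End ℝ (complement F H Q)} {𝔨 : Submodule ℝ (GroupLieAlgebra 𝓘(ℝ, E) G)}

/-- The Ricci curvature of a Killing field tangent to `𝔨 ∩ 𝔪` is bounded below along the geodesic of
a `𝔨`-submersion direction, and the norm of the Ricci tensor is bounded accordingly. -/
theorem IsSubmersionDirectionFor.le_ricciNorm (hM : IsQuotientManifold E F H)
    (hQ : IsAdInvariantInner Q) (hv : IsSubmersionDirectionFor Q 𝔨 v)
    {e : Module.Basis (Fin (Module.finrank ℝ (complement F H Q))) ℝ (complement F H Q)}
    {μ : Fin (Module.finrank ℝ (complement F H Q)) → ℝ}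
    (he : ∀ i j, Q (e i) (e j) = if i = j then 1 else 0) (hμ : ∀ i, v (e i) = μ i • e i)
    {X : GroupLieAlgebra 𝓘(ℝ, E) G} (hX : X ∈ 𝔨 ⊓ complement F H Q)
    {t : ℝ} {g : G ⧸ H → LinearMap.BilinForm ℝ F}
    (hg : IsInvariantMetricOf Q (F := F) g (geodesic Q v t)) (a : G) :
    (1 / 4) * ∑ i, (if μ i = minEigenvalue Q v then
        Q ⁅X, (e i : GroupLieAlgebra 𝓘(ℝ, E) G)⁆ ⁅X, (e i : GroupLieAlgebra 𝓘(ℝ, E) G)⁆ else 0) ≤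
      ricciNormCoord (chartForm g (a : G ⧸ H)) (chartBase F H a) *
        (Real.exp (t * minEigenvalue Q v) * Q X X) := by
  have hu := hv.isSubmersionDirection.isUnitDirection
  obtain ⟨L, hL, hself⟩ := exists_bracket_bilinear (E := E) (G := G)
  have hgi : IsInvariantForm g := hg.invariant
  obtain ⟨hs, hp⟩ := hg.symm_pos hM hQ hu
  set c := minEigenvalue Q v
  let X' : complement F H Q := ⟨X, hX.2⟩
  have hvX : v X' = c • X' := hv.apply_eq hM hQ X' hX.1
  set b := pullbackForm (E := E) H g with hb
  have hbe : ∀ Y i, b Y (e i) = Real.exp (t * μ i) * Q Y (e i) := fun Y i =>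
    pullbackForm_apply_eigenvector hQ hu hg Y (hμ i)
  have hbX : ∀ Y, b Y X = Real.exp (t * c) * Q Y X := fun Y =>
    pullbackForm_apply_eigenvector hQ hu hg Y (Z := X') hvX
  have hbsum := pullbackForm_eq_sum hQ hu hg he hμ
  have hbs : ∀ Y Z, b Y Z = b Z Y := fun Y Z => by
    rw [hb, hbsum, hbsum]; exact Finset.sum_congr rfl fun j _ => by ring
  let U : Fin (Module.finrank ℝ (complement F H Q)) → GroupLieAlgebra 𝓘(ℝ, E) G :=
    fun i => Real.exp (-(t * μ i) / 2) • (e i : GroupLieAlgebra 𝓘(ℝ, E) G)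
  have hee : ∀ i, Real.exp (-(t * μ i) / 2) * Real.exp (-(t * μ i) / 2) * Real.exp (t * μ i) = 1 := by
    intro i
    rw [← Real.exp_add, ← Real.exp_add, Real.exp_eq_one_iff]; ring
  have hUU : ∀ i j, b (U i) (U j) = if i = j then 1 else 0 := by
    intro i j
    simp only [U, map_smul, LinearMap.smul_apply, smul_eq_mul, hbe, he]
    split_ifs with h
    · rw [h, mul_one, ← mul_assoc, hee]
    · simp
  have hbU : ∀ Y, b Y Y = ∑ j, b Y (U j) * b Y (U j) := by
    intro Y
    rw [hb, hbsum]
    refine Finset.sum_congr rfl fun j _ => ?_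
    simp only [U, map_smul, smul_eq_mul, ← hb, hbe]
    linear_combination (-(Real.exp (t * μ j) * (Q Y (e j) * Q Y (e j)))) * hee j
  have hskew : ∀ X Y Z, Q (L X Y) Z + Q Y (L X Z) = 0 := fun X Y Z => by
    rw [hL, hL]; exact hQ.skew X Y Z
  have hsum := le_ricci_sum hQ.symm hself hskew (fun i => (e i : GroupLieAlgebra 𝓘(ℝ, E) G)) U μ X
    c t (fun i => rfl) (fun i j hij => by
      rw [hL]; exact hv.lie_eq_zero hM hQ hX (hμ i) (hμ j) hij) b hbs hbe hbX hbU (sum_sq_le hQ he)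
  set y₀ := chartBase F H a
  set h := chartForm g (a : G ⧸ H)
  have hd := hgi.contDiffAt_chartForm hM (a : G ⧸ H)
  have htgt := extChartAt_target_mem (a : G ⧸ H)
    (mem_extChartAt_target (I := 𝓘(ℝ, F)) (a : G ⧸ H))
  have hsy : ∀ᶠ y in 𝓝 y₀, ∀ u w, h y u w = h y w u := by
    filter_upwards [htgt] with y hy using (hgi.chartForm_symm_pos hM hs hp _ hy).1
  have hpy : ∀ᶠ y in 𝓝 y₀, ∀ u, u ≠ 0 → 0 < h y u u := by
    filter_upwards [htgt] with y hy using (hgi.chartForm_symm_pos hM hs hp _ hy).2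
  obtain ⟨K, hfam, hK, hsurj⟩ : ∃ K : GroupLieAlgebra 𝓘(ℝ, E) G → F → F,
      IsKillingFamily (fun y => LinearMap.toContinuousBilinearMap (h y)) y₀ K (fun X Y => L Y X) ∧
      (∀ Y Z, h y₀ (K Y y₀) (K Z y₀) = b Y Z) ∧ ∀ u, ∃ Y, K Y y₀ = u := by
    refine ⟨killingField (E := E) F H a, ?_, chartForm_killingField hM hgi a, fun u => ?_⟩
    · simp only [hL]
      exact hgi.isKillingFamily hM a
    obtain ⟨Y, hY⟩ := hM.exists_projDeriv_eq hQ
      (modelDeriv (F := F) (F' := F) (fun q : G ⧸ H => a⁻¹ • q) (a : G ⧸ H) u)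
    have h1 : a⁻¹ • (a : G ⧸ H) = ((1 : G) : G ⧸ H) := by
      change ((a⁻¹ * a : G) : G ⧸ H) = _
      rw [inv_mul_cancel]
    have h2 := hM.modelDeriv_smul_inv a (a : G ⧸ H) u
    rw [h1, ← hY] at h2
    exact ⟨Y, (killingField_base hM a _).trans h2⟩
  -- The stationarity condition holds because `b(·,X)` is a multiple of `Q(·,X)` and `Q([X,Z],X) =
  -- 0`.
  have hricci := hfam.ricci_eq (h := h) (fun y u w => rfl) hd hsy hpy hsurj X
    (fun Z => by
      rw [hK, hbX, apply_bracket_cycle hQ.symm hself hskew,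
        apply_bracket_cycle hQ.symm hself hskew, hself]
      simp) U (fun i j => by rw [hK, hUU]) (by rw [Fintype.card_fin, hM.finrank_complement hQ])
  have hle := ricci_le (h := h) (y₀ := y₀) (fun y u w => rfl) hd hsy hpy (K X y₀)
  simp only [hK] at hricci hle
  rw [hbX] at hle
  simp only [← hL]
  exact (hsum.trans hricci.ge).trans hle

/-- The constant uses a single `X` and a single eigenbasis, fixed before `t` and the point are
chosen; hence the estimate is uniform in both. -/
theorem IsSubmersionDirectionFor.exists_le_ricciNorm (hM : IsQuotientManifold E F H)
    (hQ : IsAdInvariantInner Q) (hk : IsHSubalgebra F H 𝔨) (hnt : ¬ IsToral F H 𝔨)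
    (hv : IsSubmersionDirectionFor Q 𝔨 v) : ∃ κ > 0, ∀ (t : ℝ)
      (g : G ⧸ H → LinearMap.BilinForm ℝ F), IsInvariantMetricOf Q (F := F) g (geodesic Q v t) →
      ∀ a : G, κ * Real.exp (t * -minEigenvalue Q v) ≤
        ricciNormCoord (chartForm g (a : G ⧸ H)) (chartBase F H a) := by
  obtain ⟨L, hL, hself⟩ := exists_bracket_bilinear (E := E) (G := G)
  obtain ⟨e, μ, he, hμ⟩ := hv.isSubmersionDirection.isUnitDirection.exists_eigenbasis hQ
  obtain ⟨X, hX, Y, hY, hXY⟩ := hk.exists_lie_ne_zero hM hQ hnt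
  have hXX : 0 < Q X X := hQ.pos X fun h => hXY (by rw [h, ← hL]; simp)
  have hnn : ∀ Z, 0 ≤ Q Z Z := fun Z => by
    by_cases h : Z = 0
    · simp [h]
    · exact (hQ.pos Z h).le
  set κ := (1 / 4) * ∑ i, (if μ i = minEigenvalue Q v then
    Q ⁅X, (e i : GroupLieAlgebra 𝓘(ℝ, E) G)⁆ ⁅X, (e i : GroupLieAlgebra 𝓘(ℝ, E) G)⁆ else 0) with hκ
  have hκ0 : 0 < κ := by
    -- `Y` is a minimal eigenvector, so it expands in the basis vectors with minimal eigenvalue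
    -- alone; if `X` commuted with all of them, `[X,Y]` would vanish.
    obtain ⟨i, hi, hne⟩ : ∃ i, μ i = minEigenvalue Q v ∧ L X (e i) ≠ 0 := by
      by_contra! h
      refine hXY ?_
      have hY' := hv.apply_eq hM hQ ⟨Y, hY.2⟩ hY.1
      have h1 := congrArg Subtype.val (sum_eigenbasis he ⟨Y, hY.2⟩)
      rw [← hL, show L X Y = L X _ from congrArg _ h1.symm]
      simp only [Submodule.coe_sum, Submodule.coe_smul, map_sum, map_smul]
      refine Finset.sum_eq_zero fun i _ => ?_
      by_cases hi : μ i = minEigenvalue Q v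
      · rw [h i hi, smul_zero]
      · have h2 := hv.isSubmersionDirection.isUnitDirection.symm ⟨Y, hY.2⟩ (e i)
        rw [hY', hμ] at h2
        simp only [Submodule.coe_smul, map_smul, LinearMap.smul_apply, smul_eq_mul] at h2
        have h3 : (μ i - minEigenvalue Q v) * Q Y (e i) = 0 := by linear_combination -h2
        rw [(mul_eq_zero.1 h3).resolve_left (sub_ne_zero.2 hi), zero_smul]
    refine mul_pos (by norm_num) (Finset.sum_pos' (fun j _ => ?_) ⟨i, Finset.mem_univ _, ?_⟩)
    · split_ifs
      · exact hnn _
      · exact le_rfl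
    · rw [if_pos hi, ← hL]; exact hQ.pos _ hne
  refine ⟨κ / Q X X, div_pos hκ0 hXX, fun t g hg a => ?_⟩
  have h := hv.le_ricciNorm hM hQ he hμ hX hg a
  rw [← hκ] at h
  rw [mul_neg, Real.exp_neg, ← div_eq_mul_inv, div_div, div_le_iff₀ (by positivity), mul_comm (Q X X)]
  exact h

end RicciBound

end HomogeneousSpace

end

theorem mainTheorem8
    {E : Type*} [NormedAddCommGroup E] [NormedSpace ℝ E] [FiniteDimensional ℝ E]
    {G : Type*} [TopologicalSpace G] [ChartedSpace E G] [Group G]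
    [LieGroup 𝓘(ℝ, E) ∞ G] [CompactSpace G] [T2Space G]
    {F : Type*} [NormedAddCommGroup F] [NormedSpace ℝ F] [FiniteDimensional ℝ F]
    (H : Subgroup G) (hH : IsClosed (H : Set G))
    [ChartedSpace F (G ⧸ H)] [IsManifold 𝓘(ℝ, F) ∞ (G ⧸ H)]
    (hM : HomogeneousSpace.IsQuotientManifold E F H)
    [ConnectedSpace (G ⧸ H)]
    (heff : DiscreteTopology H.normalCore)
    (Q : LinearMap.BilinForm ℝ (GroupLieAlgebra 𝓘(ℝ, E) G))
    (hQ : HomogeneousSpace.IsAdInvariantInner Q)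
    (𝔨₁ : Submodule ℝ (GroupLieAlgebra 𝓘(ℝ, E) G))
    (hk : HomogeneousSpace.IsHSubalgebra F H 𝔨₁)
    (hnt : ¬ HomogeneousSpace.IsToral F H 𝔨₁)
    (v : Module.End ℝ (HomogeneousSpace.complement F H Q))
    (hv : HomogeneousSpace.IsSubmersionDirectionFor Q 𝔨₁ v)
    (g : ℝ → ∀ x : G ⧸ H, LinearMap.BilinForm ℝ (TangentSpace 𝓘(ℝ, F) x))
    (hg : ∀ t : ℝ, HomogeneousSpace.IsInvariantMetricOf Q (g t)
      (HomogeneousSpace.geodesic Q v t)) :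
    ∀ x : G ⧸ H,
      Filter.Tendsto (fun t : ℝ => HomogeneousSpace.ricciNorm (g t) x)
        Filter.atTop Filter.atTop := by
  intro x
  obtain ⟨a, rfl⟩ := QuotientGroup.mk_surjective x
  obtain ⟨κ, hκ, h⟩ := hv.exists_le_ricciNorm hM hQ hk hnt
  have hneg := hv.isSubmersionDirection.isUnitDirection.minEigenvalue_neg hQ
  -- The bound is stated in the chart at `aH`, the chart in which the norm at that point is defined,
  -- so it applies by unfolding definitions.
  refine Filter.tendsto_atTop_mono (fun t => h t (g t) (hg t) a) ?_
  exact (Real.tendsto_exp_atTop.comp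
    (Filter.tendsto_id.atTop_mul_const (neg_pos.2 hneg))).const_mul_atTop hκ
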